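/- **Setting.** Let $M$ be a smooth manifold of dimension $n$ (Hausdorff, $\sigma$-compact, without boundary, not necessarily connected or compact), with a volume form $v$ (a nowhere vanishing $n$-form) and an orientation; let $k$ be an odd integer. The functions on $T^*[k]M$ are the multivector fields, $\mathbf C^\infty(T^*[k]M)=\Lambda_{C^\infty(M)}\mathrm{Der}(C^\infty(M))=\mathcal X(M)$, an $i$-vector field having degree $ki$. Let $[\cdot,\cdot]$ be the canonical Poisson (Schouten) bracket: the graded biderivation that extends the Lie bracket of vector fields and satisfies $[Y,f]=Y(f)=-[f,Y]$ and $[f,g]=0$ for vector fields $Y$ and functions $f,g$ on $M$. For $X\in\mathbf C^\infty(T^*[k]M)$ let $Q_X:=[X,\cdot\,]$. Let $\phi_v(X)=\iota_Xv$, with $\iota_{XY}=\iota_X\iota_Y$ and $\iota_Y\omega=\omega(Y,\dots)$ for a vector field $Y$ (the convention for which $\Delta_v(XY)=\Delta_v(X)Y+(-1)^iX\Delta_v(Y)+(-1)^{i+1}[X,Y]$ for $X\in\mathcal X^i(M)$). The BV Laplacian is $\Delta_v=\phi_v^{-1}\circ d\circ\phi_v$, i.e. $Z=\Delta_vX$ means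 $\phi_v(Z)=d\,\phi_v(X)$. The Berezinian form $\rho_v$ is defined by $\int_{T^*[k]M}P\,\rho_v=\int_M\phi_v(P)\,v$, where only the degree-$0$ component of $\phi_v(P)$ contributes. A divergence $\mathrm{div}_{\rho_v}Q$ of a vector field $Q$ on $T^*[k]M$ is a function with $$\int_{T^*[k]M}Q(f)\,\rho_v=-\int_{T^*[k]M}f\,(\mathrm{div}_{\rho_v}Q)\,\rho_v$$ for all $f\in\mathbf C^\infty(T^*[k]M)$ with compact support (all $f$ if $M$ is compact). **Theorem.** Let $X\in\mathbf C^\infty(T^*[k]M)$ be homogeneous of degree $m$ (that is, an $i$-vector field with $m=ki$). Then $Q_X$ is a vector field of degree $m-k$ on $T^*[k]M$, i.e. a graded derivation of that degree of $\mathbf C^\infty(T^*[k]M)$; there is a multivector field $Z$ with $\phi_v(Z)=d\,\phi_v(X)$; and $$\Delta_vX=\tfrac12\,(-1)^{n(m+1)}\,\mathrm{div}_{\rho_v}Q_X ,$$ in the sense that a multivector field $Z$ satisfies $\phi_v(Z)=d\,\phi_v(X)$ if and only if $2(-1)^{n(m+1)}Z$ is a divergence of $Q_X$ with respect to $\rho_v$.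 In particular $\Delta_vX=\frac12\mathrm{div}_{\rho_v}Q_X$ whenever $n$ is even or $X$ is of odd degree. If $M$ is compact, $\phi_v$ is moreover a bijection from multivector fields to differential forms, so that $\Delta_vX$ and $\mathrm{div}_{\rho_v}Q_X$ are unique. -/

import Mathlib

open scoped Manifold ContDiff

noncomputable section

namespace BVGeom

section Algebra

variable (A : Type*) [CommRing A] [Algebra ℝ A]

/-- The `A`-module of vector fields, i.e. of `ℝ`-linear derivations of the function algebra `A`. -/
abbrev VF := Derivation ℝ A A

/-- The algebra of polynomial functions on the shifted cotangent bundle `T*[k]M` for odd `k`: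
the free graded commutative `A`-algebra on `Der(A)[-k]`. As `k` is odd (and `2` is invertible) this
is the exterior algebra of `Der(A)` over `A`, i.e. the algebra of multivector fields. -/
abbrev MV := ExteriorAlgebra A (VF A)

variable {A}

/-- The function on `T*[k]M` defined by a function on `M`. -/
abbrev ofFun (f : A) : MV A := algebraMap A (MV A) f

/-- The function on `T*[k]M` defined by a vector field on `M`. -/
abbrev ofVF (D : VF A) : MV A := ExteriorAlgebra.ι A D

/-- The multivector fields that have degree `m` as functions on `T*[k]M`: a `p`-vector field has
degree `k * p`. -/
def degreePart (k m : ℤ) : Submodule A (MV A) :=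
  ⨆ (p : ℕ) (_ : k * (p : ℤ) = m), ⋀[A]^p (VF A)

/-- Vector fields of degree `d` on `T*[k]M`: graded derivations of degree `d` of its algebra of
functions. -/
structure IsGradedVectorField (k d : ℤ) (Q : MV A →ₗ[ℝ] MV A) : Prop where
  degree : ∀ (m : ℤ) (P : MV A), P ∈ degreePart k m → Q P ∈ degreePart (A := A) k (m + d)
  leibniz : ∀ (m : ℤ) (P R : MV A), P ∈ degreePart k m →
    Q (P * R) = Q P * R + (-1 : ℝ) ^ (d * m) • (P * Q R)

/-! ### The Lie derivative of multivector fields -/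

/-- Auxiliary module for the construction of the Lie derivative along `D`: pairs `(P, T)`, to be
thought of as `T = L_D P`, with `f • (P, T) = (f P, f T + D(f) P)`. -/
def LieAux (_ : VF A) : Type _ := MV A × MV A

instance (D : VF A) : AddCommGroup (LieAux D) := inferInstanceAs (AddCommGroup (MV A × MV A))

instance (D : VF A) : Module A (LieAux D) where
  smul f x := (f • x.1, f • x.2 + D f • x.1)
  one_smul x := by
    refine Prod.ext (one_smul A x.1) ?_
    change (1 : A) • x.2 + D 1 • x.1 = x.2
    simp
  mul_smul f g x := by
    refine Prod.ext (mul_smul f g x.1) ?_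
    change (f * g) • x.2 + D (f * g) • x.1 = f • (g • x.2 + D g • x.1) + D f • (g • x.1)
    rw [D.leibniz]
    simp only [smul_eq_mul, add_smul, mul_smul, smul_add]
    rw [smul_comm g (D f), add_assoc]
  smul_zero f := by
    refine Prod.ext (smul_zero f) ?_
    change f • (0 : MV A) + D f • (0 : MV A) = 0
    simp
  smul_add f x y := by
    refine Prod.ext (smul_add f x.1 y.1) ?_
    change f • (x.2 + y.2) + D f • (x.1 + y.1)
      = (f • x.2 + D f • x.1) + (f • y.2 + D f • y.1)
    simp only [smul_add]; abel
  add_smul f g x := by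
    refine Prod.ext (add_smul f g x.1) ?_
    change (f + g) • x.2 + D (f + g) • x.1
      = (f • x.2 + D f • x.1) + (g • x.2 + D g • x.1)
    simp only [map_add, add_smul]; abel
  zero_smul x := by
    refine Prod.ext (zero_smul A x.1) ?_
    change (0 : A) • x.2 + D 0 • x.1 = 0
    simp

theorem LieAux.smul_def (D : VF A) (f : A) (x : LieAux D) :
    f • x = ((f • x.1, f • x.2 + D f • x.1) : MV A × MV A) := rfl

/-- Left multiplication by a vector field `Y` on pairs `(P, L_D P)`. -/
def lieAuxMul (D : VF A) : VF A →ₗ[A] Module.End A (LieAux D) where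
  toFun Y :=
    { toFun := fun x => ((ofVF Y * x.1, ofVF Y * x.2 + ofVF ⁅D, Y⁆ * x.1) : MV A × MV A)
      map_add' := fun x y => by
        refine Prod.ext (mul_add _ x.1 y.1) ?_
        change ofVF Y * (x.2 + y.2) + ofVF ⁅D, Y⁆ * (x.1 + y.1)
          = (ofVF Y * x.2 + ofVF ⁅D, Y⁆ * x.1) + (ofVF Y * y.2 + ofVF ⁅D, Y⁆ * y.1)
        simp only [mul_add]; abel
      map_smul' := fun f x => by
        refine Prod.ext (mul_smul_comm f _ x.1) ?_
        change ofVF Y * (f • x.2 + D f • x.1) + ofVF ⁅D, Y⁆ * (f • x.1)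
          = f • (ofVF Y * x.2 + ofVF ⁅D, Y⁆ * x.1) + D f • (ofVF Y * x.1)
        simp only [mul_add, mul_smul_comm, smul_add]; abel }
  map_add' Y Z := by
    refine LinearMap.ext fun x => Prod.ext ?_ ?_
    · change ofVF (Y + Z) * x.1 = ofVF Y * x.1 + ofVF Z * x.1
      simp [ofVF, add_mul]
    · change ofVF (Y + Z) * x.2 + ofVF ⁅D, Y + Z⁆ * x.1
        = (ofVF Y * x.2 + ofVF ⁅D, Y⁆ * x.1) + (ofVF Z * x.2 + ofVF ⁅D, Z⁆ * x.1)
      simp only [ofVF, lie_add, map_add, add_mul]; abel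
  map_smul' f Y := by
    refine LinearMap.ext fun x => Prod.ext ?_ ?_
    · change ofVF (f • Y) * x.1 = f • (ofVF Y * x.1)
      simp [ofVF]
    · change ofVF (f • Y) * x.2 + ofVF ⁅D, f • Y⁆ * x.1
        = f • (ofVF Y * x.2 + ofVF ⁅D, Y⁆ * x.1) + D f • (ofVF Y * x.1)
      have h : ⁅D, f • Y⁆ = f • ⁅D, Y⁆ + D f • Y := by
        ext a
        simp only [Derivation.commutator_apply, Derivation.smul_apply, Derivation.add_apply,
          smul_eq_mul, Derivation.leibniz]
        ring
      simp only [ofVF, h, map_add, map_smul, add_mul, smul_mul_assoc, smul_add]; abel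

theorem ofVF_mul_ofVF (Y : VF A) : ofVF Y * ofVF Y = 0 := ExteriorAlgebra.ι_sq_zero Y

theorem ofVF_anticomm (Y Z : VF A) : ofVF Y * ofVF Z = -(ofVF Z * ofVF Y) :=
  eq_neg_of_add_eq_zero_left (ExteriorAlgebra.ι_add_mul_swap Y Z)

theorem lieAuxMul_sq (D Y : VF A) : lieAuxMul D Y * lieAuxMul D Y = 0 := by
  refine LinearMap.ext fun x => Prod.ext ?_ ?_
  · change ofVF Y * (ofVF Y * x.1) = 0
    rw [← mul_assoc, ofVF_mul_ofVF, zero_mul]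
  · change ofVF Y * (ofVF Y * x.2 + ofVF ⁅D, Y⁆ * x.1) + ofVF ⁅D, Y⁆ * (ofVF Y * x.1) = 0
    rw [mul_add, ← mul_assoc, ← mul_assoc, ← mul_assoc, ofVF_mul_ofVF, ofVF_anticomm Y ⁅D, Y⁆]
    simp

/-- Left multiplication by a multivector field on pairs `(P, L_D P)`. -/
def lieAuxLift (D : VF A) : MV A →ₐ[A] Module.End A (LieAux D) :=
  ExteriorAlgebra.lift A ⟨lieAuxMul D, lieAuxMul_sq D⟩

/-- The pair `(1, 0) = (1, L_D 1)`. -/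
def lieAuxOne (D : VF A) : LieAux D := ((1, 0) : MV A × MV A)

theorem lieAuxLift_fst (D : VF A) (P : MV A) : (lieAuxLift D P (lieAuxOne D)).1 = P := by
  induction P using CliffordAlgebra.left_induction with
  | algebraMap f =>
    rw [AlgHom.commutes]
    change f • (1 : MV A) = _
    rw [Algebra.smul_def, mul_one]
  | add x y hx hy =>
    rw [map_add]
    change (lieAuxLift D x (lieAuxOne D)).1 + (lieAuxLift D y (lieAuxOne D)).1 = _
    rw [hx, hy]
  | ι_mul x Y hx =>
    rw [map_mul]
    have : lieAuxLift D (CliffordAlgebra.ι 0 Y) = lieAuxMul D Y :=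
      ExteriorAlgebra.lift_ι_apply A _ _ Y
    rw [this]
    change ofVF Y * (lieAuxLift D x (lieAuxOne D)).1 = _
    rw [hx]

/-- The Lie derivative `L_D` of multivector fields along `D`: the derivation of the algebra of
multivector fields that extends `f ↦ D(f)` and `Y ↦ [D, Y]`. -/
def lieDerivative (D : VF A) : MV A →ₗ[ℝ] MV A where
  toFun P := (lieAuxLift D P (lieAuxOne D)).2
  map_add' P R := by rw [map_add]; rfl
  map_smul' r P := by
    rw [← algebraMap_smul A r P, map_smul]
    change algebraMap ℝ A r • (lieAuxLift D P (lieAuxOne D)).2 +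
      D (algebraMap ℝ A r) • (lieAuxLift D P (lieAuxOne D)).1 = _
    rw [D.map_algebraMap, zero_smul, add_zero, algebraMap_smul]; rfl

theorem lieDerivative_ofFun (D : VF A) (f : A) : lieDerivative D (ofFun f) = ofFun (D f) := by
  change (lieAuxLift D (algebraMap A (MV A) f) (lieAuxOne D)).2 = _
  rw [AlgHom.commutes]
  change f • (0 : MV A) + D f • (1 : MV A) = _
  rw [smul_zero, zero_add, Algebra.smul_def, mul_one]

theorem lieDerivative_ofVF_mul (D Y : VF A) (P : MV A) :
    lieDerivative D (ofVF Y * P) = ofVF ⁅D, Y⁆ * P + ofVF Y * lieDerivative D P := by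
  change (lieAuxLift D (ofVF Y * P) (lieAuxOne D)).2 = _
  rw [map_mul]
  have : lieAuxLift D (ofVF Y) = lieAuxMul D Y := ExteriorAlgebra.lift_ι_apply A _ _ Y
  rw [this]
  change ofVF Y * (lieAuxLift D P (lieAuxOne D)).2
    + ofVF ⁅D, Y⁆ * (lieAuxLift D P (lieAuxOne D)).1 = _
  rw [lieAuxLift_fst, add_comm]; rfl

/-! ### The canonical Poisson bracket (the Schouten bracket) -/

/-- The differential of `f`, as an `A`-linear form on vector fields. -/
def dFun (f : A) : Module.Dual A (VF A) where
  toFun D := D f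
  map_add' _ _ := rfl
  map_smul' _ _ := rfl

/-- The operator `[f, ·]` for a function `f` on `M`: minus the contraction with `df`, i.e. the
graded derivation with `[f, g] = 0` and `[f, Y] = -Y(f)`. -/
def funBracket (f : A) : MV A →ₗ[ℝ] MV A :=
  -((CliffordAlgebra.contractLeft (Q := (0 : QuadraticForm A (VF A))) (dFun f)).restrictScalars ℝ)

theorem funBracket_ofFun (f g : A) : funBracket f (ofFun g) = 0 := by
  change -(CliffordAlgebra.contractLeft (Q := (0 : QuadraticForm A (VF A))) (dFun f) _) = 0
  rw [CliffordAlgebra.contractLeft_algebraMap, neg_zero]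

theorem funBracket_ofVF_mul (f : A) (Y : VF A) (P : MV A) :
    funBracket f (ofVF Y * P) = -(Y f • P) - ofVF Y * funBracket f P := by
  change -(CliffordAlgebra.contractLeft (Q := (0 : QuadraticForm A (VF A))) (dFun f) _) =
    _ - _ * -(CliffordAlgebra.contractLeft (Q := (0 : QuadraticForm A (VF A))) (dFun f) P)
  have := CliffordAlgebra.contractLeft_ι_mul (Q := (0 : QuadraticForm A (VF A)))
    (d := dFun f) Y P
  rw [show ofVF Y * P = CliffordAlgebra.ι (0 : QuadraticForm A (VF A)) Y * P from rfl, this]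
  change -(Y f • P - ofVF Y * _) = _
  rw [mul_neg, sub_neg_eq_add, neg_sub]; abel

theorem funBracket_mul (f g : A) (P : MV A) :
    funBracket (f * g) P = f • funBracket g P + g • funBracket f P := by
  have h : dFun (f * g) = f • dFun g + g • dFun f := by
    refine LinearMap.ext fun D => ?_
    exact D.leibniz f g
  change -(CliffordAlgebra.contractLeft (Q := (0 : QuadraticForm A (VF A))) _ P) =
    f • -(CliffordAlgebra.contractLeft (Q := (0 : QuadraticForm A (VF A))) _ P) +
    g • -(CliffordAlgebra.contractLeft (Q := (0 : QuadraticForm A (VF A))) _ P)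
  rw [h, map_add, map_smul, map_smul]
  simp only [LinearMap.add_apply, LinearMap.smul_apply, smul_neg]; abel

theorem funBracket_add (f g : A) : funBracket (f + g) = funBracket f + funBracket g := by
  have h : dFun (f + g) = dFun f + dFun g := LinearMap.ext fun D => map_add D f g
  refine LinearMap.ext fun P => ?_
  change -(CliffordAlgebra.contractLeft (Q := (0 : QuadraticForm A (VF A))) _ P) =
    -(CliffordAlgebra.contractLeft (Q := (0 : QuadraticForm A (VF A))) _ P) +
    -(CliffordAlgebra.contractLeft (Q := (0 : QuadraticForm A (VF A))) _ P)
  rw [h, map_add, LinearMap.add_apply, neg_add]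

theorem funBracket_algebraMap (r : ℝ) : funBracket (algebraMap ℝ A r) = 0 := by
  have h : dFun (algebraMap ℝ A r) = 0 := LinearMap.ext fun D => D.map_algebraMap r
  refine LinearMap.ext fun P => ?_
  change -(CliffordAlgebra.contractLeft (Q := (0 : QuadraticForm A (VF A))) _ P) = 0
  rw [h, map_zero, LinearMap.zero_apply, neg_zero]

theorem funBracket_smul (f g : A) (P : MV A) : funBracket f (g • P) = g • funBracket f P := by
  change -(CliffordAlgebra.contractLeft (Q := (0 : QuadraticForm A (VF A))) _ _) =
    g • -(CliffordAlgebra.contractLeft (Q := (0 : QuadraticForm A (VF A))) _ P)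
  rw [map_smul, smul_neg]

theorem lieDerivative_fsmul (D : VF A) (f : A) (P : MV A) :
    lieDerivative D (f • P) = f • lieDerivative D P + D f • P := by
  change (lieAuxLift D (f • P) (lieAuxOne D)).2 = _
  rw [map_smul]
  change f • (lieAuxLift D P (lieAuxOne D)).2 + D f • (lieAuxLift D P (lieAuxOne D)).1 = _
  rw [lieAuxLift_fst]; rfl

theorem lieDerivative_smul (g : A) (D : VF A) (P : MV A) :
    lieDerivative (g • D) P = g • lieDerivative D P + ofVF D * funBracket g P := by
  induction P using CliffordAlgebra.left_induction with
  | algebraMap f =>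
    change lieDerivative (g • D) (ofFun f) = g • lieDerivative D (ofFun f)
      + ofVF D * funBracket g (ofFun f)
    rw [lieDerivative_ofFun, lieDerivative_ofFun, funBracket_ofFun, mul_zero, add_zero]
    simp [ofFun, Algebra.smul_def]
  | add x y hx hy => simp only [map_add, hx, hy, smul_add, mul_add]; abel
  | ι_mul x Y hx =>
    change lieDerivative (g • D) (ofVF Y * x) = g • lieDerivative D (ofVF Y * x)
      + ofVF D * funBracket g (ofVF Y * x)
    have h : ⁅g • D, Y⁆ = g • ⁅D, Y⁆ - Y g • D := by
      ext a
      simp only [Derivation.commutator_apply, Derivation.smul_apply, Derivation.sub_apply,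
        smul_eq_mul, Derivation.leibniz]
      ring
    have h' : ofVF (⁅g • D, Y⁆) = g • ofVF ⁅D, Y⁆ - Y g • ofVF D := by
      simp only [ofVF, h, map_sub, map_smul]
    have h3 : ofVF Y * (ofVF D * funBracket g x) = -(ofVF D * (ofVF Y * funBracket g x)) := by
      rw [← mul_assoc, ofVF_anticomm Y D, neg_mul, mul_assoc]
    rw [lieDerivative_ofVF_mul, lieDerivative_ofVF_mul, funBracket_ofVF_mul, hx, h', mul_add, h3]
    simp only [sub_mul, smul_mul_assoc, smul_add, mul_smul_comm, mul_sub, mul_neg]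
    abel

theorem lieDerivative_add (D D' : VF A) (P : MV A) :
    lieDerivative (D + D') P = lieDerivative D P + lieDerivative D' P := by
  induction P using CliffordAlgebra.left_induction with
  | algebraMap f =>
    change lieDerivative (D + D') (ofFun f) = lieDerivative D (ofFun f) + lieDerivative D' (ofFun f)
    simp only [lieDerivative_ofFun, Derivation.add_apply, ofFun, map_add]
  | add x y hx hy => simp only [map_add, hx, hy]; abel
  | ι_mul x Y hx =>
    change lieDerivative (D + D') (ofVF Y * x)
      = lieDerivative D (ofVF Y * x) + lieDerivative D' (ofVF Y * x)
    simp only [lieDerivative_ofVF_mul, hx, ofVF, add_lie, map_add, add_mul, mul_add]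
    abel

variable (A) in
/-- Auxiliary module for the construction of the bracket: pairs `(P, S)`, to be thought of as
`S = [P, ·]`, with `f • (P, S) = (f P, f S + P [f, ·])`. -/
def BrAux : Type _ := MV A × (MV A →ₗ[ℝ] MV A)

instance : AddCommGroup (BrAux A) :=
  inferInstanceAs (AddCommGroup (MV A × (MV A →ₗ[ℝ] MV A)))

instance : Module A (BrAux A) where
  smul f x := (f • x.1, f • x.2 + (LinearMap.mulLeft ℝ x.1) ∘ₗ funBracket f)
  one_smul x := by
    refine Prod.ext (one_smul A x.1) (LinearMap.ext fun R => ?_)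
    change (1 : A) • x.2 R + x.1 * funBracket (1 : A) R = x.2 R
    have := funBracket_algebraMap (A := A) 1
    rw [map_one] at this
    rw [this]; simp
  mul_smul f g x := by
    refine Prod.ext (mul_smul f g x.1) (LinearMap.ext fun R => ?_)
    change (f * g) • x.2 R + x.1 * funBracket (f * g) R
      = f • (g • x.2 R + x.1 * funBracket g R) + (g • x.1) * funBracket f R
    rw [funBracket_mul]
    simp only [mul_smul, smul_add, mul_add, smul_mul_assoc, mul_smul_comm, add_assoc]
  smul_zero f := by
    refine Prod.ext (smul_zero f) (LinearMap.ext fun R => ?_)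
    change f • (0 : MV A) + 0 * funBracket f R = 0
    simp
  smul_add f x y := by
    refine Prod.ext (smul_add f x.1 y.1) (LinearMap.ext fun R => ?_)
    change f • (x.2 R + y.2 R) + (x.1 + y.1) * funBracket f R
      = (f • x.2 R + x.1 * funBracket f R) + (f • y.2 R + y.1 * funBracket f R)
    simp only [smul_add, add_mul]; abel
  add_smul f g x := by
    refine Prod.ext (add_smul f g x.1) (LinearMap.ext fun R => ?_)
    change (f + g) • x.2 R + x.1 * funBracket (f + g) R
      = (f • x.2 R + x.1 * funBracket f R) + (g • x.2 R + x.1 * funBracket g R)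
    simp only [funBracket_add, LinearMap.add_apply, mul_add, add_smul]; abel
  zero_smul x := by
    refine Prod.ext (zero_smul A x.1) (LinearMap.ext fun R => ?_)
    change (0 : A) • x.2 R + x.1 * funBracket (0 : A) R = 0
    have := funBracket_algebraMap (A := A) 0
    rw [map_zero] at this
    rw [this]; simp

/-- Left multiplication by a vector field `D` on pairs `(P, [P, ·])`, according to the graded
Leibniz rule `[D P, R] = D [P, R] + (-1)^p P [D, R]` for a `p`-vector field `P`, with
`[D, R] = L_D R`. -/
def brAuxMul : VF A →ₗ[A] Module.End A (BrAux A) where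
  toFun D :=
    { toFun := fun x => ((ofVF D * x.1, (LinearMap.mulLeft ℝ (ofVF D)) ∘ₗ x.2 +
        (LinearMap.mulLeft ℝ (CliffordAlgebra.involute x.1)) ∘ₗ lieDerivative D) :
        MV A × (MV A →ₗ[ℝ] MV A))
      map_add' := fun x y => by
        refine Prod.ext (mul_add _ x.1 y.1) (LinearMap.ext fun R => ?_)
        change ofVF D * (x.2 R + y.2 R) + CliffordAlgebra.involute (x.1 + y.1) * lieDerivative D R
          = (ofVF D * x.2 R + CliffordAlgebra.involute x.1 * lieDerivative D R) +
            (ofVF D * y.2 R + CliffordAlgebra.involute y.1 * lieDerivative D R)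
        simp only [map_add, mul_add, add_mul]; abel
      map_smul' := fun f x => by
        refine Prod.ext (mul_smul_comm f _ x.1) (LinearMap.ext fun R => ?_)
        change ofVF D * (f • x.2 R + x.1 * funBracket f R) +
            CliffordAlgebra.involute (f • x.1) * lieDerivative D R
          = f • (ofVF D * x.2 R + CliffordAlgebra.involute x.1 * lieDerivative D R) +
            (ofVF D * x.1) * funBracket f R
        simp only [map_smul, mul_add, smul_mul_assoc, mul_smul_comm, smul_add, mul_assoc]; abel }
  map_add' Y Z := by
    refine LinearMap.ext fun x => Prod.ext ?_ (LinearMap.ext fun R => ?_)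
    · change ofVF (Y + Z) * x.1 = ofVF Y * x.1 + ofVF Z * x.1
      simp [ofVF, add_mul]
    · change ofVF (Y + Z) * x.2 R + CliffordAlgebra.involute x.1 * lieDerivative (Y + Z) R
        = (ofVF Y * x.2 R + CliffordAlgebra.involute x.1 * lieDerivative Y R) +
          (ofVF Z * x.2 R + CliffordAlgebra.involute x.1 * lieDerivative Z R)
      simp only [ofVF, lieDerivative_add, map_add, add_mul, mul_add]; abel
  map_smul' f D := by
    refine LinearMap.ext fun x => Prod.ext ?_ (LinearMap.ext fun R => ?_)
    · change ofVF (f • D) * x.1 = f • (ofVF D * x.1)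
      simp [ofVF]
    · change ofVF (f • D) * x.2 R + CliffordAlgebra.involute x.1 * lieDerivative (f • D) R
        = f • (ofVF D * x.2 R + CliffordAlgebra.involute x.1 * lieDerivative D R) +
          (ofVF D * x.1) * funBracket f R
      have h : CliffordAlgebra.involute x.1 * ofVF D = ofVF D * x.1 := by
        have key : ∀ P : MV A, CliffordAlgebra.involute P * ofVF D = ofVF D * P := by
          intro P
          induction P using CliffordAlgebra.left_induction with
          | algebraMap f =>
            rw [AlgHom.commutes]; exact Algebra.commutes f _
          | add x y hx hy => rw [map_add, add_mul, mul_add, hx, hy]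
          | ι_mul x Y hx =>
            rw [map_mul, CliffordAlgebra.involute_ι, mul_assoc, hx, ← mul_assoc, ← mul_assoc,
              neg_mul]
            change -(ofVF Y * ofVF D) * x = ofVF D * ofVF Y * x
            rw [ofVF_anticomm D Y]
        exact key x.1
      rw [lieDerivative_smul, mul_add, ← mul_assoc, h]
      simp only [ofVF, map_smul, smul_mul_assoc, mul_smul_comm, smul_add, add_assoc]

theorem brAuxMul_sq (D : VF A) : brAuxMul D * brAuxMul D = 0 := by
  refine LinearMap.ext fun x => Prod.ext ?_ (LinearMap.ext fun R => ?_)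
  · change ofVF D * (ofVF D * x.1) = 0
    rw [← mul_assoc, ofVF_mul_ofVF, zero_mul]
  · change ofVF D * (ofVF D * x.2 R + CliffordAlgebra.involute x.1 * lieDerivative D R) +
      CliffordAlgebra.involute (ofVF D * x.1) * lieDerivative D R = 0
    rw [map_mul, show CliffordAlgebra.involute (ofVF D) = -ofVF D from
      CliffordAlgebra.involute_ι D, mul_add, ← mul_assoc, ofVF_mul_ofVF]
    simp [mul_assoc]

/-- Left multiplication by a multivector field on pairs `(P, [P, ·])`. -/
def brAuxLift : MV A →ₐ[A] Module.End A (BrAux A) :=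
  ExteriorAlgebra.lift A ⟨brAuxMul, brAuxMul_sq⟩

variable (A) in
/-- The pair `(1, 0) = (1, [1, ·])`. -/
def brAuxOne : BrAux A := ((1, 0) : MV A × (MV A →ₗ[ℝ] MV A))

/-- The Hamiltonian vector field `Q_X = [X, ·]` of a function `X` on `T*[k]M`, `k` odd, where
`[·, ·]` is the canonical Poisson bracket, i.e. the Schouten bracket of multivector fields. It is
the extension of the Lie bracket of vector fields and of `[Y, f] = Y(f)`, `[f, Y] = -Y(f)`,
`[f, g] = 0` as a graded biderivation: see `hamiltonian_ofFun` and `hamiltonian_ofVF_mul` for the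
first argument, and `lieDerivative_ofFun`, `lieDerivative_ofVF_mul`, `funBracket_ofFun`,
`funBracket_ofVF_mul` for the second one. -/
def hamiltonian (X : MV A) : MV A →ₗ[ℝ] MV A := (brAuxLift X (brAuxOne A)).2

theorem brAuxLift_fst (P : MV A) : (brAuxLift P (brAuxOne A)).1 = P := by
  induction P using CliffordAlgebra.left_induction with
  | algebraMap f =>
    rw [AlgHom.commutes]
    change f • (1 : MV A) = _
    rw [Algebra.smul_def, mul_one]
  | add x y hx hy =>
    rw [map_add]
    change (brAuxLift x (brAuxOne A)).1 + (brAuxLift y (brAuxOne A)).1 = _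
    rw [hx, hy]
  | ι_mul x Y hx =>
    rw [map_mul]
    have : brAuxLift (CliffordAlgebra.ι 0 Y) = brAuxMul Y :=
      ExteriorAlgebra.lift_ι_apply A _ _ Y
    rw [this]
    change ofVF Y * (brAuxLift x (brAuxOne A)).1 = _
    rw [hx]

theorem hamiltonian_add (X Y : MV A) : hamiltonian (X + Y) = hamiltonian X + hamiltonian Y := by
  unfold hamiltonian; rw [map_add]; rfl

theorem hamiltonian_ofFun (f : A) : hamiltonian (ofFun f) = funBracket f := by
  refine LinearMap.ext fun R => ?_
  unfold hamiltonian
  rw [AlgHom.commutes]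
  change f • (0 : MV A) + 1 * funBracket f R = _
  rw [smul_zero, zero_add, one_mul]

theorem hamiltonian_ofVF_mul (D : VF A) (P R : MV A) :
    hamiltonian (ofVF D * P) R =
      ofVF D * hamiltonian P R + CliffordAlgebra.involute P * lieDerivative D R := by
  unfold hamiltonian
  rw [map_mul]
  have : brAuxLift (ofVF D) = brAuxMul D := ExteriorAlgebra.lift_ι_apply A _ _ D
  rw [this]
  change ofVF D * (brAuxLift P (brAuxOne A)).2 R +
    CliffordAlgebra.involute (brAuxLift P (brAuxOne A)).1 * lieDerivative D R = _
  rw [brAuxLift_fst]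

theorem hamiltonian_ofVF (D : VF A) : hamiltonian (ofVF D) = lieDerivative D := by
  refine LinearMap.ext fun R => ?_
  have h1 : hamiltonian (1 : MV A) = 0 := (by
    have := hamiltonian_ofFun (A := A) 1
    rw [ofFun, map_one] at this
    rw [this]
    have := funBracket_algebraMap (A := A) 1
    rwa [map_one] at this)
  have := hamiltonian_ofVF_mul D 1 R
  rw [mul_one, h1, map_one] at this
  simpa using this

/-! ### Differential forms -/

variable (A) in
/-- Differential `p`-forms: `A`-multilinear alternating maps on vector fields. -/
abbrev PForm (p : ℕ) := (VF A) [⋀^Fin p]→ₗ[A] A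

variable (A) in
/-- Differential forms, as families of homogeneous components (on a manifold of dimension `n` the
components of degree `p > n` vanish). -/
abbrev Form := (p : ℕ) → PForm A p

/-- Contraction of differential forms with a vector field, `(ι_D α)(Y₁, …) = α(D, Y₁, …)`. -/
def contractVF : VF A →ₗ[A] Module.End A (Form A) where
  toFun D :=
    { toFun := fun α p => (α (p + 1)).curryLeft D
      map_add' := fun _ _ => rfl
      map_smul' := fun _ _ => rfl }
  map_add' D D' := by
    refine LinearMap.ext fun α => funext fun p => ?_
    exact map_add (α (p + 1)).curryLeft D D'
  map_smul' f D := by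
    refine LinearMap.ext fun α => funext fun p => ?_
    exact map_smul (α (p + 1)).curryLeft f D

/-- Contraction of differential forms with multivector fields; it is an algebra morphism, i.e.
`ι_{X Y} = ι_X ∘ ι_Y`, and `ι_f` is multiplication by `f`. -/
def contract : MV A →ₐ[A] Module.End A (Form A) :=
  ExteriorAlgebra.lift A ⟨contractVF, fun D => by
    refine LinearMap.ext fun α => funext fun p => ?_
    exact AlternatingMap.curryLeft_same (α (p + 2)) D⟩

/-- The map `φ_v : X ↦ ι_X v` from multivector fields to differential forms, for an `n`-form `v`. -/
def phi {n : ℕ} (v : PForm A n) : MV A →ₗ[A] Form A where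
  toFun X := contract X (Pi.single n v)
  map_add' X Y := by rw [map_add]; rfl
  map_smul' f X := by rw [map_smul]; rfl

/-- The exterior derivative of a `p`-form evaluated on `p + 1` vector fields, by the invariant
formula
`dα(Y₀, …, Y_p) = ∑ᵢ (-1)ⁱ Yᵢ(α(…, Ŷᵢ, …)) + ∑_{i<j} (-1)^{i+j} α([Yᵢ, Yⱼ], …, Ŷᵢ, …, Ŷⱼ, …)`.
In the second sum `[Yᵢ, Yⱼ]` is moved to the place of `Yⱼ`, which turns the sign into
`-(-1)ⁱ`. -/
def extDer {p : ℕ} (α : PForm A p) (Y : Fin (p + 1) → VF A) : A :=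
  ∑ i : Fin (p + 1), (-1 : A) ^ (i : ℕ) *
    (Y i (α (i.removeNth Y)) -
      ∑ j : Fin p, if i < i.succAbove j then
        α (Function.update (i.removeNth Y) j ⁅Y i, Y (i.succAbove j)⁆) else 0)

/-- `η = dα` for (inhomogeneous) differential forms. -/
def IsExtDer (α η : Form A) : Prop :=
  η 0 = 0 ∧ ∀ (p : ℕ) (Y : Fin (p + 1) → VF A), η (p + 1) Y = extDer (α p) Y

/-- `Z = Δ_v X`, where `Δ_v = φ_v⁻¹ ∘ d ∘ φ_v` is the BV Laplacian: `φ_v Z = d (φ_v X)`. -/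
def IsBVLaplacian {n : ℕ} (v : PForm A n) (X Z : MV A) : Prop :=
  IsExtDer (phi v X) (phi v Z)

end Algebra

/-! ### Integration -/

section Manifold

variable {n : ℕ} (M : Type*) [TopologicalSpace M] [ChartedSpace (EuclideanSpace ℝ (Fin n)) M]

/-- The algebra of smooth functions on `M`. -/
abbrev Sm := C^∞⟮𝓡 n, M; ℝ⟯

variable {M}

/-- Volume forms: nowhere vanishing forms of top degree. -/
def IsVolumeForm (v : PForm (Sm (n := n) M) n) : Prop :=
  ∀ x : M, ∃ Y : Fin n → VF (Sm (n := n) M), (v Y) x ≠ 0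

/-- The vector fields `Y i` take the values `∂/∂y_i` at the point with coordinates `y` in the
preferred chart at `c`. -/
def IsCoordFrameAt (c : M) (y : EuclideanSpace ℝ (Fin n)) (Y : Fin n → VF (Sm (n := n) M)) :
    Prop :=
  ∀ (i : Fin n) (h : Sm (n := n) M),
    Y i h ((chartAt (EuclideanSpace ℝ (Fin n)) c).symm y) =
      fderiv ℝ (fun z => h ((chartAt (EuclideanSpace ℝ (Fin n)) c).symm z)) y
        (EuclideanSpace.single i 1)

open Classical in
/-- The coefficient of `v` with respect to `dy₁ ∧ ⋯ ∧ dy_n` in the preferred chart at `c`, at the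
point with coordinates `y`: the value of `v` on the coordinate vectors (which extend to global
vector fields; the value does not depend on the extension). -/
def coeff (v : PForm (Sm (n := n) M) n) (c : M) (y : EuclideanSpace ℝ (Fin n)) : ℝ :=
  if h : ∃ Y : Fin n → VF (Sm (n := n) M), IsCoordFrameAt c y Y then
    (v h.choose) ((chartAt (EuclideanSpace ℝ (Fin n)) c).symm y)
  else 0

variable [IsManifold (𝓡 n) ∞ M] [T2Space M] [SigmaCompactSpace M]

variable (n M) in
/-- A smooth partition of unity subordinate to the covering by the preferred charts. -/
def chartPartition : SmoothPartitionOfUnity M (𝓡 n) M Set.univ :=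
  (SmoothPartitionOfUnity.exists_isSubordinate_chartAt_source (𝓡 n) M).choose

/-- The integral `∫_M g v` for compactly supported `g`, where `M` carries the orientation for which
the top form `o v` is positive (`o` is locally constant with values `±1`). In a chart that is
positively (negatively) oriented, the coefficient of `v` is `o |coeff v|` (`-o |coeff v|`), so that
in either case the integral over the chart is the Lebesgue integral of `g o |coeff v|`. -/
def integral (o : M → ℝ) (v : PForm (Sm (n := n) M) n) (g : Sm (n := n) M) : ℝ :=
  ∑ᶠ c : M, ∫ y in (chartAt (EuclideanSpace ℝ (Fin n)) c).target,
    chartPartition n M c ((chartAt (EuclideanSpace ℝ (Fin n)) c).symm y) *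
      g ((chartAt (EuclideanSpace ℝ (Fin n)) c).symm y) *
      (o ((chartAt (EuclideanSpace ℝ (Fin n)) c).symm y) * |coeff v c y|)

/-- Berezinian integration `∫_{T*[k]M} P ρ_v = ∫_M φ_v(P) v`: only the component of degree `0` of
`φ_v(P)`, a function on `M`, contributes. -/
def berInt (o : M → ℝ) (v : PForm (Sm (n := n) M) n) (P : MV (Sm (n := n) M)) : ℝ :=
  integral o v (phi v P 0 Fin.elim0)

/-- A function on `T*[k]M` with compact support (no condition if `M` is compact). -/
def HasCpctSupport (P : MV (Sm (n := n) M)) : Prop :=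
  ∃ h : Sm (n := n) M, HasCompactSupport (h : M → ℝ) ∧ h • P = P

/-- `G = div_{ρ_v} Q`: the divergence of a vector field `Q` on `T*[k]M` with respect to the
Berezinian form `ρ_v`, defined by `∫ Q(f) ρ_v = - ∫ f (div_{ρ_v} Q) ρ_v`. -/
def IsDivergence (o : M → ℝ) (v : PForm (Sm (n := n) M) n)
    (Q : MV (Sm (n := n) M) →ₗ[ℝ] MV (Sm (n := n) M)) (G : MV (Sm (n := n) M)) : Prop :=
  ∀ f : MV (Sm (n := n) M), HasCpctSupport f →
    berInt o v (Q f) = -berInt o v (f * G)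

end Manifold

end BVGeom

end

/-!
The functions on `T*[k]M` are the multivector fields, and everything is reduced to algebra over
the ring `A` of smooth functions, plus a few facts about `M`.

*Algebra.* Multivector fields are generated by functions and vector fields, so identities in the
exterior algebra are proved by induction on the degree. This gives the graded Leibniz rule for
`Q_X = [X, ·]` (`hamiltonian_mul`, `isGradedVectorField_hamiltonian`). Cartan's formula
`d ι_D = L_D - ι_D d` shows that `d` of a form is a form, and gives the recursion
`Δ(D P) = [D, P] + div(D) P - D Δ(P)` for the BV Laplacian (`IsBVLaplacian.ofVF_mul`). By
induction on the degree `i` of `X` (`exists_laplacian`), this yields both the second order product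
rule `Δ(X f) = Δ(X) f + (-1)^i X Δ(f) + (-1)^{i+1} [X, f]` and, given Stokes' theorem
`∫ (D a + div(D) a) = 0` for compactly supported functions `a`, the integration by parts
`∫ ι_X dα = (-1)^i ∫ ι_{Δ X} α`. The component of degree `0` of the exact form `φ_v(Δ(X f))` is
zero, so integrating the product rule gives `∫ [X, f] = 2 (-1)^i ∫ Δ(X) f`; the factor `2` arises
because the terms with `Δ(X)` and with `Δ(f)` contribute equally. Exchanging `Δ(X)` and `f` under
the Berezinian, which only sees the component of degree `n`, turns the sign into the one of the
theorem (`formZero_phi_mul_comm`). Conversely the divergence determines `φ_v(Z)`, because the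
pairing by integration is nondegenerate (`isBVLaplacian_iff_of_integral`).

*Geometry.* By Hadamard's lemma a derivation `D` of `A` equals `∑ᵢ D(uᵢ) ∂ᵢ` in a chart, so there
are frames `E` of vector fields and a cutoff `χ` with `χ D = ∑ᵢ D(uᵢ) Eᵢ` (`Frame`,
`exists_isCoordFrame`). Hence forms of degree above `n` vanish and forms of degree `n` are
multiples of `v`. The coefficient of `v` in a chart transforms with the Jacobian determinant
(`coeff_transition`), so that the change of variables formula makes the integral over a chart
independent of the chart (`chartInt_eq_chartInt`), and Stokes' theorem reduces to the vanishing of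
`∫ ∂ᵢΦ` for compactly supported `Φ` on Euclidean space (`integral_div_eq_zero`).

*Bijectivity of `φ_v`.* As there are no `(n + 1)`-forms, `θ ∧ φ_v(P) = φ_v(θ ⌟ P)` for one-forms
`θ` (`wedge_phi`), so that the kernel of `φ_v` is stable under contractions and its range under
exterior multiplication by one-forms. With Euler's identities for a frame, an induction on the
degree shows that `χ^p V` annihilates the homogeneous elements of degree `p` of the kernel, and
maps `p`-forms into the range, where `V` is the coefficient of `v`. On a compact manifold these
functions, for varying frames, generate the unit ideal (`ideal_eq_top`).
-/

noncomputable section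

namespace BVGeom

/-! ### Graded algebra of multivector fields -/

section Algebra

variable {A : Type*} [CommRing A] [Algebra ℝ A]

open CliffordAlgebra (involute)

/-- Induction on the degree of a multivector field: functions, sums, and left multiplication by
vector fields. -/
theorem exteriorPower_induction {C : ℕ → MV A → Prop} (h0 : ∀ f, C 0 (ofFun f))
    (hadd : ∀ i x y, C i x → C i y → C i (x + y))
    (hmul : ∀ i D x, x ∈ ⋀[A]^i (VF A) → C i x → C (i + 1) (ofVF D * x)) {i : ℕ} {x : MV A}
    (hx : x ∈ ⋀[A]^i (VF A)) : C i x := by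
  refine Submodule.pow_induction_on_left' (C := fun i x _ => C i x) _ h0
    (fun x y i hx hy => hadd i x y) ?_ hx
  rintro _ ⟨D, rfl⟩ i x hx h
  exact hmul i D x hx h

theorem involute_ofVF_mul (D : VF A) (P : MV A) :
    involute (ofVF D * P) = -(ofVF D * involute P) := by
  rw [map_mul, show involute (ofVF D) = -ofVF D from CliffordAlgebra.involute_ι D, neg_mul]

theorem involute_ofFun (f : A) : involute (ofFun f : MV A) = ofFun f := AlgHom.commutes _ f

theorem involute_mul_ofVF (P : MV A) (D : VF A) : involute P * ofVF D = ofVF D * P := by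
  induction P using CliffordAlgebra.left_induction with
  | algebraMap f => rw [AlgHom.commutes]; exact Algebra.commutes f _
  | add x y hx hy => rw [map_add, add_mul, mul_add, hx, hy]
  | ι_mul x Y hx =>
    change involute (ofVF Y * x) * ofVF D = ofVF D * (ofVF Y * x)
    rw [involute_ofVF_mul, neg_mul, mul_assoc, hx, ← mul_assoc, ← mul_assoc, ofVF_anticomm D Y,
      neg_mul]

theorem mul_ofVF (P : MV A) (D : VF A) : P * ofVF D = ofVF D * involute P := by
  rw [← involute_mul_ofVF, CliffordAlgebra.involute_involute]

theorem involute_mem {i : ℕ} {P : MV A} (hP : P ∈ ⋀[A]^i (VF A)) :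
    involute P = (-1 : ℤ) ^ i • P := by
  refine exteriorPower_induction (C := fun i P => involute P = (-1 : ℤ) ^ i • P) ?_ ?_ ?_ hP
  · intro f; rw [pow_zero, one_smul]; exact involute_ofFun f
  · intro i x y hx hy; rw [map_add, hx, hy, smul_add]
  · intro i D x _ hx
    rw [involute_ofVF_mul, hx, pow_succ, mul_neg_one, neg_smul, mul_smul_comm]

/-- Graded commutativity `P f = f P` for even `f` and `P f = f · involute P` for odd `f`, applied to
the even and odd parts `(f ± involute f) / 2` of an arbitrary `f`. -/
theorem two_smul_mul (P f : MV A) :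
    (2 : ℤ) • (P * f) = (f + involute f) * P + (f - involute f) * involute P := by
  induction f using CliffordAlgebra.left_induction generalizing P with
  | algebraMap f =>
    rw [AlgHom.commutes, sub_self, zero_mul, add_zero, ← Algebra.commutes f P, add_mul, two_smul]
  | add x y hx hy =>
    simp only [mul_add, smul_add, hx, hy, map_add, add_mul, sub_mul]; abel
  | ι_mul x D hx =>
    change (2 : ℤ) • (P * (ofVF D * x)) = (ofVF D * x + involute (ofVF D * x)) * P
      + (ofVF D * x - involute (ofVF D * x)) * involute P
    rw [← mul_assoc, mul_ofVF, mul_assoc, ← mul_smul_comm, hx, involute_ofVF_mul,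
      CliffordAlgebra.involute_involute]
    simp only [mul_add, add_mul, sub_mul, mul_sub, mul_assoc, neg_mul]; abel

theorem mul_ofVF_of_mem {i : ℕ} {P : MV A} (hP : P ∈ ⋀[A]^i (VF A)) (D : VF A) :
    P * ofVF D = (-1 : ℤ) ^ i • (ofVF D * P) := by
  rw [mul_ofVF, involute_mem hP, mul_smul_comm]

theorem mul_comm_of_mem {i j : ℕ} {P R : MV A} (hP : P ∈ ⋀[A]^i (VF A))
    (hR : R ∈ ⋀[A]^j (VF A)) : P * R = (-1 : ℤ) ^ (i * j) • (R * P) := by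
  refine exteriorPower_induction (C := fun j R => P * R = (-1 : ℤ) ^ (i * j) • (R * P))
    ?_ ?_ ?_ hR
  · intro f; rw [mul_zero, pow_zero, one_smul]; exact (Algebra.commutes f P).symm
  · intro i x y hx hy; rw [mul_add, hx, hy, add_mul, smul_add]
  · intro j D x _ hx
    rw [← mul_assoc, mul_ofVF_of_mem hP, smul_mul_assoc, mul_assoc, hx, mul_smul_comm, smul_smul,
      ← mul_assoc, ← pow_add, mul_add, mul_one, add_comm]

theorem ofVF_mem (D : VF A) : ofVF D ∈ ⋀[A]^1 (VF A) := by
  rw [ExteriorAlgebra.exteriorPower, pow_one]; exact LinearMap.mem_range_self _ D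

theorem ofFun_mem (f : A) : ofFun f ∈ ⋀[A]^0 (VF A) := by
  rw [ExteriorAlgebra.exteriorPower, pow_zero]; exact Submodule.algebraMap_mem f

theorem mul_mem_exteriorPower {i j : ℕ} {P R : MV A} (hP : P ∈ ⋀[A]^i (VF A))
    (hR : R ∈ ⋀[A]^j (VF A)) : P * R ∈ ⋀[A]^(i + j) (VF A) := by
  rw [ExteriorAlgebra.exteriorPower, pow_add]; exact Submodule.mul_mem_mul hP hR

theorem ofVF_mul_mem {i : ℕ} {P : MV A} (hP : P ∈ ⋀[A]^i (VF A)) (D : VF A) :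
    ofVF D * P ∈ ⋀[A]^(i + 1) (VF A) := by
  rw [add_comm]; exact mul_mem_exteriorPower (ofVF_mem D) hP

/-! ### The Schouten bracket with a fixed multivector field is a graded derivation -/

theorem lieDerivative_mul (D : VF A) (P R : MV A) :
    lieDerivative D (P * R) = lieDerivative D P * R + P * lieDerivative D R := by
  induction P using CliffordAlgebra.left_induction with
  | algebraMap f =>
    change lieDerivative D (ofFun f * R) = lieDerivative D (ofFun f) * R + ofFun f * _
    rw [lieDerivative_ofFun, ← Algebra.smul_def, lieDerivative_fsmul, Algebra.smul_def,
      Algebra.smul_def, add_comm]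
  | add x y hx hy => simp only [add_mul, map_add, hx, hy]; abel
  | ι_mul x Y hx =>
    change lieDerivative D (ofVF Y * x * R) = lieDerivative D (ofVF Y * x) * R + ofVF Y * x * _
    rw [mul_assoc, lieDerivative_ofVF_mul, lieDerivative_ofVF_mul, hx]
    simp only [mul_add, add_mul, mul_assoc, add_assoc]

theorem lieDerivative_mem (D : VF A) {i : ℕ} {P : MV A} (hP : P ∈ ⋀[A]^i (VF A)) :
    lieDerivative D P ∈ ⋀[A]^i (VF A) := by
  refine exteriorPower_induction (C := fun i P => lieDerivative D P ∈ ⋀[A]^i (VF A)) ?_ ?_ ?_ hP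
  · intro f; rw [lieDerivative_ofFun]; exact ofFun_mem _
  · intro i x y hx hy; rw [map_add]; exact add_mem hx hy
  · intro i Y x hx h
    rw [lieDerivative_ofVF_mul]
    exact add_mem (ofVF_mul_mem hx _) (ofVF_mul_mem h _)

theorem funBracket_mul_right (f : A) (P R : MV A) :
    funBracket f (P * R) = funBracket f P * R + involute P * funBracket f R := by
  induction P using CliffordAlgebra.left_induction with
  | algebraMap g =>
    change funBracket f (ofFun g * R) = funBracket f (ofFun g) * R + involute (ofFun g) * _
    rw [funBracket_ofFun, involute_ofFun, ← Algebra.smul_def, funBracket_smul, Algebra.smul_def,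
      zero_mul, zero_add]
  | add x y hx hy => simp only [add_mul, map_add, hx, hy]; abel
  | ι_mul x Y hx =>
    change funBracket f (ofVF Y * x * R) = funBracket f (ofVF Y * x) * R
      + involute (ofVF Y * x) * _
    rw [mul_assoc, funBracket_ofVF_mul, funBracket_ofVF_mul, hx, involute_ofVF_mul]
    simp only [mul_add, sub_mul, mul_assoc, neg_mul, smul_mul_assoc]; abel

/-- Contraction of a multivector field with a one-form, a graded derivation of degree `-1`. -/
abbrev contractForm (θ : Module.Dual A (VF A)) : MV A →ₗ[A] MV A :=
  CliffordAlgebra.contractLeft (Q := (0 : QuadraticForm A (VF A))) θ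

theorem contractForm_ofFun (θ : Module.Dual A (VF A)) (f : A) : contractForm θ (ofFun f) = 0 :=
  CliffordAlgebra.contractLeft_algebraMap _ θ f

theorem contractForm_ofVF_mul (θ : Module.Dual A (VF A)) (D : VF A) (P : MV A) :
    contractForm θ (ofVF D * P) = θ D • P - ofVF D * contractForm θ P :=
  CliffordAlgebra.contractLeft_ι_mul θ D P

theorem contractForm_mem (θ : Module.Dual A (VF A)) {i : ℕ} {P : MV A} (hP : P ∈ ⋀[A]^i (VF A)) :
    (i = 0 → contractForm θ P = 0) ∧ ∀ l, i = l + 1 → contractForm θ P ∈ ⋀[A]^l (VF A) := by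
  refine exteriorPower_induction (C := fun i P => (i = 0 → contractForm θ P = 0) ∧
    ∀ l, i = l + 1 → contractForm θ P ∈ ⋀[A]^l (VF A)) ?_ ?_ ?_ hP
  · exact fun f => ⟨fun _ => contractForm_ofFun θ f, fun l hl => by omega⟩
  · intro i x y hx hy
    refine ⟨fun h => ?_, fun l h => ?_⟩ <;> rw [map_add]
    · rw [hx.1 h, hy.1 h, add_zero]
    · exact add_mem (hx.2 l h) (hy.2 l h)
  · intro i Y x hx h
    refine ⟨fun h => by simp at h, fun l hl => ?_⟩
    obtain rfl : i = l := by omega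
    rw [contractForm_ofVF_mul]
    refine sub_mem (Submodule.smul_mem _ _ hx) ?_
    rcases i with _ | i
    · rw [h.1 rfl, mul_zero]; exact zero_mem _
    · exact ofVF_mul_mem (h.2 i rfl) Y

theorem funBracket_mem (f : A) {i : ℕ} {P : MV A} (hP : P ∈ ⋀[A]^i (VF A)) :
    (i = 0 → funBracket f P = 0) ∧ ∀ l, i = l + 1 → funBracket f P ∈ ⋀[A]^l (VF A) := by
  have h := contractForm_mem (dFun f) hP
  exact ⟨fun hi => neg_eq_zero.2 (h.1 hi), fun l hl => neg_mem (h.2 l hl)⟩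

/-- The bracket with an `i`-vector field maps `j`-vector fields to `(i + j - 1)`-vector fields, and
is zero if `i = j = 0`. -/
theorem hamiltonian_mem {i j : ℕ} {X P : MV A} (hX : X ∈ ⋀[A]^i (VF A))
    (hP : P ∈ ⋀[A]^j (VF A)) :
    (i + j = 0 → hamiltonian X P = 0) ∧ ∀ l, i + j = l + 1 → hamiltonian X P ∈ ⋀[A]^l (VF A) := by
  refine exteriorPower_induction (C := fun i X => (i + j = 0 → hamiltonian X P = 0) ∧
    ∀ l, i + j = l + 1 → hamiltonian X P ∈ ⋀[A]^l (VF A)) ?_ ?_ ?_ hX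
  · intro f
    rw [hamiltonian_ofFun, zero_add]
    exact funBracket_mem f hP
  · intro i x y hx hy
    rw [hamiltonian_add]
    refine ⟨fun h => ?_, fun l h => ?_⟩ <;> rw [LinearMap.add_apply]
    · rw [hx.1 h, hy.1 h, add_zero]
    · exact add_mem (hx.2 l h) (hy.2 l h)
  · intro i D x hx h
    refine ⟨fun h => by omega, fun l hl => ?_⟩
    obtain rfl : l = i + j := by omega
    rw [hamiltonian_ofVF_mul, involute_mem hx]
    refine add_mem ?_ (mul_mem_exteriorPower (zsmul_mem hx _) (lieDerivative_mem D hP))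
    rcases hij : i + j with _ | k
    · rw [h.1 hij, mul_zero]; exact zero_mem _
    · exact ofVF_mul_mem (h.2 k hij) D

/-- The graded Leibniz rule `[X, P R] = [X, P] R + (-1)^{(i + 1) j} P [X, R]` for an `i`-vector
field `X` and a `j`-vector field `P`. -/
theorem hamiltonian_mul {i j : ℕ} {X P : MV A} (hX : X ∈ ⋀[A]^i (VF A))
    (hP : P ∈ ⋀[A]^j (VF A)) (R : MV A) :
    hamiltonian X (P * R) =
      hamiltonian X P * R + (-1 : ℤ) ^ ((i + 1) * j) • (P * hamiltonian X R) := by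
  refine exteriorPower_induction (C := fun i X => hamiltonian X (P * R) =
      hamiltonian X P * R + (-1 : ℤ) ^ ((i + 1) * j) • (P * hamiltonian X R)) ?_ ?_ ?_ hX
  · intro f
    rw [hamiltonian_ofFun, funBracket_mul_right, involute_mem hP, smul_mul_assoc]
    simp
  · intro i x y hx hy
    rw [hamiltonian_add]
    simp only [LinearMap.add_apply, hx, hy, add_mul, mul_add, smul_add]; abel
  · intro i D x hx h
    have h1 : P * (ofVF D * hamiltonian x R) =
        (-1 : ℤ) ^ j • (ofVF D * (P * hamiltonian x R)) := by
      rw [← mul_assoc, mul_ofVF_of_mem hP, smul_mul_assoc, mul_assoc]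
    have h2 : P * (x * lieDerivative D R) =
        (-1 : ℤ) ^ (i * j) • (x * (P * lieDerivative D R)) := by
      rw [← mul_assoc, mul_comm_of_mem hP hx, smul_mul_assoc, mul_assoc, mul_comm j i]
    simp only [hamiltonian_ofVF_mul, h, involute_mem hx, lieDerivative_mul, mul_add, add_mul,
      smul_mul_assoc, mul_smul_comm, h1, h2, smul_smul, ← pow_add, smul_add, mul_assoc]
    have e1 : (-1 : ℤ) ^ (i * j + 1 * j + 1 * j + j) = (-1) ^ (i * j + 1 * j) := by
      rw [show i * j + 1 * j + 1 * j + j = i * j + 1 * j + 2 * j by ring, pow_add _ _ (2 * j),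
        pow_mul (-1 : ℤ) 2]
      simp
    have e2 : (-1 : ℤ) ^ (i * j + 1 * j + 1 * j + (i + i * j)) = (-1) ^ i := by
      rw [show i * j + 1 * j + 1 * j + (i + i * j) = i + 2 * (i * j + j) by ring, pow_add _ i,
        pow_mul (-1 : ℤ) 2]
      simp
    rw [e1, e2]
    abel

theorem hamiltonian_zero : hamiltonian (0 : MV A) = 0 := by
  unfold hamiltonian; rw [map_zero]; rfl

/-- As `k ≠ 0`, the multivector fields of degree `m` on `T*[k]M` are the `p`-vector fields with
`k p = m`, if there is such a `p`, and zero otherwise. -/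
theorem eq_zero_or_exists_of_mem_degreePart {k : ℤ} (hk : Odd k) {m : ℤ} {X : MV A}
    (hX : X ∈ degreePart k m) : X = 0 ∨ ∃ p : ℕ, k * p = m ∧ X ∈ ⋀[A]^p (VF A) := by
  have hk0 : k ≠ 0 := by rintro rfl; simp at hk
  by_cases h : ∃ p : ℕ, k * p = m
  · obtain ⟨p, rfl⟩ := h
    refine Or.inr ⟨p, rfl, ?_⟩
    refine (iSup₂_le fun q hq => ?_ : degreePart k (k * p) ≤ ⋀[A]^p (VF A)) hX
    obtain rfl : q = p := by exact_mod_cast mul_left_cancel₀ hk0 hq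
    exact le_rfl
  · left
    have : degreePart (A := A) k m ≤ ⊥ := iSup₂_le fun q hq => (h ⟨q, hq⟩).elim
    simpa using this hX

theorem mem_degreePart {k m : ℤ} {p : ℕ} (h : k * p = m) {X : MV A} (hX : X ∈ ⋀[A]^p (VF A)) :
    X ∈ degreePart k m :=
  (le_iSup₂_of_le p h le_rfl : ⋀[A]^p (VF A) ≤ degreePart k m) hX

/-- The Hamiltonian vector field of a function of degree `m` is a graded derivation of degree
`m - k`. -/
theorem isGradedVectorField_hamiltonian {k : ℤ} (hk : Odd k) {m : ℤ} {X : MV A}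
    (hX : X ∈ degreePart k m) : IsGradedVectorField k (m - k) (hamiltonian X) := by
  rcases eq_zero_or_exists_of_mem_degreePart hk hX with rfl | ⟨i, rfl, hXi⟩
  · constructor <;> simp [hamiltonian_zero]
  constructor
  · intro l P hP
    rcases eq_zero_or_exists_of_mem_degreePart hk hP with rfl | ⟨j, rfl, hPj⟩
    · rw [map_zero]; exact zero_mem _
    rcases h : i + j with _ | q
    · rw [(hamiltonian_mem hXi hPj).1 h]; exact zero_mem _
    · refine mem_degreePart (p := q) ?_ ((hamiltonian_mem hXi hPj).2 q h)
      have : (i : ℤ) + j = q + 1 := by exact_mod_cast h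
      linear_combination (-k) * this
  · intro l P R hP
    rcases eq_zero_or_exists_of_mem_degreePart hk hP with rfl | ⟨j, rfl, hPj⟩
    · simp
    have e : (-1 : ℝ) ^ ((k * i - k) * (k * j)) = (((-1 : ℤ) ^ ((i + 1) * j) : ℤ) : ℝ) := by
      have e1 : (-1 : ℝ) ^ ((k * i - k) * (k * j)) = (-1 : ℝ) ^ (((i + 1) * j : ℕ) : ℤ) := by
        rcases hk with ⟨r, rfl⟩
        rw [show ((2 * r + 1) * i - (2 * r + 1)) * ((2 * r + 1) * j) = (((i + 1) * j : ℕ) : ℤ) +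
          2 * ((2 * r * r + 2 * r) * (i - 1) * j - j) by push_cast; ring,
          zpow_add₀ (by norm_num), zpow_mul _ 2]
        simp
      rw [e1, zpow_natCast]; push_cast; rfl
    rw [hamiltonian_mul hXi hPj, e, Int.cast_smul_eq_zsmul]

end Algebra

/-! ### Cartan calculus -/

section Algebra

variable {A : Type*} [CommRing A] [Algebra ℝ A]

theorem lie_smul_right (f : A) (D Y : VF A) : ⁅D, f • Y⁆ = f • ⁅D, Y⁆ + D f • Y := by
  ext a
  simp only [Derivation.commutator_apply, Derivation.smul_apply, Derivation.add_apply,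
    smul_eq_mul, Derivation.leibniz]
  ring

theorem lie_smul_left (f : A) (D Y : VF A) : ⁅f • D, Y⁆ = f • ⁅D, Y⁆ - Y f • D := by
  rw [← lie_skew, lie_smul_right, ← lie_skew D Y]
  simp only [smul_neg, neg_add_rev]; abel

/-- The sum `∑ⱼ α(…, [D, Yⱼ], …)`, with the dependence on the `i`th argument made explicit. -/
theorem sum_update_update {p : ℕ} (D : VF A) (α : PForm A p) (Y : Fin p → VF A) (i : Fin p)
    (z : VF A) :
    ∑ j, α (Function.update (Function.update Y i z) j ⁅D, Function.update Y i z j⁆) =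
      α (Function.update Y i ⁅D, z⁆) +
        ∑ j ∈ Finset.univ.erase i, α (Function.update (Function.update Y j ⁅D, Y j⁆) i z) := by
  rw [← Finset.add_sum_erase _ _ (Finset.mem_univ i), Function.update_self, Function.update_idem]
  congr 1
  refine Finset.sum_congr rfl fun j hj => ?_
  have hj : j ≠ i := Finset.ne_of_mem_erase hj
  rw [Function.update_of_ne hj, Function.update_comm hj]

/-- The Lie derivative of differential forms,
`(L_D α)(Y₁, …) = D(α(Y₁, …)) - ∑ⱼ α(…, [D, Yⱼ], …)`. -/
def lieForm (D : VF A) {p : ℕ} (α : PForm A p) : PForm A p where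
  toFun Y := D (α Y) - ∑ j, α (Function.update Y j ⁅D, Y j⁆)
  map_update_add' := by
    intro inst Y i x y
    obtain rfl : inst = instDecidableEqFin p := Subsingleton.elim _ _
    simp only [sum_update_update, AlternatingMap.map_update_add, map_add, lie_add,
      Finset.sum_add_distrib]
    abel
  map_update_smul' := by
    intro inst Y i f x
    obtain rfl : inst = instDecidableEqFin p := Subsingleton.elim _ _
    simp only [sum_update_update, AlternatingMap.map_update_smul, lie_smul_right,
      AlternatingMap.map_update_add, smul_eq_mul, Derivation.leibniz, ← Finset.mul_sum]
    ring
  map_eq_zero_of_eq' := by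
    intro Y i j hY hij
    rw [α.map_eq_zero_of_eq Y hY hij, map_zero, zero_sub, neg_eq_zero,
      ← Finset.add_sum_erase _ _ (Finset.mem_univ i),
      ← Finset.add_sum_erase _ _ (Finset.mem_erase.2 ⟨hij.symm, Finset.mem_univ j⟩),
      Finset.sum_eq_zero, add_zero, hY]
    · have key : Function.update Y i ⁅D, Y j⁆ =
          Function.update Y j ⁅D, Y j⁆ ∘ Equiv.swap i j := by
        funext l
        by_cases hl : l = j
        · subst hl; simp [Function.update_of_ne hij, hij.symm, hY]
        · by_cases hl' : l = i
          · subst hl'; simp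
          · simp [Equiv.swap_apply_of_ne_of_ne hl' hl, hl, hl']
      rw [key, AlternatingMap.map_swap_add _ _ hij]
    · intro l hl
      simp only [Finset.mem_erase, Finset.mem_univ, and_true] at hl
      refine α.map_eq_zero_of_eq _ ?_ hij
      rw [Function.update_of_ne (Ne.symm hl.2), Function.update_of_ne (Ne.symm hl.1), hY]

theorem lieForm_apply (D : VF A) {p : ℕ} (α : PForm A p) (Y : Fin p → VF A) :
    lieForm D α Y = D (α Y) - ∑ j, α (Function.update Y j ⁅D, Y j⁆) := rfl

theorem lieForm_cons (D E : VF A) {p : ℕ} (α : PForm A (p + 1)) (Y : Fin p → VF A) :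
    lieForm D α (Fin.cons E Y) =
      lieForm D (α.curryLeft E) Y - α (Fin.cons ⁅D, E⁆ Y) := by
  rw [lieForm_apply, lieForm_apply, Fin.sum_univ_succ, Fin.update_cons_zero, Fin.cons_zero]
  simp only [← Fin.cons_update, Fin.cons_succ, AlternatingMap.curryLeft_apply_apply]
  change _ = D (α (Fin.cons E Y)) - ∑ j, α (Fin.cons E _) - _
  ring

theorem lieForm_smul_left (f : A) (D : VF A) {p : ℕ} (α : PForm A p) (Y : Fin p → VF A) :
    lieForm (f • D) α Y = f * lieForm D α Y + ∑ j, Y j f * α (Function.update Y j D) := by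
  simp only [lieForm_apply, lie_smul_left, AlternatingMap.map_update_sub,
    AlternatingMap.map_update_smul, Finset.sum_sub_distrib, Derivation.smul_apply, smul_eq_mul,
    ← Finset.mul_sum]
  ring

theorem lieForm_add_left (D D' : VF A) {p : ℕ} (α : PForm A p) :
    lieForm (D + D') α = lieForm D α + lieForm D' α := by
  ext Y
  simp only [lieForm_apply, add_lie, AlternatingMap.map_update_add, AlternatingMap.add_apply,
    Finset.sum_add_distrib, Derivation.add_apply]
  ring

theorem lieForm_smul_right (D : VF A) (f : A) {p : ℕ} (α : PForm A p) :
    lieForm D (f • α) = f • lieForm D α + D f • α := by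
  ext Y
  simp only [lieForm_apply, AlternatingMap.add_apply, AlternatingMap.smul_apply, smul_eq_mul,
    Derivation.leibniz, ← Finset.mul_sum]
  ring

theorem lieForm_add_right (D : VF A) {p : ℕ} (α β : PForm A p) :
    lieForm D (α + β) = lieForm D α + lieForm D β := by
  ext Y
  simp only [lieForm_apply, AlternatingMap.add_apply, map_add, Finset.sum_add_distrib]
  ring

theorem lieForm_zero_right (D : VF A) {p : ℕ} : lieForm D (0 : PForm A p) = 0 := by
  ext Y
  simp [lieForm_apply]

theorem extDer_add {p : ℕ} (α β : PForm A p) (Y : Fin (p + 1) → VF A) :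
    extDer (α + β) Y = extDer α Y + extDer β Y := by
  simp only [extDer, ← Finset.sum_add_distrib, ← mul_add]
  refine Finset.sum_congr rfl fun i _ => ?_
  have : ∀ j : Fin p, (if i < i.succAbove j then
      (α + β) (Function.update (i.removeNth Y) j ⁅Y i, Y (i.succAbove j)⁆) else 0) =
      (if i < i.succAbove j then
        α (Function.update (i.removeNth Y) j ⁅Y i, Y (i.succAbove j)⁆) else 0) +
      (if i < i.succAbove j then
        β (Function.update (i.removeNth Y) j ⁅Y i, Y (i.succAbove j)⁆) else 0) := by
    intro j; split_ifs <;> simp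
  rw [Finset.sum_congr rfl fun j _ => this j, Finset.sum_add_distrib, AlternatingMap.add_apply,
    map_add]
  ring

/-- The Leibniz rule `d(f α) = f dα + df ∧ α`. -/
theorem extDer_smul (f : A) {p : ℕ} (α : PForm A p) (Y : Fin (p + 1) → VF A) :
    extDer (f • α) Y =
      f * extDer α Y + ∑ i : Fin (p + 1), (-1 : A) ^ (i : ℕ) * (Y i f * α (i.removeNth Y)) := by
  simp only [extDer, Finset.mul_sum, ← Finset.sum_add_distrib]
  refine Finset.sum_congr rfl fun i _ => ?_
  have : ∀ j : Fin p, (if i < i.succAbove j then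
      (f • α) (Function.update (i.removeNth Y) j ⁅Y i, Y (i.succAbove j)⁆) else 0) =
      f * (if i < i.succAbove j then
        α (Function.update (i.removeNth Y) j ⁅Y i, Y (i.succAbove j)⁆) else 0) := by
    intro j; split_ifs <;> simp
  rw [Finset.sum_congr rfl fun j _ => this j, ← Finset.mul_sum, AlternatingMap.smul_apply,
    smul_eq_mul, Derivation.leibniz, smul_eq_mul, smul_eq_mul]
  ring

theorem extDer_zero_form (α : PForm A 0) (Y : Fin 1 → VF A) :
    extDer α Y = Y 0 (α Fin.elim0) := by
  simp only [extDer, Finset.univ_eq_empty,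
    Finset.sum_empty, sub_zero]
  simp
  congr 2
  exact Subsingleton.elim _ _

theorem removeNth_succ_cons (D : VF A) {p : ℕ} (Y : Fin (p + 1) → VF A) (i : Fin (p + 1)) :
    (i.succ.removeNth (Fin.cons D Y : Fin (p + 2) → VF A)) =
      (Fin.cons D (i.removeNth Y) : Fin (p + 1) → VF A) := by
  funext j
  cases j using Fin.cases <;> simp [Fin.removeNth]

/-- Cartan's formula `ι_D d = L_D - d ι_D`, evaluated on vector fields. -/
theorem extDer_cons (D : VF A) {p : ℕ} (α : PForm A (p + 1)) (Y : Fin (p + 1) → VF A) :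
    extDer α (Fin.cons D Y) = lieForm D α Y - extDer (α.curryLeft D) Y := by
  rw [extDer, Fin.sum_univ_succ, extDer, sub_eq_add_neg (lieForm D α Y), ← Finset.sum_neg_distrib]
  congr 1
  · simp only [Fin.val_zero, pow_zero, one_mul, Fin.cons_zero, Fin.removeNth_zero, Fin.tail_cons,
      Fin.zero_succAbove, Fin.succ_pos, if_true, Fin.cons_succ]
    rfl
  · refine Finset.sum_congr rfl fun i _ => ?_
    rw [Fin.sum_univ_succ]
    simp only [removeNth_succ_cons, Fin.succ_succAbove_zero, Fin.not_lt_zero, if_false, zero_add,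
      Fin.cons_succ, Fin.succ_succAbove_succ, Fin.succ_lt_succ_iff, ← Fin.cons_update, Fin.val_succ]
    rw [pow_succ, mul_neg_one, neg_mul]
    rfl

theorem curryLeft_removeNth (D : VF A) {p : ℕ} (α : PForm A (p + 1)) (Y : Fin (p + 1) → VF A)
    (i : Fin (p + 1)) :
    (-1 : A) ^ (i : ℕ) * α.curryLeft D (i.removeNth Y) = α (Function.update Y i D) := by
  have := AlternatingMap.map_insertNth α i D (i.removeNth Y)
  rw [Fin.insertNth_removeNth, zsmul_eq_mul] at this
  rw [this]
  push_cast
  rfl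

/-- A map `B` that is linear in its first argument and alternating in the other ones is alternating
in all of them as soon as it vanishes whenever the first two arguments agree. -/
theorem exists_uncurryLeft {A : Type*} [CommRing A] {N : Type*} [AddCommGroup N] [Module A N]
    {p : ℕ} (B : N →ₗ[A] N [⋀^Fin (p + 1)]→ₗ[A] A)
    (hB : ∀ x (Y : Fin p → N), B x (Fin.cons x Y) = 0) :
    ∃ η : N [⋀^Fin (p + 2)]→ₗ[A] A, ∀ x Y, η (Fin.cons x Y) = B x Y := by
  let B' : N →ₗ[A] MultilinearMap A (fun _ : Fin (p + 1) => N) A :=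
    { toFun := fun x => (B x).toMultilinearMap
      map_add' := fun x y => by rw [map_add]; rfl
      map_smul' := fun f x => by rw [map_smul]; rfl }
  let η : MultilinearMap A (fun _ : Fin (p + 2) => N) A := LinearMap.uncurryLeft B'
  have hz : ∀ Y : Fin (p + 2) → N, η Y = B (Y 0) (Fin.tail Y) := fun _ => rfl
  -- the repeated argument may be moved to the second place, the tail being alternating
  have h0 : ∀ (Y : Fin (p + 2) → N) (j : Fin (p + 1)), Y 0 = Y j.succ →
      η Y = 0 := by
    intro Y j h
    rw [hz]
    have h1 : B (Y 0) (Fin.tail Y ∘ Equiv.swap 0 j) = 0 := by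
      have : Fin.tail Y ∘ Equiv.swap 0 j =
          Fin.cons (Y 0) (Fin.tail (Fin.tail Y ∘ Equiv.swap 0 j)) := by
        rw [h]
        conv_lhs => rw [← Fin.cons_self_tail (Fin.tail Y ∘ Equiv.swap 0 j)]
        congr 1
      rw [this]
      exact hB _ _
    rw [AlternatingMap.map_perm] at h1
    rcases Int.units_eq_one_or (Equiv.Perm.sign (Equiv.swap 0 j)) with h | h <;>
      simpa [h] using h1
  refine ⟨{ η with
    map_eq_zero_of_eq' := fun Y i j hY hij => ?_ }, fun x Y => rfl⟩
  change η Y = 0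
  rcases Fin.eq_zero_or_eq_succ i with rfl | ⟨i, rfl⟩
  · rcases Fin.eq_zero_or_eq_succ j with rfl | ⟨j, rfl⟩
    · exact (hij rfl).elim
    · exact h0 Y j hY
  · rcases Fin.eq_zero_or_eq_succ j with rfl | ⟨j, rfl⟩
    · exact h0 Y i hY.symm
    · rw [hz]
      exact (B (Y 0)).map_eq_zero_of_eq (Fin.tail Y) hY fun h => hij (by rw [h])

/-- The exterior derivative of a form is a form: it is `A`-multilinear and alternating. By Cartan's
formula this follows from the corresponding facts for forms of lower degree. -/
theorem exists_extDer (p : ℕ) (α : PForm A p) : ∃ η : PForm A (p + 1), ∀ Y, η Y = extDer α Y := by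
  induction p with
  | zero =>
    refine ⟨AlternatingMap.ofSubsingleton A (VF A) A (0 : Fin 1)
      { toFun := fun D => D (α Fin.elim0), map_add' := fun _ _ => rfl,
        map_smul' := fun _ _ => rfl }, fun Y => ?_⟩
    rw [extDer_zero_form]; rfl
  | succ p ih =>
    choose d hd using ih
    let B : VF A →ₗ[A] PForm A (p + 1) :=
      { toFun := fun D => lieForm D α - d (α.curryLeft D)
        map_add' := fun D D' => by
          ext Y
          simp only [AlternatingMap.sub_apply, AlternatingMap.add_apply, hd, map_add, extDer_add,
            lieForm_add_left]
          ring
        map_smul' := fun f D => by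
          ext Y
          simp only [AlternatingMap.sub_apply, AlternatingMap.smul_apply, hd, map_smul,
            extDer_smul, lieForm_smul_left, RingHom.id_apply, smul_eq_mul]
          simp only [← curryLeft_removeNth, mul_left_comm]
          ring }
    have hB : ∀ D Y, B D Y = extDer α (Fin.cons D Y) := fun D Y => by
      rw [extDer_cons, ← hd]; rfl
    obtain ⟨η, hη⟩ := exists_uncurryLeft B (fun D Y => by
      have hs : lieForm D α (Fin.cons D Y) = lieForm D (α.curryLeft D) Y := by
        rw [lieForm_cons, lie_self, α.map_coord_zero 0 rfl, sub_zero]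
      rw [hB, extDer_cons, hs]
      rcases p with _ | p
      · rw [extDer_zero_form]
        simp only [lieForm_apply, Finset.univ_eq_empty, Finset.sum_empty, sub_zero, Fin.cons_zero]
        rw [Subsingleton.elim Y Fin.elim0, sub_self]
      · rw [extDer_cons, AlternatingMap.curryLeft_same]
        simp [extDer])
    refine ⟨η, fun Y => ?_⟩
    rw [← Fin.cons_self_tail Y, hη, hB]

end Algebra

/-! ### The BV Laplacian -/

section Algebra

variable {A : Type*} [CommRing A] [Algebra ℝ A]

open CliffordAlgebra (involute)

/-- The Lie derivative of inhomogeneous differential forms. -/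
def lieForms (D : VF A) (α : Form A) : Form A := fun p => lieForm D (α p)

variable (A) in
/-- The component of degree `0` of a differential form, as a function. -/
def formZero : Form A →ₗ[A] A where
  toFun α := α 0 Fin.elim0
  map_add' _ _ := rfl
  map_smul' _ _ := rfl

theorem formZero_lieForms (D : VF A) (α : Form A) :
    formZero A (lieForms D α) = D (formZero A α) := by
  change lieForm D (α 0) Fin.elim0 = D (α 0 Fin.elim0)
  rw [lieForm_apply, Finset.univ_eq_empty, Finset.sum_empty, sub_zero]

theorem contract_ofVF (D : VF A) : contract (ofVF D) = contractVF D :=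
  ExteriorAlgebra.lift_ι_apply A _ _ D

theorem contract_mul_apply (P R : MV A) (α : Form A) :
    contract (P * R) α = contract P (contract R α) := by rw [map_mul]; rfl

theorem contract_ofFun (f : A) (α : Form A) : contract (ofFun f) α = f • α := by
  rw [AlgHom.commutes]; rfl

theorem contractVF_apply (D : VF A) (α : Form A) (p : ℕ) :
    contractVF D α p = (α (p + 1)).curryLeft D := rfl

theorem phi_mul {n : ℕ} (v : PForm A n) (P R : MV A) : phi v (P * R) = contract P (phi v R) :=
  contract_mul_apply P R _

/-- Cartan's formula `d ι_D α = L_D α - ι_D dα`. -/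
theorem isExtDer_contractVF {α η : Form A} (h : IsExtDer α η) (D : VF A) :
    IsExtDer (contractVF D α) (lieForms D α - contractVF D η) := by
  constructor
  · ext Y
    change lieForm D (α 0) Y - η 1 (Fin.cons D Y) = 0
    rw [h.2, extDer_zero_form, lieForm_apply, Finset.univ_eq_empty, Finset.sum_empty,
      Fin.cons_zero, Subsingleton.elim Y Fin.elim0]
    ring
  · intro p Y
    change lieForm D (α (p + 1)) Y - η (p + 1 + 1) (Fin.cons D Y) = _
    rw [h.2, extDer_cons, contractVF_apply]
    ring

theorem lieForms_contractVF (D E : VF A) (α : Form A) :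
    lieForms D (contractVF E α) = contractVF ⁅D, E⁆ α + contractVF E (lieForms D α) := by
  funext p
  ext Y
  change lieForm D ((α (p + 1)).curryLeft E) Y =
    α (p + 1) (Fin.cons ⁅D, E⁆ Y) + lieForm D (α (p + 1)) (Fin.cons E Y)
  rw [lieForm_cons]
  ring

theorem lieForms_add (D : VF A) (α β : Form A) :
    lieForms D (α + β) = lieForms D α + lieForms D β :=
  funext fun p => lieForm_add_right D (α p) (β p)

/-- The commutation rule `L_D ι_P = ι_{L_D P} + ι_P L_D`, where `L_D P = [D, P]`. -/
theorem lieForms_contract (D : VF A) (P : MV A) (α : Form A) :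
    lieForms D (contract P α) = contract (lieDerivative D P) α + contract P (lieForms D α) := by
  induction P using CliffordAlgebra.left_induction generalizing α with
  | algebraMap f =>
    change lieForms D (contract (ofFun f) α) =
      contract (lieDerivative D (ofFun f)) α + contract (ofFun f) (lieForms D α)
    rw [lieDerivative_ofFun, contract_ofFun, contract_ofFun, contract_ofFun, add_comm]
    exact funext fun p => lieForm_smul_right D f (α p)
  | add x y hx hy =>
    simp only [map_add, LinearMap.add_apply, lieForms_add, hx, hy]; abel
  | ι_mul x E hx =>
    change lieForms D (contract (ofVF E * x) α) =
      contract (lieDerivative D (ofVF E * x)) α + contract (ofVF E * x) (lieForms D α)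
    rw [lieDerivative_ofVF_mul, map_add, LinearMap.add_apply]
    simp only [contract_mul_apply, contract_ofVF]
    rw [lieForms_contractVF, hx, map_add, add_assoc]

theorem IsExtDer.add {α η β θ : Form A} (h : IsExtDer α η) (h' : IsExtDer β θ) :
    IsExtDer (α + β) (η + θ) := by
  refine ⟨?_, fun p Y => ?_⟩
  · rw [Pi.add_apply, h.1, h'.1, add_zero]
  · rw [Pi.add_apply, Pi.add_apply, AlternatingMap.add_apply, h.2, h'.2, extDer_add]

theorem IsExtDer.unique {α η θ : Form A} (h : IsExtDer α η) (h' : IsExtDer α θ) : η = θ := by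
  funext p
  rcases p with _ | p
  · rw [h.1, h'.1]
  · ext Y
    rw [h.2, h'.2]

theorem IsExtDer.formZero_eq_zero {α η : Form A} (h : IsExtDer α η) : formZero A η = 0 := by
  change η 0 Fin.elim0 = 0
  rw [h.1, AlternatingMap.zero_apply]

variable {n : ℕ} {v : PForm A n}

theorem IsBVLaplacian.add {X Z Y W : MV A} (h : IsBVLaplacian v X Z) (h' : IsBVLaplacian v Y W) :
    IsBVLaplacian v (X + Y) (Z + W) := by
  unfold IsBVLaplacian
  rw [map_add, map_add]
  exact IsExtDer.add h h'

theorem lieForms_single (D : VF A) (v : PForm A n) :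
    lieForms D (Pi.single n v) = Pi.single n (lieForm D v) := by
  funext p
  by_cases hp : p = n
  · subst hp; simp [lieForms]
  · simp [lieForms, Pi.single_eq_of_ne hp, lieForm_zero_right]

/-- The recursion `Δ(D P) = [D, P] + div(D) P - D Δ(P)`. -/
theorem IsBVLaplacian.ofVF_mul {P W : MV A} (h : IsBVLaplacian v P W) {D : VF A} {g : A}
    (hg : lieForm D v = g • v) :
    IsBVLaplacian v (ofVF D * P) (lieDerivative D P + g • P - ofVF D * W) := by
  have := isExtDer_contractVF h D
  unfold IsBVLaplacian
  rw [phi_mul, contract_ofVF, map_sub, map_add, phi_mul, contract_ofVF, map_smul]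
  convert this using 2
  change _ = lieForms D (contract P (Pi.single n v))
  rw [lieForms_contract, lieForms_single, hg, Pi.single_smul, map_smul]
  rfl

/-- Forms of the top degree are closed. -/
theorem isExtDer_single (hn : ∀ β : PForm A (n + 1), β = 0) (v : PForm A n) :
    IsExtDer (Pi.single n v) 0 := by
  refine ⟨rfl, fun p Y => ?_⟩
  by_cases hp : p = n
  · subst hp
    obtain ⟨η, hη⟩ := exists_extDer p v
    rw [Pi.single_eq_same, ← hη, hn η]; rfl
  · rw [Pi.single_eq_of_ne hp]
    simp [extDer]

theorem phi_ofFun (f : A) : phi v (ofFun f) = Pi.single n (f • v) := by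
  change contract (ofFun f) _ = _
  rw [contract_ofFun, Pi.single_smul]

theorem isBVLaplacian_ofFun (hn : ∀ β : PForm A (n + 1), β = 0) (f : A) :
    IsBVLaplacian v (ofFun f) 0 := by
  unfold IsBVLaplacian
  rw [phi_ofFun, map_zero]
  exact isExtDer_single hn _

/-- Every `P` has a BV Laplacian, and `Δ(g P) = g Δ(P) - [g, P]`. Both assertions follow from the
recursion for `Δ(D P)`. -/
theorem exists_isBVLaplacian_fun_smul (hn : ∀ β : PForm A (n + 1), β = 0)
    (hdiv : ∀ D : VF A, ∃ g : A, lieForm D v = g • v) (g : A) (P : MV A) :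
    ∃ W, IsBVLaplacian v P W ∧ IsBVLaplacian v (g • P) (g • W - funBracket g P) := by
  induction P using CliffordAlgebra.left_induction with
  | algebraMap f =>
    refine ⟨0, isBVLaplacian_ofFun hn f, ?_⟩
    change IsBVLaplacian v (g • ofFun f) (g • 0 - funBracket g (ofFun f))
    rw [funBracket_ofFun, smul_zero, sub_zero, ofFun, Algebra.smul_def, ← map_mul]
    exact isBVLaplacian_ofFun hn _
  | add x y hx hy =>
    obtain ⟨W, h1, h2⟩ := hx
    obtain ⟨W', h1', h2'⟩ := hy
    refine ⟨W + W', h1.add h1', ?_⟩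
    rw [map_add, smul_add, smul_add, add_sub_add_comm]
    exact h2.add h2'
  | ι_mul x D hx =>
    obtain ⟨W, h1, h2⟩ := hx
    obtain ⟨c, hc⟩ := hdiv D
    refine ⟨_, h1.ofVF_mul hc, ?_⟩
    change IsBVLaplacian v (g • (ofVF D * x)) (_ - funBracket g (ofVF D * x))
    rw [← mul_smul_comm]
    convert h2.ofVF_mul hc using 1
    rw [lieDerivative_fsmul, funBracket_ofVF_mul]
    simp only [smul_add, smul_sub, mul_sub, mul_smul_comm, smul_comm g c]
    abel

theorem IsBVLaplacian.fun_smul (hn : ∀ β : PForm A (n + 1), β = 0)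
    (hdiv : ∀ D : VF A, ∃ g : A, lieForm D v = g • v) (g : A) {P W : MV A}
    (h : IsBVLaplacian v P W) : IsBVLaplacian v (g • P) (g • W - funBracket g P) := by
  obtain ⟨W', h1, h2⟩ := exists_isBVLaplacian_fun_smul hn hdiv g P
  unfold IsBVLaplacian at *
  rw [map_sub, map_smul (phi v) g W, h.unique h1, ← map_smul, ← map_sub]
  exact h2

theorem formZero_contract_smul (h : A) (P : MV A) (α : Form A) :
    formZero A (contract P (h • α)) = h * formZero A (contract P α) := by
  rw [map_smul, map_smul, smul_eq_mul]

theorem hamiltonian_one (X : MV A) : hamiltonian X 1 = 0 := by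
  have h1 : (1 : MV A) = ofFun 1 := (map_one _).symm
  induction X using CliffordAlgebra.left_induction with
  | algebraMap f =>
    change hamiltonian (ofFun f) 1 = 0
    rw [hamiltonian_ofFun, h1, funBracket_ofFun]
  | add x y hx hy => rw [hamiltonian_add, LinearMap.add_apply, hx, hy, add_zero]
  | ι_mul x D hx =>
    change hamiltonian (ofVF D * x) 1 = 0
    rw [hamiltonian_ofVF_mul, hx, h1, lieDerivative_ofFun, Derivation.map_one_eq_zero, ofFun,
      map_zero, mul_zero, mul_zero, add_zero]

/-- The BV Laplacian `Z` of an `i`-vector field `X`. It has the parity of an `i - 1`-vector field,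
satisfies the second order product rule
`Δ(X f) = Δ(X) f + (-1)^i X Δ(f) + (-1)^{i+1} [X, f]`, and, by Stokes' theorem for functions
(`hI`), the integration by parts formula `∫ ι_X dα = (-1)^i ∫ ι_Z α`. -/
theorem exists_laplacian (hn : ∀ β : PForm A (n + 1), β = 0)
    (hdiv : ∀ D : VF A, ∃ g : A, lieForm D v = g • v) (Ac : Ideal A) (I : A →ₗ[ℝ] ℝ)
    (hI : ∀ (D : VF A) (g : A), lieForm D v = g • v → ∀ a ∈ Ac, I (D a + g * a) = 0)
    {i : ℕ} {X : MV A} (hX : X ∈ ⋀[A]^i (VF A)) :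
    ∃ Z : MV A, involute Z = (-1 : ℤ) ^ (i + 1) • Z ∧
      (∀ f W, IsBVLaplacian v f W → IsBVLaplacian v (X * f)
        (Z * f + (-1 : ℤ) ^ i • (X * W) + (-1 : ℤ) ^ (i + 1) • hamiltonian X f)) ∧
      ∀ α η, IsExtDer α η → (∃ h ∈ Ac, h • α = α) →
        I (formZero A (contract X η)) = (-1 : ℤ) ^ i • I (formZero A (contract Z α)) := by
  refine exteriorPower_induction (C := fun i X => ∃ Z : MV A,
    involute Z = (-1 : ℤ) ^ (i + 1) • Z ∧
      (∀ f W, IsBVLaplacian v f W → IsBVLaplacian v (X * f)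
        (Z * f + (-1 : ℤ) ^ i • (X * W) + (-1 : ℤ) ^ (i + 1) • hamiltonian X f)) ∧
      ∀ α η, IsExtDer α η → (∃ h ∈ Ac, h • α = α) →
        I (formZero A (contract X η)) = (-1 : ℤ) ^ i • I (formZero A (contract Z α))) ?_ ?_ ?_ hX
  · intro g
    refine ⟨0, by simp, fun f W h => ?_, fun α η h _ => ?_⟩
    · convert h.fun_smul hn hdiv g using 1
      · rw [Algebra.smul_def]
      · rw [hamiltonian_ofFun, Algebra.smul_def g W]
        rw [pow_zero, zero_add, pow_one, neg_smul, one_smul, one_smul, zero_mul, zero_add,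
          ← sub_eq_add_neg]
    · rw [contract_ofFun, map_smul, h.formZero_eq_zero]
      simp
  · rintro i X Y ⟨Z, h1, h2, h3⟩ ⟨Z', h1', h2', h3'⟩
    refine ⟨Z + Z', by rw [map_add, h1, h1', smul_add], fun f W h => ?_, fun α η h hα => ?_⟩
    · convert (h2 f W h).add (h2' f W h) using 1
      · rw [add_mul]
      · rw [hamiltonian_add]
        simp only [add_mul, smul_add, LinearMap.add_apply]; abel
    · simp only [map_add, LinearMap.add_apply, h3 α η h hα, h3' α η h hα, smul_add]
  · rintro i D X hX ⟨Z, h1, h2, h3⟩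
    obtain ⟨g, hg⟩ := hdiv D
    -- the recursion `Δ(D X) = [D, X] + div(D) X - D Δ(X)`
    refine ⟨lieDerivative D X + g • X - ofVF D * Z, ?_, fun f W h => ?_, ?_⟩
    · rw [map_sub, map_add, map_smul, involute_mem (lieDerivative_mem D hX), involute_mem hX,
        involute_ofVF_mul, h1]
      rcases neg_one_pow_eq_or ℤ i with hi | hi <;>
      · simp only [pow_succ, hi, mul_neg, mul_one, neg_neg, neg_smul, one_smul, smul_neg]
        try abel
    · convert (h2 f W h).ofVF_mul hg using 1
      · rw [mul_assoc]
      · rw [hamiltonian_ofVF_mul, lieDerivative_mul, involute_mem hX]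
        rcases neg_one_pow_eq_or ℤ i with hi | hi <;>
        · simp only [mul_add, add_mul, sub_mul, mul_assoc, pow_succ, hi, mul_one, neg_neg,
            neg_smul, one_smul, mul_neg, neg_mul, smul_mul_assoc]
          abel
    · intro α η h hα
      obtain ⟨a, ha, haα⟩ := hα
      -- the hypothesis for `ι_D α`, whose exterior derivative is `L_D α - ι_D dα`; the integral of
      -- `L_D` of the function `(ι_X α)₀` is removed by Stokes' theorem
      have e1 := h3 _ _ (isExtDer_contractVF h D) ⟨a, ha, by rw [← map_smul, haα]⟩
      have e2 := lieForms_contract D X α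
      have e3 := hI D g hg (formZero A (contract X α)) (by
        rw [← haα, formZero_contract_smul]; exact Ac.mul_mem_right _ ha)
      have e4 : X * ofVF D = (-1 : ℤ) ^ i • (ofVF D * X) := mul_ofVF_of_mem hX D
      have e5 : Z * ofVF D = (-1 : ℤ) ^ (i + 1) • (ofVF D * Z) := by
        rw [mul_ofVF, h1, mul_smul_comm]
      rw [← contract_ofVF, ← contract_mul_apply, map_sub, ← contract_mul_apply, e4, e5] at e1
      rw [← formZero_lieForms, e2] at e3
      simp only [map_add, map_sub, map_smul, map_zsmul, LinearMap.add_apply, LinearMap.sub_apply,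
        LinearMap.smul_apply, smul_eq_mul] at e1 e3 ⊢
      rcases neg_one_pow_eq_or ℤ i with hi | hi <;>
      · simp only [pow_succ, hi, mul_neg_one, neg_neg, one_smul, neg_smul] at e1 ⊢
        linarith

/-- The degree `p` component of `ι_P v` comes from the part of `P` of degree `n - p`. -/
theorem contract_involute_single (v : PForm A n) (P : MV A) (p : ℕ) :
    contract (involute P) (Pi.single n v) p =
      (-1 : ℤ) ^ (n + p) • contract P (Pi.single n v) p := by
  induction P using CliffordAlgebra.left_induction generalizing p with
  | algebraMap f =>
    change contract (involute (ofFun f)) _ p = _ • contract (ofFun f) _ p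
    rw [involute_ofFun, contract_ofFun, ← Pi.single_smul]
    by_cases hp : p = n
    · subst hp; rw [Even.neg_one_pow ⟨p, rfl⟩, one_smul]
    · rw [Pi.single_eq_of_ne hp, smul_zero]
  | add x y hx hy =>
    simp only [map_add, LinearMap.add_apply, Pi.add_apply, hx, hy, smul_add]
  | ι_mul x D hx =>
    change contract (involute (ofVF D * x)) _ p = _ • contract (ofVF D * x) _ p
    rw [involute_ofVF_mul, map_neg, LinearMap.neg_apply, contract_mul_apply, contract_mul_apply,
      contract_ofVF, Pi.neg_apply, contractVF_apply, contractVF_apply, hx, ← add_assoc, pow_succ,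
      mul_neg_one, neg_smul]
    ext Y
    simp

/-- Graded commutativity under the Berezinian, for `Z` with the parity of an `(i + 1)`-vector field.
Only the component of degree `n` of the product counts, so that the sign depends on `n`. -/
theorem formZero_phi_mul_comm (v : PForm A n) {i : ℕ} {Z : MV A}
    (hZ : involute Z = (-1 : ℤ) ^ (i + 1) • Z) (f : MV A) :
    formZero A (phi v (Z * f)) =
      (-1 : ℤ) ^ (n * (i + 1) + i + 1) • formZero A (phi v (f * Z)) := by
  have key : ∀ P, formZero A (phi v (involute P)) = (-1 : ℤ) ^ n • formZero A (phi v P) :=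
    fun P => by
      change contract (involute P) (Pi.single n v) 0 Fin.elim0 = _
      rw [contract_involute_single, add_zero]; rfl
  have h1 : formZero A (phi v (involute f * Z)) =
      (-1 : ℤ) ^ n • (-1 : ℤ) ^ (i + 1) • formZero A (phi v (f * Z)) := by
    have : involute (f * Z) = (-1 : ℤ) ^ (i + 1) • (involute f * Z) := by
      rw [map_mul, hZ, mul_smul_comm]
    have h := key (f * Z)
    rw [this, map_zsmul, map_zsmul] at h
    rw [smul_comm, ← h, smul_smul, ← pow_add, Even.neg_one_pow ⟨_, rfl⟩, one_smul]
  have h2 := congrArg (fun P => formZero A (phi v P)) (two_smul_mul Z f)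
  simp only [hZ, add_mul, sub_mul, mul_smul_comm, map_add, map_sub, map_zsmul, h1] at h2
  have h3 : ∀ a b : A, (2 : ℤ) • a = (2 : ℤ) • b → a = b := fun a b h => by
    have := congrArg (fun x => (1 / 2 : ℝ) • x) h
    simpa [← Int.cast_smul_eq_zsmul ℝ, smul_smul] using this
  apply h3
  rw [h2]
  rw [show n * (i + 1) + i + 1 = n * (i + 1) + (i + 1) by ring, pow_add _ _ (i + 1),
    pow_mul]
  rcases neg_one_pow_eq_or ℤ n with hn | hn <;> rcases neg_one_pow_eq_or ℤ (i + 1) with hi | hi <;>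
  · simp only [hn, hi, one_pow, mul_one, one_smul, neg_smul, smul_neg, neg_neg, mul_neg, two_smul]
    abel

/-- Forms are determined by the functions that they yield on contraction with multivector
fields. -/
theorem form_eq_zero_of_contract {β : Form A} (h : ∀ P, formZero A (contract P β) = 0) :
    β = 0 := by
  suffices ∀ (p : ℕ) (β : Form A), (∀ P, formZero A (contract P β) = 0) → β p = 0 from
    funext fun p => this p β h
  intro p
  induction p with
  | zero =>
    intro β h
    ext Y
    have := h (ofFun 1)
    rw [contract_ofFun, one_smul] at this
    rw [Subsingleton.elim Y Fin.elim0]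
    exact this
  | succ p ih =>
    intro β h
    ext Y
    have := ih (contractVF (Y 0) β) fun P => by
      rw [← contract_ofVF, ← contract_mul_apply]; exact h _
    rw [← Fin.cons_self_tail Y]
    exact congrArg (fun γ => γ (Fin.tail Y)) this

/-- The BV Laplacian of `X` is half the divergence of `[X, ·]`, up to sign, in terms of an
abstract integral `I` that satisfies Stokes' theorem on the ideal `Ac` of compactly supported
functions and is nondegenerate. -/
theorem isBVLaplacian_iff_of_integral (hn : ∀ β : PForm A (n + 1), β = 0)
    (hdiv : ∀ D : VF A, ∃ g : A, lieForm D v = g • v) (Ac : Ideal A)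
    (hAc : ∀ h ∈ Ac, ∃ h' ∈ Ac, h' * h = h) (I : A →ₗ[ℝ] ℝ)
    (hI : ∀ (D : VF A) (g : A), lieForm D v = g • v → ∀ a ∈ Ac, I (D a + g * a) = 0)
    (hnd : ∀ a : A, (∀ h ∈ Ac, I (h * a) = 0) → a = 0)
    {i : ℕ} {X : MV A} (hX : X ∈ ⋀[A]^i (VF A)) :
    (∃ Z, IsBVLaplacian v X Z) ∧ ∀ Z, IsBVLaplacian v X Z ↔
      ∀ f : MV A, (∃ h ∈ Ac, h • f = f) → I (formZero A (phi v (hamiltonian X f))) =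
        -I (formZero A (phi v (f * ((2 * (-1 : ℝ) ^ (n * (i + 1))) • Z)))) := by
  obtain ⟨Z₀, h1, h2, h3⟩ := exists_laplacian hn hdiv Ac I hI hX
  -- the product rule for `X · 1`
  have hZ₀ : IsBVLaplacian v X Z₀ := by
    have := h2 1 0 (by simpa using isBVLaplacian_ofFun (v := v) hn 1)
    convert this using 1
    · rw [mul_one]
    · simp [hamiltonian_one]
  have hex : ∀ f, ∃ W, IsBVLaplacian v f W := fun f =>
    let ⟨W, hW, _⟩ := exists_isBVLaplacian_fun_smul hn hdiv 0 f
    ⟨W, hW⟩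
  have hmain : ∀ f : MV A, (∃ h ∈ Ac, h • f = f) → I (formZero A (phi v (hamiltonian X f))) =
      -((2 * (-1 : ℝ) ^ (n * (i + 1))) * I (formZero A (phi v (f * Z₀)))) := by
    rintro f ⟨h, hh, hf⟩
    obtain ⟨W, hW⟩ := hex f
    -- `φ_v(Δ(X f))` is exact, hence has no component of degree `0`; so `∫ [X, f]` is, up to sign,
    -- the sum of `∫ Δ(X) f` and `± ∫ X Δ(f)`, which are equal by integration by parts
    have e1 := (h2 f W hW).formZero_eq_zero
    have e2 := h3 _ _ hW ⟨h, hh, by rw [← map_smul, hf]⟩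
    rw [← phi_mul, ← phi_mul, formZero_phi_mul_comm v h1] at e2
    simp only [map_add, map_zsmul, formZero_phi_mul_comm v h1] at e1
    have e3 := congrArg I e1
    simp only [map_add, map_zsmul, map_zero, e2] at e3
    have e4 : (-1 : ℝ) ^ (n * (i + 1)) = (((-1 : ℤ) ^ (n * (i + 1)) : ℤ) : ℝ) := by push_cast; rfl
    rw [e4]
    rcases neg_one_pow_eq_or ℤ (n * (i + 1)) with hq | hq <;>
    rcases neg_one_pow_eq_or ℤ i with hi | hi <;>
    · simp only [pow_add, pow_one, hq, hi, mul_neg, mul_one, neg_neg, neg_smul, one_smul, smul_neg,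
        Int.cast_one, Int.cast_neg] at e3 ⊢
      linarith
  have hsmul : ∀ (r : ℝ) (f Z : MV A), I (formZero A (phi v (f * (r • Z)))) =
      r * I (formZero A (phi v (f * Z))) := fun r f Z => by
    rw [← algebraMap_smul A r Z, mul_smul_comm, map_smul, map_smul, algebraMap_smul, map_smul,
      smul_eq_mul]
  refine ⟨⟨Z₀, hZ₀⟩, fun Z => ⟨fun hZ f hf => ?_, fun H => ?_⟩⟩
  · rw [hmain f hf, hsmul, phi_mul, phi_mul, hZ.unique hZ₀]
  · have : phi v Z - phi v Z₀ = 0 := by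
      -- `φ_v(Z)` is determined by testing with the functions `h P`, `h` compactly supported
      refine form_eq_zero_of_contract fun P => hnd _ fun h hh => ?_
      obtain ⟨h', hh', e⟩ := hAc h hh
      have hf : h' • (h • P) = h • P := by rw [smul_smul, e]
      have e1 := hmain (h • P) ⟨h', hh', hf⟩
      rw [H _ ⟨h', hh', hf⟩, hsmul, neg_inj] at e1
      have e2 := mul_left_cancel₀ (mul_ne_zero two_ne_zero (pow_ne_zero _ (by norm_num))) e1
      have e3 : ∀ Y, formZero A (phi v (h • P * Y)) = h * formZero A (contract P (phi v Y)) :=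
        fun Y => by rw [smul_mul_assoc, map_smul, map_smul, phi_mul, smul_eq_mul]
      rw [e3, e3, ← sub_eq_zero, ← map_sub, ← mul_sub, ← map_sub, ← map_sub] at e2
      exact e2
    unfold IsBVLaplacian
    rw [sub_eq_zero.1 this]
    exact hZ₀

end Algebra

/-! ### Hadamard's lemma -/

section Hadamard

open MeasureTheory intervalIntegral Set Filter Topology

variable {E : Type} [NormedAddCommGroup E] [NormedSpace ℝ E] [FiniteDimensional ℝ E]

/-- Smoothness of `x ↦ ∫₀¹ w(t) f(t x) dt`. The weight `w` makes the statement stable under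
differentiation, which replaces `w(t)` by `t w(t)` and `f` by its derivative. -/
theorem contDiff_nat_integral_comp_smul (k : ℕ) : ∀ {G : Type} [NormedAddCommGroup G]
    [NormedSpace ℝ G] [CompleteSpace G] {f : E → G}, ContDiff ℝ ∞ f → ∀ {w : ℝ → ℝ},
    Continuous w → ContDiff ℝ k fun x => ∫ t in (0 : ℝ)..1, w t • f (t • x) := by
  have hcont : ∀ {G : Type} [NormedAddCommGroup G] [NormedSpace ℝ G] {f : E → G},
      ContDiff ℝ ∞ f → ∀ {w : ℝ → ℝ}, Continuous w →
      Continuous (Function.uncurry fun (x : E) (t : ℝ) => w t • f (t • x)) := by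
    intro G _ _ f hf w hw
    have := hf.continuous
    unfold Function.uncurry
    fun_prop
  induction k with
  | zero =>
    intro G _ _ _ f hf w hw
    rw [Nat.cast_zero, contDiff_zero]
    exact continuous_parametric_intervalIntegral_of_continuous' (hcont hf hw) 0 1
  | succ k ih =>
    intro G _ _ _ f hf w hw
    have hf' : ContDiff ℝ ∞ (fderiv ℝ f) := hf.fderiv_right (by simp)
    have hw' : Continuous fun t => w t * t := hw.mul continuous_id
    have hderiv : ∀ x, HasFDerivAt (fun x => ∫ t in (0 : ℝ)..1, w t • f (t • x))
        (∫ t in (0 : ℝ)..1, (w t * t) • fderiv ℝ f (t • x)) x := by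
      intro x
      have hc := hcont hf' hw'
      obtain ⟨C, hC⟩ := ((isCompact_closedBall x 1).prod (isCompact_Icc (a := (0 : ℝ)) (b := 1))
        ).exists_bound_of_continuousOn hc.continuousOn
      refine hasFDerivAt_integral_of_dominated_of_fderiv_le
        (F := fun x t => w t • f (t • x))
        (F' := fun x t => (w t * t) • fderiv ℝ f (t • x)) (bound := fun _ => C)
        (Metric.closedBall_mem_nhds x one_pos)
        (Eventually.of_forall fun x => ?_) ?_ ?_ ?_ ?_ ?_
      · exact ((hcont hf hw).comp (Continuous.prodMk_right x)).aestronglyMeasurable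
      · exact ((hcont hf hw).comp (Continuous.prodMk_right x)).intervalIntegrable _ _
      · exact (hc.comp (Continuous.prodMk_right x)).aestronglyMeasurable
      · refine Eventually.of_forall fun t ht y hy => hC (y, t) ⟨hy, ?_⟩
        rw [uIoc_of_le zero_le_one] at ht
        exact ⟨ht.1.le, ht.2⟩
      · exact intervalIntegrable_const
      · refine Eventually.of_forall fun t _ y _ => ?_
        have h1 : HasFDerivAt f (fderiv ℝ f (t • y)) (t • y) :=
          (hf.differentiable (by simp) _).hasFDerivAt
        have h2 : HasFDerivAt (fun y : E => t • y) (t • ContinuousLinearMap.id ℝ E) y :=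
          (hasFDerivAt_id y).const_smul t
        have h3 : (w t * t) • fderiv ℝ f (t • y) =
            w t • (fderiv ℝ f (t • y) ∘SL (t • ContinuousLinearMap.id ℝ E)) := by
          ext z
          simp [mul_smul]
        rw [h3]
        exact (h1.comp y h2).const_smul (w t)
    rw [Nat.cast_succ, contDiff_succ_iff_fderiv]
    refine ⟨fun x => (hderiv x).differentiableAt, by simp, ?_⟩
    rw [show fderiv ℝ (fun x => ∫ t in (0 : ℝ)..1, w t • f (t • x)) =
      fun x => ∫ t in (0 : ℝ)..1, (w t * t) • fderiv ℝ f (t • x) from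
        funext fun x => (hderiv x).fderiv]
    exact ih hf' hw'

theorem sum_smul_single {n : ℕ} (z : EuclideanSpace ℝ (Fin n)) :
    ∑ i, z i • EuclideanSpace.single i (1 : ℝ) = z := by
  ext j
  simp [Pi.single_apply]

/-- Hadamard's lemma: `f(y) = f(x₀) + ∑ᵢ (yᵢ - x₀ᵢ) Gᵢ(y)` with `Gᵢ` smooth and
`Gᵢ(x₀) = ∂ᵢf(x₀)`. -/
theorem exists_hadamard {n : ℕ} {f : EuclideanSpace ℝ (Fin n) → ℝ} (hf : ContDiff ℝ ∞ f)
    (x₀ : EuclideanSpace ℝ (Fin n)) :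
    ∃ G : Fin n → EuclideanSpace ℝ (Fin n) → ℝ, (∀ i, ContDiff ℝ ∞ (G i)) ∧
      (∀ y, f y = f x₀ + ∑ i, (y i - x₀ i) * G i y) ∧
      ∀ i, G i x₀ = fderiv ℝ f x₀ (EuclideanSpace.single i 1) := by
  let F : EuclideanSpace ℝ (Fin n) → EuclideanSpace ℝ (Fin n) →L[ℝ] ℝ :=
    fun z => fderiv ℝ f (x₀ + z)
  have hF : ContDiff ℝ ∞ F :=
    (hf.fderiv_right (by simp)).comp (contDiff_const.add contDiff_id)
  let J : EuclideanSpace ℝ (Fin n) → EuclideanSpace ℝ (Fin n) →L[ℝ] ℝ :=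
    fun z => ∫ t in (0 : ℝ)..1, (1 : ℝ) • F (t • z)
  have hJ : ContDiff ℝ ∞ J :=
    contDiff_infty.2 fun k => contDiff_nat_integral_comp_smul k hF continuous_const
  refine ⟨fun i y => J (y - x₀) (EuclideanSpace.single i 1), fun i => ?_, fun y => ?_, fun i => ?_⟩
  · exact (hJ.comp (contDiff_id.sub contDiff_const)).clm_apply contDiff_const
  · have h1 : ∑ i, (y i - x₀ i) * J (y - x₀) (EuclideanSpace.single i 1) =
        J (y - x₀) (y - x₀) := by
      have := congrArg (J (y - x₀)) (sum_smul_single (y - x₀))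
      rw [map_sum] at this
      rw [← this]
      exact Finset.sum_congr rfl fun i _ => by rw [map_smul]; rfl
    have hcont : Continuous fun t : ℝ => F (t • (y - x₀)) :=
      hF.continuous.comp (continuous_id.smul continuous_const)
    have h2 : J (y - x₀) (y - x₀) = ∫ t in (0 : ℝ)..1, F (t • (y - x₀)) (y - x₀) := by
      simp only [J, one_smul]
      exact ContinuousLinearMap.intervalIntegral_apply
        (hcont.intervalIntegrable (μ := volume) _ _) (y - x₀)
    have h3 : ∫ t in (0 : ℝ)..1, F (t • (y - x₀)) (y - x₀) =
        f (x₀ + (1 : ℝ) • (y - x₀)) - f (x₀ + (0 : ℝ) • (y - x₀)) := by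
      refine integral_eq_sub_of_hasDerivAt (f := fun t : ℝ => f (x₀ + t • (y - x₀)))
        (fun t _ => ?_) ?_
      · have e1 : HasFDerivAt f (F (t • (y - x₀))) (x₀ + t • (y - x₀)) :=
          (hf.differentiable (by simp) _).hasFDerivAt
        have e2 : HasDerivAt (fun t : ℝ => x₀ + t • (y - x₀)) (y - x₀) t := by
          simpa using ((hasDerivAt_id t).smul_const (y - x₀)).const_add x₀
        exact e1.comp_hasDerivAt t e2
      · exact (hcont.clm_apply continuous_const).intervalIntegrable _ _
    rw [h1, h2, h3]
    simp
  · simp [J, F]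

end Hadamard

/-! ### Local frames of vector fields -/

section Manifold

open Set Filter Topology

variable {n : ℕ} {M : Type*} [TopologicalSpace M] [ChartedSpace (EuclideanSpace ℝ (Fin n)) M]
  [IsManifold (𝓡 n) ∞ M]

theorem contDiffOn_comp_chart_symm (h : Sm (n := n) M) (c : M) :
    ContDiffOn ℝ ∞ (fun z => h ((chartAt (EuclideanSpace ℝ (Fin n)) c).symm z))
      (chartAt (EuclideanSpace ℝ (Fin n)) c).target := by
  rw [← contMDiffOn_iff_contDiffOn]
  exact h.contMDiff.comp_contMDiffOn (contMDiffOn_chart_symm (I := 𝓡 n) (x := c))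

/-- The function `ψ · (G ∘ c)` on `M`, for a function `G` of the coordinates and a cutoff `ψ`
supported in the domain of the chart. -/
def ofCoord (c : M) (ψ : Sm (n := n) M)
    (hψ : tsupport ψ ⊆ (chartAt (EuclideanSpace ℝ (Fin n)) c).source)
    (G : EuclideanSpace ℝ (Fin n) → ℝ)
    (hG : ContDiffOn ℝ ∞ G (chartAt (EuclideanSpace ℝ (Fin n)) c).target) : Sm (n := n) M :=
  ⟨fun x => ψ x * G (chartAt (EuclideanSpace ℝ (Fin n)) c x), by
    refine contMDiff_of_tsupport fun x hx => ?_
    have hx' : x ∈ (chartAt (EuclideanSpace ℝ (Fin n)) c).source :=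
      hψ (tsupport_mul_subset_left hx)
    refine ψ.contMDiff.contMDiffAt.mul ?_
    have h1 := contMDiffAt_of_mem_maximalAtlas (I := 𝓡 n) (n := ∞)
      (IsManifold.chart_mem_maximalAtlas c) hx'
    have h2 : ContMDiffAt (𝓡 n) 𝓘(ℝ, ℝ) ∞ G (chartAt (EuclideanSpace ℝ (Fin n)) c x) :=
      ((hG _ ((chartAt _ c).map_source hx')).contDiffAt
        ((chartAt _ c).open_target.mem_nhds ((chartAt _ c).map_source hx'))).contMDiffAt
    exact h2.comp x h1⟩

theorem ofCoord_apply (c : M) (ψ : Sm (n := n) M) (hψ) (G) (hG) (x : M) :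
    ofCoord c ψ hψ G hG x = ψ x * G (chartAt (EuclideanSpace ℝ (Fin n)) c x) := rfl

variable [T2Space M] [SigmaCompactSpace M]

/-- A smooth compactly supported function in `U` that is `1` near `K`. -/
theorem exists_bump {K U : Set M} (hK : IsCompact K) (hU : IsOpen U) (hKU : K ⊆ U) :
    ∃ ψ : Sm (n := n) M, (∀ᶠ x in 𝓝ˢ K, ψ x = 1) ∧ HasCompactSupport ψ ∧ tsupport ψ ⊆ U := by
  have : LocallyCompactSpace M := Manifold.locallyCompact_of_finiteDimensional (𝓡 n)
  obtain ⟨K', hK', h1, h2⟩ := exists_compact_between hK hU hKU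
  obtain ⟨ψ, h3, h4, -⟩ := exists_contMDiffMap_one_nhds_of_subset_interior (𝓡 n) (n := ⊤)
    hK.isClosed h1
  have h5 : tsupport ψ ⊆ K' := closure_minimal (fun x hx => by
    by_contra h; exact hx (h4 x h)) hK'.isClosed
  exact ⟨ψ, h3, hK'.of_isClosed_subset (isClosed_tsupport _) h5, h5.trans h2⟩

theorem exists_bump_at (x : M) {U : Set M} (hU : U ∈ 𝓝 x) :
    ∃ ψ : Sm (n := n) M, (∀ᶠ y in 𝓝 x, ψ y = 1) ∧ HasCompactSupport ψ ∧ tsupport ψ ⊆ U := by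
  obtain ⟨ψ, h1, h2, h3⟩ := exists_bump (n := n) (isCompact_singleton (x := x)) isOpen_interior
    (singleton_subset_iff.2 (mem_interior_iff_mem_nhds.2 hU))
  rw [nhdsSet_singleton] at h1
  exact ⟨ψ, h1, h2, h3.trans interior_subset⟩

/-- Derivations of the algebra of smooth functions are local operators. -/
theorem derivation_congr (D : VF (Sm (n := n) M)) {f g : Sm (n := n) M} {x : M}
    (h : ∀ᶠ y in 𝓝 x, f y = g y) : D f x = D g x := by
  obtain ⟨ψ, h1, -, h3⟩ := exists_bump_at (n := n) x h
  have h0 : ψ * (f - g) = 0 := by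
    ext y
    change ψ y * (f y - g y) = 0
    by_cases hy : y ∈ tsupport ψ
    · rw [show f y = g y from h3 hy, sub_self, mul_zero]
    · rw [image_eq_zero_of_notMem_tsupport hy, zero_mul]
  have h4 := congrArg (fun k : Sm (n := n) M => k x) (congrArg D h0)
  rw [D.leibniz, map_zero, map_sub] at h4
  change ψ x * (D f x - D g x) + (f x - g x) * D ψ x = 0 at h4
  rw [h1.self_of_nhds, h.self_of_nhds] at h4
  linarith

theorem derivation_const (D : VF (Sm (n := n) M)) (r : ℝ) {f : Sm (n := n) M} {x : M}
    (h : ∀ᶠ y in 𝓝 x, f y = r) : D f x = 0 := by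
  rw [derivation_congr D (g := algebraMap ℝ _ r) h, D.map_algebraMap]; rfl

/-- A derivation is given in coordinates by `D = ∑ᵢ D(uᵢ) ∂ᵢ`, where the functions `uᵢ` agree with
the coordinates near the point. -/
theorem derivation_eq_sum (D : VF (Sm (n := n) M)) (h : Sm (n := n) M) (c : M) {x : M}
    (hx : x ∈ (chartAt (EuclideanSpace ℝ (Fin n)) c).source) (u : Fin n → Sm (n := n) M)
    (hu : ∀ i, ∀ᶠ y in 𝓝 x, u i y = chartAt (EuclideanSpace ℝ (Fin n)) c y i) :
    D h x = ∑ i, D (u i) x *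
      fderiv ℝ (fun z => h ((chartAt (EuclideanSpace ℝ (Fin n)) c).symm z))
        (chartAt (EuclideanSpace ℝ (Fin n)) c x) (EuclideanSpace.single i 1) := by
  set e := chartAt (EuclideanSpace ℝ (Fin n)) c with he
  set H := fun z => h (e.symm z) with hH
  have hHs : ContDiffOn ℝ ∞ H e.target := contDiffOn_comp_chart_symm h c
  have hex : e x ∈ e.target := e.map_source hx
  obtain ⟨r, hr, hrt⟩ := Metric.isOpen_iff.1 e.open_target _ hex
  -- a cutoff makes the coordinate expression `H` of `h` a function on the whole Euclidean space
  let θ : ContDiffBump (e x) := ⟨r / 3, r / 2, by positivity, by linarith⟩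
  have hθ : ContDiff ℝ ∞ fun z => θ z * H z := by
    rw [← contMDiff_iff_contDiff]
    refine contMDiff_of_tsupport fun z hz => ?_
    have hz' : z ∈ tsupport θ := tsupport_mul_subset_left hz
    rw [θ.tsupport_eq] at hz'
    have hzt : z ∈ e.target := hrt (Metric.closedBall_subset_ball (by simp [θ]; linarith) hz')
    exact (θ.contDiffAt.mul ((hHs z hzt).contDiffAt (e.open_target.mem_nhds hzt))).contMDiffAt
  obtain ⟨G, hG1, hG2, hG3⟩ := exists_hadamard hθ (e x)
  have hnear : (fun z => θ z * H z) =ᶠ[𝓝 (e x)] H := by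
    filter_upwards [θ.eventuallyEq_one] with z hz
    rw [hz]; simp
  obtain ⟨ψ, hψ1, -, hψ3⟩ := exists_bump_at (n := n) x (e.open_source.mem_nhds hx)
  let g : Fin n → Sm (n := n) M := fun i => ofCoord c ψ hψ3 (G i) (hG1 i).contDiffOn
  -- Hadamard's lemma on `M`, with all functions globally defined
  have key : ∀ᶠ y in 𝓝 x, h y = (algebraMap ℝ (Sm (n := n) M) (h x) +
      ∑ i, (u i - algebraMap ℝ (Sm (n := n) M) (e x i)) * g i : Sm (n := n) M) y := by
    have h1 := (e.continuousAt hx).eventually hnear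
    have h2 : ∀ᶠ y in 𝓝 x, ∀ i, u i y = e y i := eventually_all.2 hu
    filter_upwards [h1, h2, hψ1, e.open_source.mem_nhds hx] with y h1 h2 h3 h4
    have e1 : h y = H (e y) := by rw [hH]; simp only []; rw [e.left_inv h4]
    rw [e1, ← h1, hG2]
    change _ = h x + (∑ i, (u i - algebraMap ℝ (Sm (n := n) M) (e x i)) * g i : Sm (n := n) M) y
    have e2 : (∑ i, (u i - algebraMap ℝ (Sm (n := n) M) (e x i)) * g i : Sm (n := n) M) y =
        ∑ i, (u i y - e x i) * g i y :=
      map_sum (ContMDiffMap.evalRingHom y) _ _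
    have e3 : θ (e x) * H (e x) = h x := by
      rw [show θ (e x) * H (e x) = H (e x) from hnear.self_of_nhds, hH]
      simp only []
      rw [e.left_inv hx]
    rw [e2, e3]
    congr 1
    refine Finset.sum_congr rfl fun i _ => ?_
    rw [ofCoord_apply, h3, one_mul, h2]
  rw [derivation_congr D key, map_add, D.map_algebraMap, zero_add, map_sum]
  have e3 : (∑ i, D ((u i - algebraMap ℝ (Sm (n := n) M) (e x i)) * g i) : Sm (n := n) M) x =
      ∑ i, D ((u i - algebraMap ℝ (Sm (n := n) M) (e x i)) * g i) x :=
    map_sum (ContMDiffMap.evalRingHom x) _ _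
  rw [e3]
  refine Finset.sum_congr rfl fun i _ => ?_
  rw [D.leibniz, map_sub, D.map_algebraMap, sub_zero]
  change (u i x - e x i) * D (g i) x + g i x * D (u i) x = _
  rw [(hu i).self_of_nhds, ofCoord_apply, hψ1.self_of_nhds, hG3, hnear.fderiv_eq]
  ring

end Manifold

/-! ### Forms in a local frame -/

/-- Alternating maps in more than `n` arguments on a free module of rank `n` vanish. -/
theorem form_eq_zero {A : Type*} [CommRing A] {n p : ℕ} (hp : n < p)
    (β : (Fin n → A) [⋀^Fin p]→ₗ[A] A) : β = 0 := by
  refine (Pi.basisFun A (Fin n)).ext_alternating fun k hk => ?_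
  have := Fintype.card_le_of_injective k hk
  simp only [Fintype.card_fin] at this
  omega

section Algebra

variable {A : Type*} [CommRing A] [Algebra ℝ A]

theorem vf_sum_apply {ι : Type*} (s : Finset ι) (f : ι → VF A) (h : A) :
    (∑ i ∈ s, f i) h = ∑ i ∈ s, f i h := by
  induction s using Finset.cons_induction with
  | empty => simp
  | cons a s ha ih => rw [Finset.sum_cons, Finset.sum_cons, Derivation.add_apply, ih]

variable (A) in
/-- A frame of vector fields with a cutoff: `χ D = ∑ᵢ D(uᵢ) Eᵢ` for all vector fields `D`. -/
structure Frame (n : ℕ) where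
  /-- the cutoff function -/
  cut : A
  /-- the coordinate functions -/
  coord : Fin n → A
  /-- the vector fields of the frame -/
  field : Fin n → VF A
  cut_smul : ∀ D : VF A, cut • D = ∑ i, D (coord i) • field i

namespace Frame

variable {n : ℕ} (F : Frame A n)

/-- The vector field with given components. -/
def toVF : (Fin n → A) →ₗ[A] VF A := Fintype.linearCombination A F.field

/-- The components of a vector field. -/
def comps : VF A →ₗ[A] Fin n → A where
  toFun D i := D (F.coord i)
  map_add' _ _ := rfl
  map_smul' _ _ := rfl

theorem toVF_comps (D : VF A) : F.toVF (F.comps D) = F.cut • D := (F.cut_smul D).symm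

theorem toVF_single (i : Fin n) : F.toVF (Pi.single i 1) = F.field i := by
  simp [toVF, Fintype.linearCombination_apply, Pi.single_apply]

/-- The form `χ^p α` factors through the free module of components. -/
theorem cut_pow_mul {p : ℕ} (α : PForm A p) (Y : Fin p → VF A) :
    F.cut ^ p * α Y = α.compLinearMap F.toVF (fun k => F.comps (Y k)) := by
  rw [AlternatingMap.compLinearMap_apply]
  simp only [toVF_comps]
  have := α.map_smul_univ (fun _ => F.cut) Y
  rw [this, Finset.prod_const, Finset.card_univ, Fintype.card_fin, smul_eq_mul]

theorem cut_pow_mul_eq_zero {p : ℕ} (hp : n < p) (α : PForm A p) (Y : Fin p → VF A) :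
    F.cut ^ p * α Y = 0 := by
  rw [cut_pow_mul, form_eq_zero hp (α.compLinearMap F.toVF)]; rfl

theorem compLinearMap_toVF (α : PForm A n) :
    α.compLinearMap F.toVF = α F.field • (Pi.basisFun A (Fin n)).det := by
  rw [AlternatingMap.eq_smul_basis_det (Pi.basisFun A (Fin n)) (α.compLinearMap F.toVF)]
  congr 1
  rw [AlternatingMap.compLinearMap_apply]
  congr 1
  funext i
  rw [Pi.basisFun_apply, toVF_single]

theorem cut_pow_mul_det (α : PForm A n) (Y : Fin n → VF A) :
    F.cut ^ n * α Y = α F.field * (Pi.basisFun A (Fin n)).det (fun k => F.comps (Y k)) := by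
  rw [cut_pow_mul, compLinearMap_toVF]; rfl

theorem cut_pow_mul_mul_comm (α β : PForm A n) (Y Z : Fin n → VF A) :
    F.cut ^ n * F.cut ^ n * (α Y * β Z) = F.cut ^ n * F.cut ^ n * (β Y * α Z) := by
  have h1 := F.cut_pow_mul_det α Y
  have h2 := F.cut_pow_mul_det β Z
  have h3 := F.cut_pow_mul_det β Y
  have h4 := F.cut_pow_mul_det α Z
  calc _ = (F.cut ^ n * α Y) * (F.cut ^ n * β Z) := by ring
    _ = (F.cut ^ n * β Y) * (F.cut ^ n * α Z) := by rw [h1, h2, h3, h4]; ring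
    _ = _ := by ring

end Frame
end Algebra

section Manifold

open Set Filter Topology

variable {n : ℕ} {M : Type*} [TopologicalSpace M] [ChartedSpace (EuclideanSpace ℝ (Fin n)) M]

/-- On the open set `U`, the frame is the coordinate frame of the chart at `c`. -/
structure IsCoordFrame (F : Frame (Sm (n := n) M) n) (c : M) (U : Set M) : Prop where
  isOpen : IsOpen U
  subset_source : U ⊆ (chartAt (EuclideanSpace ℝ (Fin n)) c).source
  cut_eq : ∀ x ∈ U, F.cut x = 1
  coord_eq : ∀ i, ∀ x ∈ U, F.coord i x = chartAt (EuclideanSpace ℝ (Fin n)) c x i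
  field_eq : ∀ i, ∀ x ∈ U, ∀ h : Sm (n := n) M, F.field i h x =
    fderiv ℝ (fun z => h ((chartAt (EuclideanSpace ℝ (Fin n)) c).symm z))
      (chartAt (EuclideanSpace ℝ (Fin n)) c x) (EuclideanSpace.single i 1)

theorem sum_apply {ι : Type*} (s : Finset ι) (f : ι → Sm (n := n) M) (x : M) :
    (∑ i ∈ s, f i) x = ∑ i ∈ s, f i x := map_sum (ContMDiffMap.evalRingHom x) _ _

namespace IsCoordFrame

variable {F : Frame (Sm (n := n) M) n} {c : M} {U : Set M} (hF : IsCoordFrame F c U)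
include hF

theorem derivation_apply (D : VF (Sm (n := n) M)) (h : Sm (n := n) M) {x : M} (hx : x ∈ U) :
    D h x = ∑ i, D (F.coord i) x * F.field i h x := by
  have := congrArg (fun k : Sm (n := n) M => k x) (congrArg (fun D' => D' h) (F.cut_smul D))
  simp only [Derivation.smul_apply, vf_sum_apply, sum_apply] at this
  change F.cut x * D h x = ∑ i, D (F.coord i) x * F.field i h x at this
  rwa [hF.cut_eq x hx, one_mul] at this

theorem field_coord (i j : Fin n) {x : M} (hx : x ∈ U) :
    F.field i (F.coord j) x = if i = j then 1 else 0 := by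
  rw [hF.field_eq i x hx]
  have hs := hF.subset_source hx
  have : (fun z => F.coord j ((chartAt (EuclideanSpace ℝ (Fin n)) c).symm z)) =ᶠ[
      𝓝 (chartAt (EuclideanSpace ℝ (Fin n)) c x)] fun z => EuclideanSpace.proj (𝕜 := ℝ) j z := by
    have h1 : ∀ᶠ z in 𝓝 (chartAt (EuclideanSpace ℝ (Fin n)) c x),
        (chartAt (EuclideanSpace ℝ (Fin n)) c).symm z ∈ U :=
      ((chartAt (EuclideanSpace ℝ (Fin n)) c).continuousAt_symm
        ((chartAt _ c).map_source hs)).eventually (by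
          rw [(chartAt _ c).left_inv hs]; exact hF.isOpen.mem_nhds hx)
    filter_upwards [h1, (chartAt _ c).open_target.mem_nhds ((chartAt _ c).map_source hs)]
      with z hz hz'
    rw [hF.coord_eq j _ hz, (chartAt _ c).right_inv hz']; rfl
  rw [this.fderiv_eq, ContinuousLinearMap.fderiv]
  simp [eq_comm]

/-- The coefficient of `α` with `Eⱼ` replaced by a vector field `W`. -/
theorem form_update (α : PForm (Sm (n := n) M) n) (j : Fin n) (W : VF (Sm (n := n) M)) {x : M}
    (hx : x ∈ U) : α (Function.update F.field j W) x = W (F.coord j) x * α F.field x := by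
  have h1 : F.cut • α (Function.update F.field j W) = W (F.coord j) • α F.field := by
    rw [← α.map_update_smul, F.cut_smul, AlternatingMap.map_update_sum,
      Finset.sum_eq_single j]
    · rw [α.map_update_smul, Function.update_eq_self]
    · intro i _ hi
      rw [α.map_update_smul, α.map_update_self _ hi.symm, smul_zero]
    · simp
  have h2 := congrArg (fun k : Sm (n := n) M => k x) h1
  change F.cut x * _ = _ * _ at h2
  rwa [hF.cut_eq x hx, one_mul] at h2

end IsCoordFrame

variable [IsManifold (𝓡 n) ∞ M]

theorem differentiableAt_comp_chart_symm (h : Sm (n := n) M) (c : M) {x : M}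
    (hx : x ∈ (chartAt (EuclideanSpace ℝ (Fin n)) c).source) :
    DifferentiableAt ℝ (fun z => h ((chartAt (EuclideanSpace ℝ (Fin n)) c).symm z))
      (chartAt (EuclideanSpace ℝ (Fin n)) c x) :=
  ((contDiffOn_comp_chart_symm h c).differentiableOn (by simp)).differentiableAt
    ((chartAt _ c).open_target.mem_nhds ((chartAt _ c).map_source hx))

/-- The vector field `χ ∂ᵢ` on `M`, where `∂ᵢ` is a coordinate field of the chart at `c` and `χ`
is a cutoff supported in the domain of the chart. -/
def coordVF (c : M) (χ : Sm (n := n) M)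
    (hχ : tsupport χ ⊆ (chartAt (EuclideanSpace ℝ (Fin n)) c).source) (i : Fin n) :
    VF (Sm (n := n) M) :=
  Derivation.mk'
    { toFun := fun h => ofCoord c χ hχ (fun y => fderiv ℝ
        (fun z => h ((chartAt (EuclideanSpace ℝ (Fin n)) c).symm z)) y
          (EuclideanSpace.single i 1))
        (((contDiffOn_comp_chart_symm h c).fderiv_of_isOpen
          (chartAt (EuclideanSpace ℝ (Fin n)) c).open_target (by simp)).clm_apply contDiffOn_const)
      map_add' := fun f g => by
        ext x
        by_cases hx : x ∈ (chartAt (EuclideanSpace ℝ (Fin n)) c).source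
        · have h := fderiv_fun_add (differentiableAt_comp_chart_symm f c hx)
            (differentiableAt_comp_chart_symm g c hx)
          change χ x * fderiv ℝ (fun z => f _ + g _) _ _ = χ x * _ + χ x * _
          rw [h, ← mul_add]; rfl
        · have h : χ x = 0 := image_eq_zero_of_notMem_tsupport fun h => hx (hχ h)
          change χ x * _ = χ x * _ + χ x * _
          rw [h]; ring
      map_smul' := fun r f => by
        ext x
        by_cases hx : x ∈ (chartAt (EuclideanSpace ℝ (Fin n)) c).source
        · have h := fderiv_fun_const_smul (differentiableAt_comp_chart_symm f c hx) r
          change χ x * fderiv ℝ (fun z => r • f _) _ _ = r * (χ x * _)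
          rw [h, mul_left_comm]; rfl
        · have h : χ x = 0 := image_eq_zero_of_notMem_tsupport fun h => hx (hχ h)
          change χ x * _ = r * (χ x * _)
          rw [h]; ring }
    (fun f g => by
      ext x
      by_cases hx : x ∈ (chartAt (EuclideanSpace ℝ (Fin n)) c).source
      · have h := fderiv_fun_mul (differentiableAt_comp_chart_symm f c hx)
          (differentiableAt_comp_chart_symm g c hx)
        change χ x * fderiv ℝ (fun z => f _ * g _) _ _ = f x * (χ x * _) + g x * (χ x * _)
        rw [h, (chartAt _ c).left_inv hx]
        change χ x * (f x * _ + g x * _) = _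
        ring_nf
        rfl
      · have h : χ x = 0 := image_eq_zero_of_notMem_tsupport fun h => hx (hχ h)
        change χ x * _ = f x * (χ x * _) + g x * (χ x * _)
        rw [h]; ring)

theorem coordVF_apply (c : M) (χ : Sm (n := n) M) (hχ) (i : Fin n) (h : Sm (n := n) M) (x : M) :
    coordVF c χ hχ i h x = χ x * fderiv ℝ
      (fun z => h ((chartAt (EuclideanSpace ℝ (Fin n)) c).symm z))
        (chartAt (EuclideanSpace ℝ (Fin n)) c x) (EuclideanSpace.single i 1) := rfl

section

variable [T2Space M] [SigmaCompactSpace M]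

/-- Every compact subset of the domain of a chart is covered by a coordinate frame. -/
theorem exists_isCoordFrame (c : M) {K : Set M} (hK : IsCompact K)
    (hKc : K ⊆ (chartAt (EuclideanSpace ℝ (Fin n)) c).source) :
    ∃ (F : Frame (Sm (n := n) M) n) (U : Set M), IsCoordFrame F c U ∧ K ⊆ U := by
  obtain ⟨ψ, h1, -, h2⟩ := exists_bump (n := n) hK (chartAt _ c).open_source hKc
  obtain ⟨W, hW, hKW, hWψ⟩ := mem_nhdsSet_iff_exists.1 h1
  obtain ⟨χ, h3, -, h4⟩ := exists_bump (n := n) hK (hW.inter (chartAt _ c).open_source)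
    (subset_inter hKW hKc)
  obtain ⟨U, hU, hKU, hUχ⟩ := mem_nhdsSet_iff_exists.1 h3
  have hUWc : U ⊆ W ∩ (chartAt (EuclideanSpace ℝ (Fin n)) c).source := fun x hx =>
    h4 (subset_tsupport _ (by rw [Function.mem_support, show χ x = 1 from hUχ hx]; norm_num))
  let u : Fin n → Sm (n := n) M := fun i => ofCoord c ψ h2 (fun y => y i)
    (EuclideanSpace.proj (𝕜 := ℝ) i).contDiff.contDiffOn
  have hu : ∀ i, ∀ x ∈ W, u i x = chartAt (EuclideanSpace ℝ (Fin n)) c x i := fun i x hx => by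
    change ψ x * _ = _
    rw [show ψ x = 1 from hWψ hx, one_mul]
  have hχ : tsupport χ ⊆ (chartAt (EuclideanSpace ℝ (Fin n)) c).source :=
    h4.trans inter_subset_right
  -- the coordinates `u` are cut off by `ψ`, which is `1` on `W`, and the fields by `χ`, which is
  -- supported in `W`
  refine ⟨⟨χ, u, coordVF c χ hχ, fun D => ?_⟩, U, ⟨hU, fun x hx => (hUWc hx).2, fun x hx => hUχ hx,
    fun i x hx => hu i x (hUWc hx).1, fun i x hx h => ?_⟩, hKU⟩
  · ext h x
    rw [Derivation.smul_apply, vf_sum_apply, sum_apply]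
    change χ x * D h x = ∑ i, D (u i) x * (χ x * _)
    by_cases hx : x ∈ tsupport χ
    · rw [derivation_eq_sum D h c (h4 hx).2 u fun i => by
        filter_upwards [hW.mem_nhds (h4 hx).1] with y hy using hu i y hy, Finset.mul_sum]
      refine Finset.sum_congr rfl fun i _ => ?_
      rw [mul_left_comm]
    · rw [image_eq_zero_of_notMem_tsupport hx]
      simp
  · rw [coordVF_apply, show χ x = 1 from hUχ hx, one_mul]

theorem exists_isCoordFrame_at (c : M) {x : M}
    (hx : x ∈ (chartAt (EuclideanSpace ℝ (Fin n)) c).source) :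
    ∃ (F : Frame (Sm (n := n) M) n) (U : Set M), IsCoordFrame F c U ∧ x ∈ U := by
  obtain ⟨F, U, h, hU⟩ := exists_isCoordFrame c isCompact_singleton (singleton_subset_iff.2 hx)
  exact ⟨F, U, h, singleton_subset_iff.1 hU⟩

theorem exists_frame (x : M) : ∃ F : Frame (Sm (n := n) M) n, F.cut x = 1 := by
  obtain ⟨F, U, h, hU⟩ := exists_isCoordFrame_at (n := n) x (mem_chart_source _ x)
  exact ⟨F, h.cut_eq x hU⟩

end

section

variable [T2Space M] [SigmaCompactSpace M]

theorem form_eq_zero_of_lt {p : ℕ} (hp : n < p) (α : PForm (Sm (n := n) M) p) : α = 0 := by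
  ext Y x
  obtain ⟨F, hF⟩ := exists_frame (n := n) x
  have := congrArg (fun k : Sm (n := n) M => k x) (F.cut_pow_mul_eq_zero hp α Y)
  change F.cut x ^ p * α Y x = 0 at this
  rwa [hF, one_pow, one_mul] at this

/-- Any two forms of top degree are proportional. -/
theorem form_mul_comm (α β : PForm (Sm (n := n) M) n) (Y Z : Fin n → VF (Sm (n := n) M)) :
    α Y * β Z = β Y * α Z := by
  ext x
  obtain ⟨F, hF⟩ := exists_frame (n := n) x
  have := congrArg (fun k : Sm (n := n) M => k x) (F.cut_pow_mul_mul_comm α β Y Z)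
  change F.cut x ^ n * F.cut x ^ n * (α Y x * β Z x) = F.cut x ^ n * F.cut x ^ n * (β Y x * α Z x)
    at this
  rw [hF] at this
  simpa using this

/-- Every form of top degree is a multiple of a volume form. -/
theorem exists_eq_smul {v : PForm (Sm (n := n) M) n} (hv : IsVolumeForm v)
    (α : PForm (Sm (n := n) M) n) : ∃ g : Sm (n := n) M, α = g • v := by
  choose Y hY using hv
  have hrel : ∀ (Y Z : Fin n → VF (Sm (n := n) M)) (x : M), α Y x * v Z x = v Y x * α Z x :=
    fun Y Z x => congrArg (fun k : Sm (n := n) M => k x) (form_mul_comm α v Y Z)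
  -- near `x₀` the vector fields `Y x₀` may be used at all points
  refine ⟨⟨fun x => α (Y x) x / v (Y x) x, fun x₀ => ?_⟩, ?_⟩
  · have h1 : ContMDiffAt (𝓡 n) 𝓘(ℝ, ℝ) ∞ (fun x => α (Y x₀) x / v (Y x₀) x) x₀ :=
      (α (Y x₀)).contMDiff.contMDiffAt.div₀ (v (Y x₀)).contMDiff.contMDiffAt (hY x₀)
    refine h1.congr_of_eventuallyEq ?_
    filter_upwards [(v (Y x₀)).contMDiff.continuous.continuousAt.eventually_ne (hY x₀)] with x hx
    rw [div_eq_div_iff (hY x) hx, hrel, mul_comm]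
  · ext Z x
    change α Z x = α (Y x) x / v (Y x) x * v Z x
    rw [div_mul_eq_mul_div, hrel, mul_div_cancel_left₀ _ (hY x)]

theorem exists_lieForm_eq_smul {v : PForm (Sm (n := n) M) n} (hv : IsVolumeForm v)
    (D : VF (Sm (n := n) M)) : ∃ g : Sm (n := n) M, lieForm D v = g • v :=
  exists_eq_smul hv _

/-- The divergence in coordinates: `div(D) V = ∑ⱼ ∂ⱼ(V Dⱼ)`, for the coefficient `V` of `v`. -/
theorem IsCoordFrame.div_apply {F : Frame (Sm (n := n) M) n} {c : M} {U : Set M}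
    (hF : IsCoordFrame F c U) {v : PForm (Sm (n := n) M) n} {D : VF (Sm (n := n) M)}
    {g : Sm (n := n) M} (hg : lieForm D v = g • v) {x : M} (hx : x ∈ U) :
    g x * v F.field x =
      D (v F.field) x + ∑ j, F.field j (D (F.coord j)) x * v F.field x := by
  have h1 := congrArg (fun k : Sm (n := n) M => k x) (congrArg (fun β => β F.field) hg)
  simp only [lieForm_apply] at h1
  change D (v F.field) x - (∑ j, v (Function.update F.field j ⁅D, F.field j⁆) : Sm (n := n) M) x =
    g x * v F.field x at h1
  rw [← h1, sum_apply, sub_eq_add_neg, ← Finset.sum_neg_distrib]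
  congr 1
  refine Finset.sum_congr rfl fun j _ => ?_
  rw [hF.form_update v j _ hx, Derivation.commutator_apply]
  change -((D (F.field j (F.coord j)) x - F.field j (D (F.coord j)) x) * _) = _
  rw [derivation_const D 1, zero_sub, neg_mul, neg_neg]
  filter_upwards [hF.isOpen.mem_nhds hx] with y hy
  rw [hF.field_coord j j hy, if_pos rfl]

end

end Manifold

/-! ### The coefficient of a volume form -/

section Manifold

open Set Filter Topology MeasureTheory

variable {n : ℕ} {M : Type*} [TopologicalSpace M] [ChartedSpace (EuclideanSpace ℝ (Fin n)) M]

theorem Frame.form_apply (F : Frame (Sm (n := n) M) n) (v : PForm (Sm (n := n) M) n)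
    (Y : Fin n → VF (Sm (n := n) M)) {x : M} (hx : F.cut x = 1) :
    v Y x = v F.field x * Matrix.det fun k i => Y k (F.coord i) x := by
  have h := congrArg (fun k : Sm (n := n) M => k x) (F.cut_pow_mul_det v Y)
  change F.cut x ^ n * v Y x = v F.field x *
    ContMDiffMap.evalRingHom x ((Pi.basisFun (Sm (n := n) M) (Fin n)).det fun k => F.comps (Y k))
    at h
  rw [Pi.basisFun_det_apply, RingHom.map_det, hx, one_pow, one_mul] at h
  exact h

/-- The coefficient of `v` is its value on any coordinate frame: the choice of vector fields in the
definition of `coeff` is immaterial. -/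
theorem IsCoordFrame.coeff_eq {F : Frame (Sm (n := n) M) n} {c : M} {U : Set M}
    (hF : IsCoordFrame F c U) (v : PForm (Sm (n := n) M) n) {x : M} (hx : x ∈ U) :
    coeff v c (chartAt (EuclideanSpace ℝ (Fin n)) c x) = v F.field x := by
  have hxs := hF.subset_source hx
  have hex : ∃ Y : Fin n → VF (Sm (n := n) M),
      IsCoordFrameAt c (chartAt (EuclideanSpace ℝ (Fin n)) c x) Y := by
    refine ⟨F.field, fun i h => ?_⟩
    rw [(chartAt _ c).left_inv hxs, hF.field_eq i x hx]
  have hY := hex.choose_spec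
  unfold coeff
  rw [dif_pos hex, (chartAt _ c).left_inv hxs, F.form_apply v _ (hF.cut_eq x hx)]
  have : (Matrix.of fun k i => hex.choose k (F.coord i) x) = (1 : Matrix (Fin n) (Fin n) ℝ) := by
    ext k i
    have h1 := hY k (F.coord i)
    rw [(chartAt _ c).left_inv hxs, ← hF.field_eq k x hx, hF.field_coord k i hx] at h1
    rw [Matrix.of_apply, h1, Matrix.one_apply]
  change _ * Matrix.det (Matrix.of fun k i => hex.choose k (F.coord i) x) = _
  rw [this, Matrix.det_one, mul_one]

theorem IsCoordFrame.form_field_ne_zero {F : Frame (Sm (n := n) M) n} {c : M} {U : Set M}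
    (hF : IsCoordFrame F c U) {v : PForm (Sm (n := n) M) n} (hv : IsVolumeForm v) {x : M}
    (hx : x ∈ U) : v F.field x ≠ 0 := by
  obtain ⟨Y, hY⟩ := hv x
  rw [F.form_apply v Y (hF.cut_eq x hx)] at hY
  exact left_ne_zero_of_mul hY

theorem IsCoordFrame.coeff_eventuallyEq {F : Frame (Sm (n := n) M) n} {c : M} {U : Set M}
    (hF : IsCoordFrame F c U) (v : PForm (Sm (n := n) M) n) {y : EuclideanSpace ℝ (Fin n)}
    (hy : y ∈ (chartAt (EuclideanSpace ℝ (Fin n)) c).target)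
    (hyU : (chartAt (EuclideanSpace ℝ (Fin n)) c).symm y ∈ U) :
    ∀ᶠ z in 𝓝 y, z ∈ (chartAt (EuclideanSpace ℝ (Fin n)) c).target ∧
      (chartAt (EuclideanSpace ℝ (Fin n)) c).symm z ∈ U ∧
      coeff v c z = v F.field ((chartAt (EuclideanSpace ℝ (Fin n)) c).symm z) := by
  filter_upwards [(chartAt _ c).open_target.mem_nhds hy,
    ((chartAt _ c).continuousAt_symm hy).eventually (hF.isOpen.mem_nhds hyU)] with z hz hzU
  refine ⟨hz, hzU, ?_⟩
  rw [← hF.coeff_eq v hzU, (chartAt _ c).right_inv hz]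

section

variable [IsManifold (𝓡 n) ∞ M]

theorem differentiableAt_transition (c c' : M) {x : M}
    (hx : x ∈ (chartAt (EuclideanSpace ℝ (Fin n)) c).source)
    (hx' : x ∈ (chartAt (EuclideanSpace ℝ (Fin n)) c').source) :
    DifferentiableAt ℝ (fun z => chartAt (EuclideanSpace ℝ (Fin n)) c'
      ((chartAt (EuclideanSpace ℝ (Fin n)) c).symm z))
      (chartAt (EuclideanSpace ℝ (Fin n)) c x) := by
  have h1 := contMDiffAt_symm_of_mem_maximalAtlas (I := 𝓡 n) (n := ∞)
    (IsManifold.chart_mem_maximalAtlas c) ((chartAt (EuclideanSpace ℝ (Fin n)) c).map_source hx)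
  have h2 := contMDiffAt_of_mem_maximalAtlas (I := 𝓡 n) (n := ∞)
    (IsManifold.chart_mem_maximalAtlas c') hx'
  rw [← (chartAt _ c).left_inv hx] at h2
  exact ((h2.comp _ h1).contDiffAt).differentiableAt (by simp)

variable [T2Space M] [SigmaCompactSpace M]

theorem continuousOn_coeff (v : PForm (Sm (n := n) M) n) (c : M) :
    ContinuousOn (coeff v c) (chartAt (EuclideanSpace ℝ (Fin n)) c).target := by
  intro y hy
  obtain ⟨F, U, hF, hU⟩ := exists_isCoordFrame_at (n := n) c ((chartAt _ c).map_target hy)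
  refine ContinuousAt.continuousWithinAt ?_
  have h1 : ContinuousAt (fun z => v F.field ((chartAt (EuclideanSpace ℝ (Fin n)) c).symm z)) y :=
    (v F.field).contMDiff.continuous.continuousAt.comp ((chartAt _ c).continuousAt_symm hy)
  exact h1.congr ((hF.coeff_eventuallyEq v hy hU).mono fun z hz => hz.2.2.symm)

theorem coeff_ne_zero {v : PForm (Sm (n := n) M) n} (hv : IsVolumeForm v) (c : M) {x : M}
    (hx : x ∈ (chartAt (EuclideanSpace ℝ (Fin n)) c).source) :
    coeff v c (chartAt (EuclideanSpace ℝ (Fin n)) c x) ≠ 0 := by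
  obtain ⟨F, U, hF, hU⟩ := exists_isCoordFrame_at (n := n) c hx
  rw [hF.coeff_eq v hU]
  exact hF.form_field_ne_zero hv hU

/-- The transformation law of the coefficient under a change of coordinates. -/
theorem coeff_transition (v : PForm (Sm (n := n) M) n) (c c' : M) {x : M}
    (hx : x ∈ (chartAt (EuclideanSpace ℝ (Fin n)) c).source)
    (hx' : x ∈ (chartAt (EuclideanSpace ℝ (Fin n)) c').source) :
    coeff v c (chartAt (EuclideanSpace ℝ (Fin n)) c x) =
      (fderiv ℝ (fun z => chartAt (EuclideanSpace ℝ (Fin n)) c'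
        ((chartAt (EuclideanSpace ℝ (Fin n)) c).symm z))
        (chartAt (EuclideanSpace ℝ (Fin n)) c x)).det *
      coeff v c' (chartAt (EuclideanSpace ℝ (Fin n)) c' x) := by
  obtain ⟨F, U, hF, hU⟩ := exists_isCoordFrame_at (n := n) c hx
  obtain ⟨F', U', hF', hU'⟩ := exists_isCoordFrame_at (n := n) c' hx'
  rw [hF.coeff_eq v hU, hF'.coeff_eq v hU', F'.form_apply v _ (hF'.cut_eq x hU'), mul_comm]
  congr 1
  have hd := differentiableAt_transition c c' hx hx'
  set L := fderiv ℝ (fun z => chartAt (EuclideanSpace ℝ (Fin n)) c'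
        ((chartAt (EuclideanSpace ℝ (Fin n)) c).symm z))
        (chartAt (EuclideanSpace ℝ (Fin n)) c x) with hL
  let b := (EuclideanSpace.basisFun (Fin n) ℝ).toBasis
  rw [ContinuousLinearMap.det, ← LinearMap.det_toMatrix b, ← Matrix.det_transpose]
  congr 1
  ext k i
  rw [Matrix.transpose_apply, hF.field_eq k x hU]
  have hnear : (fun z => F'.coord i ((chartAt (EuclideanSpace ℝ (Fin n)) c).symm z)) =ᶠ[
      𝓝 (chartAt (EuclideanSpace ℝ (Fin n)) c x)] fun z => EuclideanSpace.proj (𝕜 := ℝ) i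
        (chartAt (EuclideanSpace ℝ (Fin n)) c' ((chartAt (EuclideanSpace ℝ (Fin n)) c).symm z)) := by
    filter_upwards [((chartAt (EuclideanSpace ℝ (Fin n)) c).continuousAt_symm
        ((chartAt _ c).map_source hx)).eventually (by
          rw [(chartAt _ c).left_inv hx]; exact hF'.isOpen.mem_nhds hU')] with z hz
    rw [hF'.coord_eq i _ hz]; rfl
  have hcomp := ((EuclideanSpace.proj (𝕜 := ℝ) i).hasFDerivAt.comp _ hd.hasFDerivAt).fderiv
  rw [hnear.fderiv_eq]
  refine (congrArg (fun T => T (EuclideanSpace.single k 1)) hcomp).trans ?_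
  rw [LinearMap.toMatrix_apply]
  simp [b, L]

end

/-! ### Integration in a chart -/

/-- The integral of `f` against the density `|v|` over the domain of the chart at `c`. -/
def chartInt (v : PForm (Sm (n := n) M) n) (c : M) (f : M → ℝ) : ℝ :=
  ∫ y in (chartAt (EuclideanSpace ℝ (Fin n)) c).target,
    f ((chartAt (EuclideanSpace ℝ (Fin n)) c).symm y) * |coeff v c y|

theorem chartInt_smul (v : PForm (Sm (n := n) M) n) (c : M) (r : ℝ) (f : M → ℝ) :
    chartInt v c (fun x => r * f x) = r * chartInt v c f := by
  unfold chartInt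
  rw [← MeasureTheory.integral_const_mul]
  simp only [mul_assoc]

/-- The product of a function on the domain of a chart, in coordinates, with a weight `w`, extended
by zero. -/
def chartExt (c : M) (f : M → ℝ) (w : EuclideanSpace ℝ (Fin n) → ℝ) :
    EuclideanSpace ℝ (Fin n) → ℝ :=
  (chartAt (EuclideanSpace ℝ (Fin n)) c).target.indicator fun y =>
    f ((chartAt (EuclideanSpace ℝ (Fin n)) c).symm y) * w y

theorem chartExt_apply {c : M} (f : M → ℝ) (w : EuclideanSpace ℝ (Fin n) → ℝ)
    {y : EuclideanSpace ℝ (Fin n)} (hy : y ∈ (chartAt (EuclideanSpace ℝ (Fin n)) c).target) :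
    chartExt c f w y = f ((chartAt (EuclideanSpace ℝ (Fin n)) c).symm y) * w y :=
  indicator_of_mem hy _

theorem chartInt_eq_integral (v : PForm (Sm (n := n) M) n) (c : M) (f : M → ℝ) :
    chartInt v c f = ∫ y, chartExt c f (fun y => |coeff v c y|) y :=
  (integral_indicator (chartAt _ c).open_target.measurableSet).symm

theorem isCompact_chart_image {c : M} {f : M → ℝ} (hf : HasCompactSupport f)
    (hs : tsupport f ⊆ (chartAt (EuclideanSpace ℝ (Fin n)) c).source) :
    IsCompact (chartAt (EuclideanSpace ℝ (Fin n)) c '' tsupport f) :=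
  IsCompact.image_of_continuousOn hf ((chartAt _ c).continuousOn.mono hs)

theorem chartExt_eq_zero {c : M} (f : M → ℝ) (w : EuclideanSpace ℝ (Fin n) → ℝ)
    {y : EuclideanSpace ℝ (Fin n)}
    (hy : y ∉ chartAt (EuclideanSpace ℝ (Fin n)) c '' tsupport f) : chartExt c f w y = 0 := by
  by_cases hyt : y ∈ (chartAt (EuclideanSpace ℝ (Fin n)) c).target
  · rw [chartExt_apply f w hyt, image_eq_zero_of_notMem_tsupport (f := f), zero_mul]
    exact fun h => hy ⟨_, h, (chartAt _ c).right_inv hyt⟩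
  · exact indicator_of_notMem hyt _

theorem chartExt_eventuallyEq_zero {c : M} {f : M → ℝ} (hf : HasCompactSupport f)
    (hs : tsupport f ⊆ (chartAt (EuclideanSpace ℝ (Fin n)) c).source)
    (w : EuclideanSpace ℝ (Fin n) → ℝ) {y : EuclideanSpace ℝ (Fin n)}
    (hy : y ∉ chartAt (EuclideanSpace ℝ (Fin n)) c '' tsupport f) :
    chartExt c f w =ᶠ[𝓝 y] fun _ => 0 := by
  filter_upwards [(isCompact_chart_image hf hs).isClosed.isOpen_compl.mem_nhds hy] with z hz
  exact chartExt_eq_zero f w hz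

theorem hasCompactSupport_chartExt {c : M} {f : M → ℝ} (hf : HasCompactSupport f)
    (hs : tsupport f ⊆ (chartAt (EuclideanSpace ℝ (Fin n)) c).source)
    (w : EuclideanSpace ℝ (Fin n) → ℝ) : HasCompactSupport (chartExt c f w) :=
  HasCompactSupport.intro (isCompact_chart_image hf hs) fun _ hy => chartExt_eq_zero f w hy

theorem continuous_chartExt {c : M} {f : M → ℝ} (hfc : Continuous f) (hf : HasCompactSupport f)
    (hs : tsupport f ⊆ (chartAt (EuclideanSpace ℝ (Fin n)) c).source)
    {w : EuclideanSpace ℝ (Fin n) → ℝ}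
    (hw : ContinuousOn w (chartAt (EuclideanSpace ℝ (Fin n)) c).target) :
    Continuous (chartExt c f w) := by
  refine continuous_iff_continuousAt.2 fun y => ?_
  by_cases hyt : y ∈ (chartAt (EuclideanSpace ℝ (Fin n)) c).target
  · have ht := (chartAt (EuclideanSpace ℝ (Fin n)) c).open_target.mem_nhds hyt
    refine ContinuousAt.congr (f := fun y =>
      f ((chartAt (EuclideanSpace ℝ (Fin n)) c).symm y) * w y) ?_ ?_
    · exact (hfc.continuousAt.comp ((chartAt _ c).continuousAt_symm hyt)).mul (hw.continuousAt ht)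
    · filter_upwards [ht] with z hz using (chartExt_apply f w hz).symm
  · refine ContinuousAt.congr continuousAt_const
      (chartExt_eventuallyEq_zero hf hs w fun h => hyt ?_).symm
    obtain ⟨x, hx, rfl⟩ := h
    exact (chartAt _ c).map_source (hs hx)

section

variable [IsManifold (𝓡 n) ∞ M] [T2Space M] [SigmaCompactSpace M]

theorem integrable_chartExt (v : PForm (Sm (n := n) M) n) {c : M} {f : M → ℝ}
    (hfc : Continuous f) (hf : HasCompactSupport f)
    (hs : tsupport f ⊆ (chartAt (EuclideanSpace ℝ (Fin n)) c).source) :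
    Integrable (chartExt c f fun y => |coeff v c y|) :=
  (continuous_chartExt hfc hf hs (continuousOn_coeff v c).abs).integrable_of_hasCompactSupport
    (hasCompactSupport_chartExt hf hs _)

/-- The integral over a chart does not depend on the chart. -/
theorem chartInt_eq_chartInt (v : PForm (Sm (n := n) M) n) (c c' : M) {f : M → ℝ}
    (hf : ∀ x, f x ≠ 0 → x ∈ (chartAt (EuclideanSpace ℝ (Fin n)) c).source)
    (hf' : ∀ x, f x ≠ 0 → x ∈ (chartAt (EuclideanSpace ℝ (Fin n)) c').source) :
    chartInt v c f = chartInt v c' f := by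
  set e := chartAt (EuclideanSpace ℝ (Fin n)) c with he
  set e' := chartAt (EuclideanSpace ℝ (Fin n)) c' with he'
  let τ : OpenPartialHomeomorph (EuclideanSpace ℝ (Fin n)) (EuclideanSpace ℝ (Fin n)) :=
    e.symm.trans e'
  have hsub : τ.source ⊆ e.target := fun y hy => hy.1
  have hsub' : τ.target ⊆ e'.target := fun y hy => hy.1
  have h1 : chartInt v c f = ∫ y in τ.source, f (e.symm y) * |coeff v c y| := by
    refine setIntegral_eq_of_subset_of_forall_sdiff_eq_zero e.open_target.measurableSet hsub
      fun y hy => ?_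
    rw [show f (e.symm y) = 0 from by_contra fun h => hy.2 ⟨hy.1, hf' _ h⟩, zero_mul]
  have h2 : chartInt v c' f = ∫ y in τ.target, f (e'.symm y) * |coeff v c' y| := by
    refine setIntegral_eq_of_subset_of_forall_sdiff_eq_zero e'.open_target.measurableSet hsub'
      fun y hy => ?_
    rw [show f (e'.symm y) = 0 from by_contra fun h => hy.2 ⟨hy.1, hf _ h⟩, zero_mul]
  have hx : ∀ y ∈ τ.source, e (e.symm y) = y ∧ e.symm y ∈ e.source ∧ e.symm y ∈ e'.source :=
    fun y hy => ⟨e.right_inv hy.1, e.map_target hy.1, hy.2⟩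
  rw [h1, h2, integral_target_eq_integral_abs_det_fderiv_smul volume (f := τ)
    (f' := fun y => fderiv ℝ τ y) fun y hy => ?_]
  · refine setIntegral_congr_fun τ.open_source.measurableSet fun y hy => ?_
    obtain ⟨h3, h4, h5⟩ := hx y hy
    have h6 := coeff_transition v c c' h4 h5
    rw [← he, h3] at h6
    change f (e.symm y) * |coeff v c y| =
      |(fderiv ℝ τ y).det| * (f (e'.symm (e' (e.symm y))) * |coeff v c' (e' (e.symm y))|)
    rw [e'.left_inv h5, h6, abs_mul]
    change _ * (|(fderiv ℝ τ y).det| * _) = _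
    ring
  · obtain ⟨h3, h4, h5⟩ := hx y hy
    have := differentiableAt_transition c c' h4 h5
    rw [← he, h3] at this
    exact this.hasFDerivAt

end

end Manifold

/-! ### Integration over the manifold, and Stokes' theorem -/

section Manifold

open Set Filter Topology MeasureTheory

theorem integral_fderiv_eq_zero {n : ℕ} {Φ : EuclideanSpace ℝ (Fin n) → ℝ} (h : ContDiff ℝ 1 Φ)
    (hc : HasCompactSupport Φ) (z : EuclideanSpace ℝ (Fin n)) : ∫ y, fderiv ℝ Φ y z = 0 := by
  have h1 : Integrable fun y => fderiv ℝ Φ y z :=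
    (((h.continuous_fderiv one_ne_zero).clm_apply continuous_const)
      ).integrable_of_hasCompactSupport (hc.fderiv_apply ℝ z)
  have := integral_mul_fderiv_eq_neg_fderiv_mul_of_integrable (μ := volume)
    (f := fun _ : EuclideanSpace ℝ (Fin n) => (1 : ℝ)) (g := Φ) (v := z) (by simp) (by simpa)
    (by simpa using h.continuous.integrable_of_hasCompactSupport hc)
    (fun _ _ => differentiableAt_const _) (fun _ _ => (h.differentiable one_ne_zero) _)
  simpa using this

variable {n : ℕ} {M : Type*} [TopologicalSpace M] [ChartedSpace (EuclideanSpace ℝ (Fin n)) M]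
  [IsManifold (𝓡 n) ∞ M] [T2Space M] [SigmaCompactSpace M]

/-- The partition of unity is subordinate to the covering by the preferred charts. -/
theorem tsupport_chartPartition (c : M) :
    tsupport (chartPartition n M c) ⊆ (chartAt (EuclideanSpace ℝ (Fin n)) c).source :=
  (SmoothPartitionOfUnity.exists_isSubordinate_chartAt_source (𝓡 n) M).choose_spec c

theorem tsupport_chartPartition_mul {g : M → ℝ} (c : M) :
    tsupport (fun x => chartPartition n M c x * g x) ⊆
      (chartAt (EuclideanSpace ℝ (Fin n)) c).source :=
  tsupport_mul_subset_left.trans (tsupport_chartPartition c)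

theorem hasCompactSupport_chartPartition_mul {g : M → ℝ} (hg : HasCompactSupport g) (c : M) :
    HasCompactSupport (fun x => chartPartition n M c x * g x) := hg.mul_left

theorem continuous_chartPartition_mul {g : M → ℝ} (hg : Continuous g) (c : M) :
    Continuous (fun x => chartPartition n M c x * g x) :=
  (chartPartition n M c).contMDiff.continuous.mul hg

/-- Only finitely many functions of the partition of unity do not vanish on a compact set. -/
theorem exists_finset_chartPartition {K : Set M} (hK : IsCompact K) :
    ∃ s : Finset M, ∀ c ∉ s, ∀ x ∈ K, chartPartition n M c x = 0 := by
  have := (chartPartition n M).locallyFinite.finite_nonempty_inter_compact hK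
  refine ⟨this.toFinset, fun c hc x hx => by_contra fun h => hc ?_⟩
  rw [Finite.mem_toFinset]
  exact ⟨x, h, hx⟩

theorem sum_chartPartition {K : Set M} {s : Finset M}
    (hs : ∀ c ∉ s, ∀ x ∈ K, chartPartition n M c x = 0) {x : M} (hx : x ∈ K) :
    ∑ c ∈ s, chartPartition n M c x = 1 := by
  rw [← (chartPartition n M).sum_eq_one (mem_univ x)]
  refine (finsum_eq_sum_of_support_subset _ fun c hc => ?_).symm
  by_contra h
  exact hc (hs c h x hx)

/-- The integral of a function that vanishes outside `K`, as a finite sum of integrals over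
charts. -/
theorem integral_eq_sum (o : M → ℝ) (v : PForm (Sm (n := n) M) n) (g : Sm (n := n) M)
    {K : Set M} (hg : ∀ x ∉ K, g x = 0) {s : Finset M}
    (hs : ∀ c ∉ s, ∀ x ∈ K, chartPartition n M c x = 0) :
    integral o v g = ∑ c ∈ s, chartInt v c (fun x => chartPartition n M c x * (g x * o x)) := by
  have h1 : integral o v g =
      ∑ᶠ c : M, chartInt v c (fun x => chartPartition n M c x * (g x * o x)) := by
    unfold integral chartInt
    simp only [mul_assoc]
  rw [h1]
  refine finsum_eq_sum_of_support_subset _ fun c hc => ?_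
  by_contra h
  refine hc ?_
  have : (fun x => chartPartition n M c x * (g x * o x)) = fun _ => 0 := by
    funext x
    by_cases hx : x ∈ K
    · rw [hs c h x hx, zero_mul]
    · rw [hg x hx, zero_mul, mul_zero]
  change chartInt v c (fun x => chartPartition n M c x * (g x * o x)) = 0
  rw [this]
  simp [chartInt]

variable {o : M → ℝ}

theorem chartInt_sum (v : PForm (Sm (n := n) M) n) (c : M) {ι : Type*} (s : Finset ι)
    {f : ι → M → ℝ} (hf : ∀ i ∈ s, Continuous (f i)) (hfc : ∀ i ∈ s, HasCompactSupport (f i))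
    (hfs : ∀ i ∈ s, tsupport (f i) ⊆ (chartAt (EuclideanSpace ℝ (Fin n)) c).source) :
    chartInt v c (fun x => ∑ i ∈ s, f i x) = ∑ i ∈ s, chartInt v c (f i) := by
  simp only [chartInt_eq_integral]
  rw [← integral_finsetSum s fun i hi => integrable_chartExt v (hf i hi) (hfc i hi) (hfs i hi)]
  congr 1
  funext y
  by_cases hy : y ∈ (chartAt (EuclideanSpace ℝ (Fin n)) c).target
  · simp only [chartExt_apply _ _ hy, Finset.sum_mul]
  · simp [chartExt, indicator_of_notMem hy]

theorem chartInt_add (v : PForm (Sm (n := n) M) n) (c : M) {f g : M → ℝ}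
    (hf : Continuous f) (hfc : HasCompactSupport f)
    (hfs : tsupport f ⊆ (chartAt (EuclideanSpace ℝ (Fin n)) c).source)
    (hg : Continuous g) (hgc : HasCompactSupport g)
    (hgs : tsupport g ⊆ (chartAt (EuclideanSpace ℝ (Fin n)) c).source) :
    chartInt v c (fun x => f x + g x) = chartInt v c f + chartInt v c g := by
  have := chartInt_sum v c (Finset.univ : Finset (Fin 2)) (f := ![f, g])
    (by simp [Fin.forall_fin_two, hf, hg]) (by simp [Fin.forall_fin_two, hfc, hgc])
    (by simp [Fin.forall_fin_two, hfs, hgs])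
  simpa [Fin.sum_univ_two] using this

/-- For a function supported in the domain of a chart, the integral is computed in this chart. -/
theorem integral_eq_chartInt (ho : IsLocallyConstant o) (v : PForm (Sm (n := n) M) n)
    {g : Sm (n := n) M} (hg : HasCompactSupport g) {c : M}
    (hgs : tsupport g ⊆ (chartAt (EuclideanSpace ℝ (Fin n)) c).source) :
    integral o v g = chartInt v c (fun x => g x * o x) := by
  obtain ⟨s, hs⟩ := exists_finset_chartPartition (n := n) hg
  rw [integral_eq_sum o v g (fun x hx => image_eq_zero_of_notMem_tsupport hx) hs]
  have hgo : Continuous fun x => g x * o x := g.contMDiff.continuous.mul ho.continuous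
  have hgoc : HasCompactSupport fun x => g x * o x := hg.mul_right
  have h1 : ∀ c' ∈ s, chartInt v c' (fun x => chartPartition n M c' x * (g x * o x)) =
      chartInt v c (fun x => chartPartition n M c' x * (g x * o x)) := fun c' _ =>
    chartInt_eq_chartInt v c' c
      (fun x hx => tsupport_chartPartition c' (subset_tsupport _ (left_ne_zero_of_mul hx)))
      (fun x hx => hgs (subset_tsupport _ (left_ne_zero_of_mul (right_ne_zero_of_mul hx))))
  rw [Finset.sum_congr rfl h1, ← chartInt_sum v c s
    (fun c' _ => continuous_chartPartition_mul hgo c')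
    (fun c' _ => hasCompactSupport_chartPartition_mul hgoc c')
    (fun c' _ => (tsupport_mul_subset_right.trans tsupport_mul_subset_left).trans hgs)]
  congr 1
  funext x
  rw [← Finset.sum_mul]
  by_cases hx : x ∈ tsupport g
  · rw [sum_chartPartition hs hx, one_mul]
  · rw [image_eq_zero_of_notMem_tsupport hx]; simp

variable (n M) in
/-- The ideal of functions with compact support. -/
def compactIdeal : Ideal (Sm (n := n) M) where
  carrier := {g | HasCompactSupport g}
  add_mem' := fun ha hb => HasCompactSupport.add ha hb
  zero_mem' := HasCompactSupport.zero
  smul_mem' := fun _ _ hb => HasCompactSupport.mul_left hb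

theorem integral_add (ho : IsLocallyConstant o) (v : PForm (Sm (n := n) M) n)
    {g h : Sm (n := n) M} (hg : HasCompactSupport g) (hh : HasCompactSupport h) :
    integral o v (g + h) = integral o v g + integral o v h := by
  obtain ⟨s, hs⟩ := exists_finset_chartPartition (n := n) (hg.isCompact.union hh.isCompact)
  have hz : ∀ x ∉ tsupport g ∪ tsupport h, g x = 0 ∧ h x = 0 := fun x hx =>
    ⟨image_eq_zero_of_notMem_tsupport fun H => hx (Or.inl H),
      image_eq_zero_of_notMem_tsupport fun H => hx (Or.inr H)⟩
  rw [integral_eq_sum o v g (fun x hx => (hz x hx).1) hs,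
    integral_eq_sum o v h (fun x hx => (hz x hx).2) hs,
    integral_eq_sum o v (g + h) (fun x hx => by
      change g x + h x = 0; rw [(hz x hx).1, (hz x hx).2, add_zero]) hs, ← Finset.sum_add_distrib]
  refine Finset.sum_congr rfl fun c _ => ?_
  refine Eq.trans ?_ (chartInt_add v c
    (continuous_chartPartition_mul (g.contMDiff.continuous.mul ho.continuous) c)
    (hasCompactSupport_chartPartition_mul hg.mul_right c) (tsupport_chartPartition_mul c)
    (continuous_chartPartition_mul (h.contMDiff.continuous.mul ho.continuous) c)
    (hasCompactSupport_chartPartition_mul hh.mul_right c) (tsupport_chartPartition_mul c))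
  congr 1
  funext x
  change _ * ((g x + h x) * _) = _
  ring

theorem integral_smul (o : M → ℝ) (v : PForm (Sm (n := n) M) n) (r : ℝ)
    {g : Sm (n := n) M} (hg : HasCompactSupport g) :
    integral o v (r • g) = r * integral o v g := by
  obtain ⟨s, hs⟩ := exists_finset_chartPartition (n := n) hg
  have hz : ∀ x ∉ tsupport g, g x = 0 := fun x hx => image_eq_zero_of_notMem_tsupport hx
  rw [integral_eq_sum o v g hz hs, integral_eq_sum o v (r • g) (fun x hx => by
      change r * g x = 0; rw [hz x hx, mul_zero]) hs, Finset.mul_sum]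
  refine Finset.sum_congr rfl fun c _ => ?_
  rw [← chartInt_smul]
  congr 1
  funext x
  change _ * ((r * g x) * _) = _
  ring

/-- The integral of compactly supported functions, extended to a linear map on all functions. -/
theorem exists_linear_integral (ho : IsLocallyConstant o) (v : PForm (Sm (n := n) M) n) :
    ∃ I : Sm (n := n) M →ₗ[ℝ] ℝ, ∀ g ∈ compactIdeal n M, I g = integral o v g := by
  let I₀ : (compactIdeal n M).restrictScalars ℝ →ₗ[ℝ] ℝ :=
    { toFun := fun g => integral o v g
      map_add' := fun g h => integral_add ho v g.2 h.2
      map_smul' := fun r g => integral_smul o v r g.2 }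
  obtain ⟨I, hI⟩ := I₀.exists_extend
  exact ⟨I, fun g hg => congrArg (fun J => J ⟨g, hg⟩) hI⟩

/-- A locally constant function, as a smooth function. -/
def ofLocConst (ho : IsLocallyConstant o) : Sm (n := n) M :=
  ⟨o, fun x => contMDiffAt_const.congr_of_eventuallyEq (ho.eventually_eq x)⟩

/-- Derivations do not increase supports. -/
theorem derivation_support (D : VF (Sm (n := n) M)) (g : Sm (n := n) M) :
    tsupport (D g) ⊆ tsupport g := by
  refine closure_minimal (fun x hx => ?_) (isClosed_tsupport _)
  by_contra h
  refine hx (derivation_const D 0 ?_)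
  filter_upwards [(isClosed_tsupport g).isOpen_compl.mem_nhds h] with y hy
  exact image_eq_zero_of_notMem_tsupport hy

/-- Stokes' theorem for functions supported in a chart: in coordinates, the integrand is
`∑ᵢ ∂ᵢ(a Dᵢ |V|)` up to a locally constant sign, for the coefficient `V` of `v`. -/
theorem integral_div_eq_zero_of_chart (ho : IsLocallyConstant o)
    {v : PForm (Sm (n := n) M) n}
    (hv : IsVolumeForm v) {D : VF (Sm (n := n) M)} {g : Sm (n := n) M} (hg : lieForm D v = g • v)
    {a : Sm (n := n) M} (ha : HasCompactSupport a) {c : M}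
    (hac : tsupport a ⊆ (chartAt (EuclideanSpace ℝ (Fin n)) c).source) :
    integral o v (D a + g * a) = 0 := by
  obtain ⟨F, U, hF, hKU⟩ := exists_isCoordFrame (n := n) c ha hac
  have hsub : tsupport (D a + g * a : Sm (n := n) M) ⊆ tsupport a :=
    (tsupport_add _ _).trans (union_subset (derivation_support D a) tsupport_mul_subset_right)
  have hcs : HasCompactSupport (D a + g * a : Sm (n := n) M) :=
    ha.of_isClosed_subset (isClosed_tsupport _) hsub
  rw [integral_eq_chartInt ho v hcs (hsub.trans hac), chartInt_eq_integral]
  set e := chartAt (EuclideanSpace ℝ (Fin n)) c with he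
  -- the flux in the `i`th coordinate direction, with the coefficient of `v` and with the density
  let b : Fin n → Sm (n := n) M := fun i => a * D (F.coord i) * v F.field
  let Φ : Fin n → EuclideanSpace ℝ (Fin n) → ℝ := fun i =>
    chartExt c (fun x => a x * (D (F.coord i) x * o x)) fun y => |coeff v c y|
  have hsupp : ∀ i, tsupport (fun x => a x * (D (F.coord i) x * o x)) ⊆ tsupport a :=
    fun i => tsupport_mul_subset_left
  have hsc : ∀ i, HasCompactSupport (fun x => a x * (D (F.coord i) x * o x)) :=
    fun i => ha.mul_right
  have hout : ∀ i, ∀ y ∉ e '' tsupport a, Φ i =ᶠ[𝓝 y] fun _ => 0 := fun i y hy =>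
    chartExt_eventuallyEq_zero (hsc i) ((hsupp i).trans hac) _
      fun h => hy (image_mono (hsupp i) h)
  -- near a point of the support, the density is, up to a constant sign, the coefficient of `v`
  have hin : ∀ x ∈ tsupport a, ∃ σ : ℝ, o x * |v F.field x| = σ * v F.field x ∧
      ∀ i, Φ i =ᶠ[𝓝 (e x)] fun y => σ * b i (e.symm y) := by
    intro x hx
    have hxs := hac hx
    have hne := hF.form_field_ne_zero hv (hKU hx)
    have hxt := e.map_source hxs
    have hU : e.symm (e x) ∈ U := by rw [e.left_inv hxs]; exact hKU hx
    have h1 := hF.coeff_eventuallyEq v hxt hU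
    have hcont : ContinuousAt (fun y => v F.field (e.symm y)) (e x) :=
      (v F.field).contMDiff.continuous.continuousAt.comp (e.continuousAt_symm hxt)
    have h2 : ∀ᶠ y in 𝓝 (e x), o (e.symm y) = o x := by
      have := (e.continuousAt_symm hxt).eventually (by
        rw [e.left_inv hxs]; exact ho.eventually_eq x)
      exact this
    have h3 : ∃ τ : ℝ, |v F.field x| = τ * v F.field x ∧
        ∀ᶠ y in 𝓝 (e x), |v F.field (e.symm y)| = τ * v F.field (e.symm y) := by
      rcases lt_or_gt_of_ne hne with h | h
      · refine ⟨-1, by rw [abs_of_neg h]; ring, ?_⟩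
        filter_upwards [hcont.eventually (gt_mem_nhds (a := 0) (by simpa only [e.left_inv hxs]))]
          with y hy
        rw [abs_of_neg hy]; ring
      · refine ⟨1, by rw [abs_of_pos h]; ring, ?_⟩
        filter_upwards [hcont.eventually (lt_mem_nhds (a := 0) (by simpa only [e.left_inv hxs]))]
          with y hy
        rw [abs_of_pos hy]; ring
    obtain ⟨τ, h3, h4⟩ := h3
    refine ⟨o x * τ, by rw [h3]; ring, fun i => ?_⟩
    filter_upwards [h1, h2, h4] with y hy1 hy2 hy4
    simp only [Φ]
    rw [chartExt_apply _ _ hy1.1, hy1.2.2]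
    change a (e.symm y) * (D (F.coord i) (e.symm y) * o (e.symm y)) * |v F.field (e.symm y)| =
      o x * τ * (a (e.symm y) * D (F.coord i) (e.symm y) * v F.field (e.symm y))
    rw [hy2, hy4]; ring
  have hsmooth : ∀ i, ContDiff ℝ 1 (Φ i) := by
    intro i
    refine contDiff_iff_contDiffAt.2 fun y => ?_
    by_cases hy : y ∈ e '' tsupport a
    · obtain ⟨x, hx, rfl⟩ := hy
      obtain ⟨σ, -, h2⟩ := hin x hx
      refine ContDiffAt.congr_of_eventuallyEq ?_ (h2 i)
      refine contDiffAt_const.mul ?_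
      have := (contDiffOn_comp_chart_symm (b i) c).contDiffAt
        (e.open_target.mem_nhds (e.map_source (hac hx)))
      exact this.of_le (by simp)
    · exact contDiffAt_const.congr_of_eventuallyEq (hout i y hy)
  have hcomp : ∀ i, HasCompactSupport (Φ i) := fun i =>
    hasCompactSupport_chartExt (hsc i) ((hsupp i).trans hac) _
  have hdiv : ∀ y, chartExt c (fun x => (D a + g * a : Sm (n := n) M) x * o x)
      (fun y => |coeff v c y|) y = ∑ i, fderiv ℝ (Φ i) y (EuclideanSpace.single i 1) := by
    intro y
    by_cases hy : y ∈ e '' tsupport a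
    · obtain ⟨x, hx, rfl⟩ := hy
      have hxs := hac hx
      have hxU := hKU hx
      obtain ⟨σ, h1, h2⟩ := hin x hx
      rw [chartExt_apply _ _ (e.map_source hxs), e.left_inv hxs, hF.coeff_eq v hxU, mul_assoc, h1]
      have h3 : ∀ i, fderiv ℝ (Φ i) (e x) (EuclideanSpace.single i 1) =
          σ * F.field i (b i) x := by
        intro i
        rw [(h2 i).fderiv_eq, hF.field_eq i x hxU,
          fderiv_const_mul (differentiableAt_comp_chart_symm (b i) c hxs)]
        rfl
      have h4 : ∀ i, F.field i (b i) x = v F.field x * (D (F.coord i) x * F.field i a x) +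
          a x * (D (F.coord i) x * F.field i (v F.field) x) +
          a x * (F.field i (D (F.coord i)) x * v F.field x) := by
        intro i
        simp only [b, Derivation.leibniz]
        change a x * D (F.coord i) x * F.field i (v F.field) x + v F.field x *
          (a x * F.field i (D (F.coord i)) x + D (F.coord i) x * F.field i a x) = _
        ring
      simp only [h3, h4]
      rw [← Finset.mul_sum, Finset.sum_add_distrib, Finset.sum_add_distrib, ← Finset.mul_sum,
        ← Finset.mul_sum, ← Finset.mul_sum, ← hF.derivation_apply D a hxU,
        ← hF.derivation_apply D (v F.field) hxU]
      have h5 := hF.div_apply hg hxU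
      change (D a x + g x * a x) * (σ * v F.field x) = _
      linear_combination σ * a x * h5
    · rw [Finset.sum_eq_zero fun i _ => by rw [(hout i y hy).fderiv_eq]; simp]
      refine chartExt_eq_zero _ _ fun h => hy (image_mono ?_ h)
      exact tsupport_mul_subset_left.trans hsub
  simp only [hdiv]
  rw [integral_finsetSum]
  · exact Finset.sum_eq_zero fun i _ => integral_fderiv_eq_zero (hsmooth i) (hcomp i) _
  · intro i _
    exact ((((hsmooth i).continuous_fderiv one_ne_zero).clm_apply continuous_const)
      ).integrable_of_hasCompactSupport ((hcomp i).fderiv_apply ℝ _)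

/-- Stokes' theorem: the integral of the divergence of a vector field with compact support
vanishes. -/
theorem integral_div_eq_zero (ho : IsLocallyConstant o)
    {v : PForm (Sm (n := n) M) n} (hv : IsVolumeForm v) {D : VF (Sm (n := n) M)}
    {g : Sm (n := n) M} (hg : lieForm D v = g • v) {a : Sm (n := n) M}
    (ha : HasCompactSupport a) : integral o v (D a + g * a) = 0 := by
  obtain ⟨I, hI⟩ := exists_linear_integral ho v
  obtain ⟨s, hs⟩ := exists_finset_chartPartition (n := n) ha
  let ρ : M → Sm (n := n) M := fun c => chartPartition n M c
  have hcs : ∀ {b : Sm (n := n) M}, HasCompactSupport b → D b + g * b ∈ compactIdeal n M :=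
    fun hb => (compactIdeal n M).add_mem
      (hb.of_isClosed_subset (isClosed_tsupport _) (derivation_support D _))
      ((compactIdeal n M).mul_mem_left _ hb)
  have hρ : ∀ c, HasCompactSupport (ρ c * a : Sm (n := n) M) := fun c => ha.mul_left
  have hsum : a = ∑ c ∈ s, ρ c * a := by
    ext x
    rw [sum_apply]
    change a x = ∑ c ∈ s, chartPartition n M c x * a x
    rw [← Finset.sum_mul]
    by_cases hx : x ∈ tsupport a
    · rw [sum_chartPartition hs hx, one_mul]
    · rw [image_eq_zero_of_notMem_tsupport hx, mul_zero]
  rw [← hI _ (hcs ha), hsum, map_sum, Finset.mul_sum, ← Finset.sum_add_distrib, map_sum]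
  refine Finset.sum_eq_zero fun c _ => ?_
  rw [hI _ (hcs (hρ c))]
  exact integral_div_eq_zero_of_chart ho hv hg (hρ c) (tsupport_chartPartition_mul c)

/-- The pairing of functions with compactly supported functions by integration is nondegenerate. -/
theorem eq_zero_of_integral_eq_zero (ho : IsLocallyConstant o) (ho' : ∀ x, o x = 1 ∨ o x = -1)
    {v : PForm (Sm (n := n) M) n} (hv : IsVolumeForm v) {a : Sm (n := n) M}
    (h : ∀ b ∈ compactIdeal n M, integral o v (b * a) = 0) : a = 0 := by
  ext x
  by_contra hx
  change a x ≠ 0 at hx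
  have hxs := mem_chart_source (EuclideanSpace ℝ (Fin n)) x
  obtain ⟨χ, h1, h2, h3⟩ := exists_bump_at (n := n) x
    ((chartAt (EuclideanSpace ℝ (Fin n)) x).open_source.mem_nhds hxs)
  -- with this test function, the integrand is `(χ a)²` times the density `|v|`
  let b : Sm (n := n) M := χ * (χ * a * ofLocConst ho)
  have hb : HasCompactSupport b := h2.mul_right
  have hbs : tsupport (b * a : Sm (n := n) M) ⊆
      (chartAt (EuclideanSpace ℝ (Fin n)) x).source :=
    (tsupport_mul_subset_left.trans tsupport_mul_subset_left).trans h3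
  have hba : HasCompactSupport (b * a : Sm (n := n) M) := hb.mul_right
  have h4 := h b hb
  rw [integral_eq_chartInt ho v hba hbs, chartInt_eq_integral] at h4
  have h5 : (fun y => (b * a : Sm (n := n) M) y * o y) = fun y => (χ y * a y) ^ 2 := by
    funext y
    change χ y * (χ y * a y * o y) * a y * o y = _
    have : o y * o y = 1 := by rcases ho' y with h | h <;> rw [h] <;> norm_num
    linear_combination (χ y * a y) ^ 2 * this
  rw [h5] at h4
  have hs : tsupport (fun y => (χ y * a y) ^ 2) ⊆ tsupport χ := by
    simp only [pow_two]
    exact tsupport_mul_subset_left.trans tsupport_mul_subset_left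
  have hc : HasCompactSupport (fun y => (χ y * a y) ^ 2) :=
    h2.of_isClosed_subset (isClosed_tsupport _) hs
  have hcont : Continuous fun y => (χ y * a y) ^ 2 :=
    (χ.contMDiff.continuous.mul a.contMDiff.continuous).pow 2
  refine (ne_of_gt ?_) h4
  refine (continuous_chartExt hcont hc (hs.trans h3)
    (continuousOn_coeff v x).abs).integral_pos_of_hasCompactSupport_nonneg_nonzero
    (hasCompactSupport_chartExt hc (hs.trans h3) _)
    (fun y => indicator_nonneg (fun y _ => mul_nonneg (sq_nonneg _) (abs_nonneg _)) y)
    (x := chartAt (EuclideanSpace ℝ (Fin n)) x x) ?_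
  rw [chartExt_apply _ _ ((chartAt _ x).map_source hxs), (chartAt _ x).left_inv hxs,
    h1.self_of_nhds, one_mul]
  exact mul_ne_zero (pow_ne_zero 2 hx) (abs_ne_zero.2 (coeff_ne_zero hv x hxs))

end Manifold

/-! ### Exterior multiplication by one-forms -/

section Algebra

variable {A : Type*} [CommRing A] [Algebra ℝ A]

/-- Exterior multiplication `α ↦ θ ∧ α` of differential forms by a one-form `θ`. -/
def wedge (θ : Module.Dual A (VF A)) : Form A →ₗ[A] Form A where
  toFun α
    | 0 => 0
    | p + 1 => AlternatingMap.alternatizeUncurryFin (θ.smulRight (α p))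
  map_add' α β := by
    funext p
    cases p with
    | zero => exact (add_zero _).symm
    | succ p =>
      change AlternatingMap.alternatizeUncurryFin (θ.smulRight (α p + β p)) = _ + _
      rw [← AlternatingMap.alternatizeUncurryFin_add]
      congr 1
      exact LinearMap.ext fun D => smul_add _ _ _
  map_smul' f α := by
    funext p
    cases p with
    | zero => exact (smul_zero f).symm
    | succ p =>
      change AlternatingMap.alternatizeUncurryFin (θ.smulRight (f • α p)) = f • _
      rw [← AlternatingMap.alternatizeUncurryFin_smul]
      congr 1
      exact LinearMap.ext fun D => smul_comm (θ D) f (α p)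

theorem wedge_succ (θ : Module.Dual A (VF A)) (α : Form A) (p : ℕ) :
    wedge θ α (p + 1) = AlternatingMap.alternatizeUncurryFin (θ.smulRight (α p)) := rfl

theorem wedge_single_eq_zero {n : ℕ} (hn : ∀ β : PForm A (n + 1), β = 0) (v : PForm A n)
    (θ : Module.Dual A (VF A)) : wedge θ (Pi.single n v) = 0 := by
  funext p
  cases p with
  | zero => rfl
  | succ p =>
    rcases eq_or_ne p n with rfl | hp
    · exact hn _
    · rw [wedge_succ, Pi.single_eq_of_ne hp]
      ext Y
      simp [AlternatingMap.alternatizeUncurryFin_apply]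

/-- The anticommutation rule `ι_D (θ ∧ α) = θ(D) α - θ ∧ ι_D α`. -/
theorem contractVF_wedge (D : VF A) (θ : Module.Dual A (VF A)) (α : Form A) :
    contractVF D (wedge θ α) = θ D • α - wedge θ (contractVF D α) := by
  funext p
  cases p with
  | zero =>
    ext Y
    change wedge θ α 1 (Matrix.vecCons D Y) = θ D * α 0 Y - 0
    rw [wedge_succ, AlternatingMap.alternatizeUncurryFin_apply]
    simp
  | succ p =>
    ext Y
    change wedge θ α (p + 2) (Fin.cons D Y) = θ D * α (p + 1) Y -
      wedge θ (contractVF D α) (p + 1) Y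
    rw [wedge_succ, wedge_succ, AlternatingMap.alternatizeUncurryFin_apply,
      AlternatingMap.alternatizeUncurryFin_apply, Fin.sum_univ_succ, sub_eq_add_neg,
      ← Finset.sum_neg_distrib]
    congr 1
    · simp
    · refine Finset.sum_congr rfl fun i _ => ?_
      have h : (i.succ.removeNth (Fin.cons D Y : Fin (p + 2) → VF A)) =
          Fin.cons D (i.removeNth Y) := removeNth_succ_cons D Y i
      rw [h, Fin.cons_succ, Fin.val_succ, pow_succ, mul_neg_one, neg_smul]
      rfl

/-- The commutation rule `θ ∧ ι_P α = ι_{θ ⌟ P} α ± ι_P (θ ∧ α)`. -/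
theorem wedge_contract (θ : Module.Dual A (VF A)) (P : MV A) (α : Form A) :
    wedge θ (contract P α) =
      contract (contractForm θ P) α + contract (CliffordAlgebra.involute P) (wedge θ α) := by
  induction P using CliffordAlgebra.left_induction generalizing α with
  | algebraMap f =>
    change wedge θ (contract (ofFun f) α) = contract (contractForm θ (ofFun f)) α +
      contract (CliffordAlgebra.involute (ofFun f)) (wedge θ α)
    rw [contractForm_ofFun, involute_ofFun, contract_ofFun,
      contract_ofFun, map_smul, map_zero, LinearMap.zero_apply, zero_add]
  | add P R hP hR => simp only [map_add, LinearMap.add_apply, hP, hR]; abel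
  | ι_mul P D hP =>
    change wedge θ (contract (ofVF D * P) α) = contract (contractForm θ (ofVF D * P)) α +
      contract (CliffordAlgebra.involute (ofVF D * P)) (wedge θ α)
    have h := contractVF_wedge D θ (contract P α)
    rw [hP, map_add] at h
    rw [contract_mul_apply, contractForm_ofVF_mul, involute_ofVF_mul, map_sub, map_neg, map_smul,
      contract_ofVF, LinearMap.sub_apply, LinearMap.neg_apply, LinearMap.smul_apply,
      contract_mul_apply, contract_mul_apply, contract_ofVF]
    rw [sub_add_eq_add_sub, sub_eq_iff_eq_add.1 h.symm]
    abel

/-- If there are no forms above the degree of `v`, then `φ_v` intertwines the contraction of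
multivector fields with a one-form and the exterior multiplication by this form. -/
theorem wedge_phi {n : ℕ} (hn : ∀ β : PForm A (n + 1), β = 0) (v : PForm A n)
    (θ : Module.Dual A (VF A)) (P : MV A) : wedge θ (phi v P) = phi v (contractForm θ P) := by
  change wedge θ (contract P _) = contract _ _
  rw [wedge_contract, wedge_single_eq_zero hn, map_zero, add_zero]

/-- For an `i`-vector field `P`, the form `φ_v(P)` is homogeneous of degree `n - i`. -/
theorem phi_apply_eq_zero {n : ℕ} (v : PForm A n) {i : ℕ} {P : MV A}
    (hP : P ∈ ⋀[A]^i (VF A)) {q : ℕ} (hq : i + q ≠ n) : phi v P q = 0 := by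
  refine exteriorPower_induction (C := fun i P => ∀ q, i + q ≠ n → phi v P q = 0)
    ?_ ?_ ?_ hP q hq
  · intro f q hq
    rw [phi_ofFun]
    exact Pi.single_eq_of_ne (by omega) _
  · intro i x y hx hy q hq
    rw [map_add]
    change phi v x q + phi v y q = 0
    rw [hx q hq, hy q hq, add_zero]
  · intro i D x _ hx q hq
    rw [phi_mul, contract_ofVF, contractVF_apply, hx (q + 1) (by omega)]
    rfl

theorem contractVF_single (D : VF A) {p : ℕ} (α : PForm A (p + 1)) :
    contractVF D (Pi.single (p + 1) α) = Pi.single p (α.curryLeft D) := by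
  funext q
  rw [contractVF_apply]
  rcases eq_or_ne q p with rfl | h
  · rw [Pi.single_eq_same, Pi.single_eq_same]
  · rw [Pi.single_eq_of_ne h, Pi.single_eq_of_ne (by omega)]
    rfl

theorem wedge_single (θ : Module.Dual A (VF A)) {p : ℕ} (α : PForm A p) :
    wedge θ (Pi.single p α) =
      Pi.single (p + 1) (AlternatingMap.alternatizeUncurryFin (θ.smulRight α)) := by
  funext q
  cases q with
  | zero => exact (Pi.single_eq_of_ne (by omega) _).symm
  | succ q =>
    rw [wedge_succ]
    rcases eq_or_ne q p with rfl | h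
    · rw [Pi.single_eq_same, Pi.single_eq_same]
    · rw [Pi.single_eq_of_ne h, Pi.single_eq_of_ne (by omega)]
      ext Y
      simp [AlternatingMap.alternatizeUncurryFin_apply]

/-- The function `α(Y₁, …, Y_p)` is an iterated contraction of `α`. -/
theorem exists_contract_single_eq {p : ℕ} (α : PForm A p) (Y : Fin p → VF A) :
    ∃ P, contract P (Pi.single p α : Form A) =
      Pi.single 0 (AlternatingMap.constOfIsEmpty A (VF A) (Fin 0) (α Y)) := by
  induction p with
  | zero =>
    refine ⟨1, ?_⟩
    rw [map_one, Module.End.one_apply]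
    congr 1
    ext Z
    rw [Subsingleton.elim Z Y]
    rfl
  | succ p ih =>
    obtain ⟨P, hP⟩ := ih (α.curryLeft (Y 0)) (Fin.tail Y)
    refine ⟨P * ofVF (Y 0), ?_⟩
    rw [contract_mul_apply, contract_ofVF, contractVF_single, hP]
    congr 2
    exact congrArg α (Fin.cons_self_tail Y)

namespace Frame

variable {n : ℕ} (F : Frame A n)

/-- Euler's identity `∑ⱼ Eⱼ (duⱼ ⌟ P) = i χ P` for `i`-vector fields. -/
theorem sum_field_mul_contractForm {i : ℕ} {P : MV A} (hP : P ∈ ⋀[A]^i (VF A)) :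
    ∑ j, ofVF (F.field j) * contractForm (dFun (F.coord j)) P = i • F.cut • P := by
  refine exteriorPower_induction (C := fun i P => ∑ j, ofVF (F.field j) *
    contractForm (dFun (F.coord j)) P = i • F.cut • P) ?_ ?_ ?_ hP
  · intro f
    simp
  · intro i x y hx hy
    simp only [map_add, mul_add, Finset.sum_add_distrib, hx, hy, smul_add]
  · intro i D x _ hx
    have h1 : ∑ j, D (F.coord j) • ofVF (F.field j) = F.cut • ofVF D := by
      rw [← map_smul, F.cut_smul, map_sum]
      simp only [map_smul]
    have h2 : ∀ j, ofVF (F.field j) * contractForm (dFun (F.coord j)) (ofVF D * x) =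
        (D (F.coord j) • ofVF (F.field j)) * x +
          ofVF D * (ofVF (F.field j) * contractForm (dFun (F.coord j)) x) := by
      intro j
      rw [contractForm_ofVF_mul, mul_sub, ← mul_assoc, ofVF_anticomm, neg_mul, sub_neg_eq_add,
        mul_smul_comm, smul_mul_assoc, mul_assoc]
      rfl
    rw [Finset.sum_congr rfl fun j _ => h2 j, Finset.sum_add_distrib, ← Finset.sum_mul,
      ← Finset.mul_sum, h1, hx, mul_smul_comm, mul_smul_comm, smul_mul_assoc, succ_nsmul']

/-- Euler's identity `∑ⱼ duⱼ ∧ ι_{Eⱼ} α = (p + 1) χ α` for `(p + 1)`-forms. -/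
theorem sum_wedge_contractVF {p : ℕ} (α : PForm A (p + 1)) :
    ∑ j, wedge (dFun (F.coord j)) (Pi.single p (α.curryLeft (F.field j))) =
      Pi.single (p + 1) ((p + 1) • F.cut • α) := by
  have h1 : ∑ j, (dFun (F.coord j)).smulRight (α.curryLeft (F.field j)) =
      F.cut • α.curryLeft := by
    refine LinearMap.ext fun D => ?_
    rw [LinearMap.sum_apply, LinearMap.smul_apply, ← map_smul, F.cut_smul, map_sum]
    simp only [map_smul]
    rfl
  have h2 : ∑ j, AlternatingMap.alternatizeUncurryFin
      ((dFun (F.coord j)).smulRight (α.curryLeft (F.field j))) = (p + 1) • F.cut • α := by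
    rw [smul_comm, ← AlternatingMap.alternatizeUncurryFin_curryLeft,
      ← AlternatingMap.alternatizeUncurryFin_smul, ← h1]
    exact (map_sum AlternatingMap.alternatizeUncurryFinLM _ _).symm
  simp only [wedge_single]
  rw [← h2]
  exact (map_sum (LinearMap.single A (fun p => PForm A p) (p + 1)) _ _).symm

/-- Injectivity of `φ_v` up to a power of the cutoff and the coefficient of `v`: the kernel of `φ_v`
is stable under contraction with one-forms, so that Euler's identity reduces the assertion to lower
degrees. -/
theorem smul_eq_zero_of_phi_eq_zero (hn : ∀ β : PForm A (n + 1), β = 0) (v : PForm A n) {i : ℕ}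
    {P : MV A} (hP : P ∈ ⋀[A]^i (VF A)) (h : phi v P = 0) :
    (F.cut ^ i * v F.field) • P = 0 := by
  induction i generalizing P with
  | zero =>
    obtain ⟨f, rfl⟩ := Submodule.mem_one.1 hP
    have h1 : f • v = 0 := by
      have := congrFun h n
      rw [phi_ofFun] at this
      simpa using this
    have h2 : f * v F.field = 0 := congrArg (fun α : PForm A n => α F.field) h1
    rw [pow_zero, one_mul, Algebra.smul_def, ← map_mul, mul_comm, h2, map_zero]
  | succ i ih =>
    have h1 : ∀ j, (F.cut ^ i * v F.field) • contractForm (dFun (F.coord j)) P = 0 := fun j =>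
      ih ((contractForm_mem _ hP).2 i rfl) (by rw [← wedge_phi hn, h, map_zero])
    have h2 := congrArg (fun R => (F.cut ^ i * v F.field) • R) (F.sum_field_mul_contractForm hP)
    simp only [Finset.smul_sum, ← mul_smul_comm, h1, mul_zero, Finset.sum_const_zero] at h2
    have h3 : ((i : ℝ) + 1) • (F.cut ^ (i + 1) * v F.field) • P = 0 := by
      rw [← Nat.cast_succ, Nat.cast_smul_eq_nsmul, h2, smul_comm _ (i + 1), smul_smul, pow_succ,
        mul_right_comm]
    have h4 : ((i : ℝ) + 1) ≠ 0 := by positivity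
    exact (smul_eq_zero_iff_right h4).1 h3

/-- Surjectivity of `φ_v` up to a power of the cutoff and the coefficient of `v`: the range of `φ_v`
is stable under exterior multiplication by one-forms, so that Euler's identity reduces the assertion
to lower degrees. -/
theorem exists_phi_eq_smul (hn : ∀ β : PForm A (n + 1), β = 0) (v : PForm A n) {p : ℕ}
    (α : PForm A p) : ∃ P, phi v P = (F.cut ^ p * v F.field) • (Pi.single p α : Form A) := by
  induction p with
  | zero =>
    obtain ⟨P, hP⟩ := exists_contract_single_eq v F.field
    refine ⟨α Fin.elim0 • P, ?_⟩
    rw [map_smul, show phi v P = _ from hP, ← Pi.single_smul, ← Pi.single_smul]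
    congr 1
    ext Z
    rw [Subsingleton.elim Z Fin.elim0]
    change α Fin.elim0 * v F.field = (F.cut ^ 0 * v F.field) * α Fin.elim0
    ring
  | succ p ih =>
    choose P hP using fun j => ih (α.curryLeft (F.field j))
    refine ⟨algebraMap ℝ A ((p : ℝ) + 1)⁻¹ • ∑ j, contractForm (dFun (F.coord j)) (P j), ?_⟩
    have h4 : ((p : ℝ) + 1) ≠ 0 := by positivity
    have h5 : algebraMap ℝ A ((p : ℝ) + 1)⁻¹ * ((p + 1 : ℕ) : A) = 1 := by
      rw [← map_natCast (algebraMap ℝ A), ← map_mul, Nat.cast_succ, inv_mul_cancel₀ h4, map_one]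
    rw [map_smul, map_sum]
    simp only [← wedge_phi hn, hP, map_smul]
    rw [← Finset.smul_sum, F.sum_wedge_contractVF, ← Nat.cast_smul_eq_nsmul A, Pi.single_smul,
      Pi.single_smul, smul_smul, smul_smul, smul_smul, ← one_mul (F.cut ^ (p + 1) * _), ← h5]
    congr 1
    ring

end Frame

end Algebra

/-! ### Bijectivity of `φ_v` on compact manifolds -/

section Manifold

open Set Topology

variable {n : ℕ} {M : Type*} [TopologicalSpace M] [ChartedSpace (EuclideanSpace ℝ (Fin n)) M]

/-- On a compact manifold, an ideal of functions without common zeros is the unit ideal. -/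
theorem ideal_eq_top [CompactSpace M] (J : Ideal (Sm (n := n) M)) (hJ : ∀ x, ∃ g ∈ J, g x ≠ 0) :
    J = ⊤ := by
  choose g hg hx using hJ
  obtain ⟨t, ht⟩ := isCompact_univ.elim_finite_subcover (fun x => {y | g x y ≠ 0})
    (fun x => isOpen_ne_fun (g x).contMDiff.continuous continuous_const)
    fun x _ => mem_iUnion.2 ⟨x, hx x⟩
  let s : Sm (n := n) M := ∑ x ∈ t, g x * g x
  have hs : ∀ y, s y ≠ 0 := by
    intro y
    obtain ⟨x, hxt, hy⟩ := mem_iUnion₂.1 (ht (mem_univ y))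
    refine ne_of_gt ?_
    rw [sum_apply]
    exact Finset.sum_pos' (fun i _ => mul_self_nonneg (g i y)) ⟨x, hxt, mul_self_pos.2 hy⟩
  let r : Sm (n := n) M := ⟨fun y => (s y)⁻¹, s.contMDiff.inv₀ hs⟩
  rw [Ideal.eq_top_iff_one]
  have h1 : r * s = 1 := by
    ext y
    exact inv_mul_cancel₀ (hs y)
  rw [← h1]
  exact J.mul_mem_left _ (J.sum_mem fun x _ => J.mul_mem_left _ (hg x))

variable [IsManifold (𝓡 n) ∞ M] [T2Space M] [SigmaCompactSpace M]

theorem exists_cut_pow_mul_ne_zero {v : PForm (Sm (n := n) M) n} (hv : IsVolumeForm v) (p : ℕ)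
    (x : M) : ∃ F : Frame (Sm (n := n) M) n, (F.cut ^ p * v F.field) x ≠ 0 := by
  obtain ⟨F, U, hF, hU⟩ := exists_isCoordFrame_at (n := n) x (mem_chart_source _ x)
  refine ⟨F, ?_⟩
  change F.cut x ^ p * v F.field x ≠ 0
  rw [hF.cut_eq x hU, one_pow, one_mul]
  exact hF.form_field_ne_zero hv hU

theorem phi_injective [CompactSpace M] {v : PForm (Sm (n := n) M) n} (hv : IsVolumeForm v) :
    Function.Injective (phi v) := by
  refine (injective_iff_map_eq_zero _).2 fun P hP => ?_
  classical
  let c := DirectSum.decompose (fun i : ℕ => ⋀[Sm (n := n) M]^i (VF (Sm (n := n) M))) P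
  have hsum : ∑ i ∈ c.support, (c i : MV (Sm (n := n) M)) = P := 
    DirectSum.sum_support_decompose (fun i : ℕ => ⋀[Sm (n := n) M]^i (VF (Sm (n := n) M))) P
  -- the images of the homogeneous components have different degrees
  have hc : ∀ i, phi v (c i) = 0 := by
    intro i
    funext q
    by_cases hq : i + q = n
    · have h1 := congrFun hP q
      rw [← hsum, map_sum, Finset.sum_apply] at h1
      refine Eq.trans (Eq.symm ?_) h1
      refine Finset.sum_eq_single i (fun j _ hj => ?_) fun hi => ?_
      · exact phi_apply_eq_zero v (c j).2 (by omega)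
      · rw [DFinsupp.notMem_support_iff.1 hi, ZeroMemClass.coe_zero, map_zero]
        rfl
    · exact phi_apply_eq_zero v (c i).2 hq
  rw [← hsum]
  refine Finset.sum_eq_zero fun i _ => ?_
  have h2 : Ideal.torsionOf (Sm (n := n) M) _ (c i : MV (Sm (n := n) M)) = ⊤ := by
    refine ideal_eq_top _ fun x => ?_
    obtain ⟨F, hF⟩ := exists_cut_pow_mul_ne_zero hv i x
    exact ⟨_, F.smul_eq_zero_of_phi_eq_zero (form_eq_zero_of_lt (Nat.lt_succ_self n)) v (c i).2
      (hc i), hF⟩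
  exact (Ideal.torsionOf_eq_top_iff _ _).1 h2

theorem phi_surjective [CompactSpace M] {v : PForm (Sm (n := n) M) n} (hv : IsVolumeForm v) :
    Function.Surjective (phi v) := by
  intro α
  have h1 : ∀ p, (Pi.single p (α p) : Form (Sm (n := n) M)) ∈ LinearMap.range (phi v) := by
    intro p
    have h2 : (LinearMap.range (phi v)).comap
        (LinearMap.toSpanSingleton _ _ (Pi.single p (α p) : Form (Sm (n := n) M))) = ⊤ := by
      refine ideal_eq_top _ fun x => ?_
      obtain ⟨F, hF⟩ := exists_cut_pow_mul_ne_zero hv p x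
      exact ⟨_, F.exists_phi_eq_smul (form_eq_zero_of_lt (Nat.lt_succ_self n)) v (α p), hF⟩
    have h3 : (1 : Sm (n := n) M) • (Pi.single p (α p) : Form (Sm (n := n) M)) ∈
        LinearMap.range (phi v) := (Ideal.eq_top_iff_one _).1 h2
    rwa [one_smul] at h3
  have h4 : α = ∑ p ∈ Finset.range (n + 1), Pi.single p (α p) := by
    funext q
    rw [Finset.sum_apply]
    by_cases hq : q ∈ Finset.range (n + 1)
    · rw [Finset.sum_eq_single_of_mem q hq fun p _ hp => Pi.single_eq_of_ne hp.symm _,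
        Pi.single_eq_same]
    · exact (form_eq_zero_of_lt (by simpa using hq) _).trans (form_eq_zero_of_lt (by simpa using hq)
        _).symm
  rw [h4]
  exact Submodule.sum_mem _ fun p _ => h1 p

end Manifold

/-! ### Divergences of Hamiltonian vector fields -/

section Manifold

open Set

variable {n : ℕ} {M : Type*} [TopologicalSpace M] [ChartedSpace (EuclideanSpace ℝ (Fin n)) M]

theorem formZero_phi_mul_mem (v : PForm (Sm (n := n) M) n) {f : MV (Sm (n := n) M)}
    {h : Sm (n := n) M} (hh : h ∈ compactIdeal n M) (hf : h • f = f) (G : MV (Sm (n := n) M)) :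
    formZero _ (phi v (f * G)) ∈ compactIdeal n M := by
  rw [← hf, smul_mul_assoc, map_smul, map_smul]
  exact Ideal.mul_mem_right _ _ hh

variable [IsManifold (𝓡 n) ∞ M] [T2Space M] [SigmaCompactSpace M]

/-- The ideal of compactly supported functions is locally unital. -/
theorem exists_mul_eq_of_mem_compactIdeal (h : Sm (n := n) M) (hh : h ∈ compactIdeal n M) :
    ∃ h' ∈ compactIdeal n M, h' * h = h := by
  obtain ⟨ψ, h1, h2, -⟩ := exists_bump (n := n) (K := tsupport h) hh isOpen_univ (subset_univ _)
  refine ⟨ψ, h2, ?_⟩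
  ext x
  change ψ x * h x = h x
  by_cases hx : x ∈ tsupport h
  · rw [h1.self_of_nhdsSet x hx, one_mul]
  · rw [image_eq_zero_of_notMem_tsupport hx, mul_zero]

/-- The Berezinian integrand of `[X, f]` has compact support if `f` has. -/
theorem formZero_phi_hamiltonian_mem (v : PForm (Sm (n := n) M) n) {i : ℕ}
    {X : MV (Sm (n := n) M)} (hX : X ∈ ⋀[Sm (n := n) M]^i (VF (Sm (n := n) M)))
    {f : MV (Sm (n := n) M)} {h : Sm (n := n) M} (hh : h ∈ compactIdeal n M) (hf : h • f = f) :
    formZero _ (phi v (hamiltonian X f)) ∈ compactIdeal n M := by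
  obtain ⟨h', hh', e⟩ := exists_mul_eq_of_mem_compactIdeal h hh
  -- `[X, f] = [X, h] f + h [X, f]` and `[X, h] = [X, h' h] = [X, h'] h + h' [X, h]`
  have key : ∀ (g : Sm (n := n) M) (R : MV (Sm (n := n) M)), hamiltonian X (g • R) =
      hamiltonian X (ofFun g) * R + g • hamiltonian X R := by
    intro g R
    rw [Algebra.smul_def, hamiltonian_mul hX (ofFun_mem g), mul_zero, pow_zero, one_smul,
      Algebra.smul_def]
  have h1 : hamiltonian X f = h • (hamiltonian X (ofFun h') * f + hamiltonian X f) +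
      h' • (hamiltonian X (ofFun h) * f) := by
    have e1 := key h f
    have e2 := key h' (ofFun h)
    have e3 : h' • (ofFun h : MV (Sm (n := n) M)) = ofFun h := by
      rw [Algebra.smul_def, ← map_mul, e]
    rw [e3] at e2
    have e4 : hamiltonian X (ofFun h') * ofFun h * f = h • (hamiltonian X (ofFun h') * f) := by
      rw [mul_assoc, ← Algebra.smul_def, mul_smul_comm]
    rw [hf] at e1
    conv_lhs => rw [e1, e2]
    rw [add_mul, e4, smul_mul_assoc, smul_add]
    abel
  rw [h1, map_add, map_smul, map_smul, map_add, map_smul, map_smul]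
  exact add_mem (Ideal.mul_mem_right _ _ hh) (Ideal.mul_mem_right _ _ hh')

variable {o : M → ℝ}

/-- The comparison of `Δ_v X` and `div Q_X`, with the sign in terms of the polyvector degree `i`. -/
theorem isBVLaplacian_iff_isDivergence (ho : IsLocallyConstant o)
    (ho' : ∀ x, o x = 1 ∨ o x = -1) {v : PForm (Sm (n := n) M) n} (hv : IsVolumeForm v) {i : ℕ}
    {X : MV (Sm (n := n) M)} (hX : X ∈ ⋀[Sm (n := n) M]^i (VF (Sm (n := n) M))) :
    (∃ Z, IsBVLaplacian v X Z) ∧ ∀ Z, IsBVLaplacian v X Z ↔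
      IsDivergence o v (hamiltonian X) ((2 * (-1 : ℝ) ^ (n * (i + 1))) • Z) := by
  obtain ⟨I, hI⟩ := exists_linear_integral ho v
  have hmem : ∀ (D : VF (Sm (n := n) M)) (g : Sm (n := n) M), ∀ a ∈ compactIdeal n M,
      D a + g * a ∈ compactIdeal n M := fun D g a ha =>
    add_mem (IsCompact.of_isClosed_subset ha (isClosed_tsupport _)
      (derivation_support D a)) (Ideal.mul_mem_left _ _ ha)
  obtain ⟨h1, h2⟩ := isBVLaplacian_iff_of_integral (v := v)
    (fun β => form_eq_zero_of_lt (Nat.lt_succ_self n) β) (exists_lieForm_eq_smul hv)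
    (compactIdeal n M) exists_mul_eq_of_mem_compactIdeal I
    (fun D g hg a ha => by rw [hI _ (hmem D g a ha)]; exact integral_div_eq_zero ho hv hg ha)
    (fun a ha => eq_zero_of_integral_eq_zero ho ho' hv fun b hb => by
      rw [← hI _ (Ideal.mul_mem_right _ _ hb)]; exact ha b hb) hX
  refine ⟨h1, fun Z => (h2 Z).trans ?_⟩
  refine forall_congr' fun f => forall_congr' fun ⟨h, hh, hf⟩ => ?_
  rw [hI _ (formZero_phi_hamiltonian_mem v hX hh hf), hI _ (formZero_phi_mul_mem v hh hf _)]
  rfl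

end Manifold

/-- The sign in terms of the degree `m = k i` of an `i`-vector field as a function on `T*[k]M`. -/
theorem neg_one_zpow_mul_succ {k : ℤ} (hk : Odd k) (n i : ℕ) :
    (-1 : ℝ) ^ ((n : ℤ) * (k * i + 1)) = (-1) ^ (n * (i + 1)) := by
  obtain ⟨r, rfl⟩ := hk
  rw [show (n : ℤ) * ((2 * r + 1) * i + 1) = ((n * (i + 1) : ℕ) : ℤ) + 2 * (n * r * i) by
    push_cast; ring, zpow_add₀ (by norm_num), zpow_mul _ 2, zpow_natCast]
  norm_num

end BVGeom

end

theorem mainTheorem2 {n : ℕ} {M : Type*} [TopologicalSpace M] [T2Space M] [SigmaCompactSpace M]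
    [ChartedSpace (EuclideanSpace ℝ (Fin n)) M] [IsManifold (𝓡 n) ∞ M]
    (o : M → ℝ) (ho : IsLocallyConstant o) (ho' : ∀ x, o x = 1 ∨ o x = -1)
    (v : BVGeom.PForm (BVGeom.Sm (n := n) M) n) (hv : BVGeom.IsVolumeForm v)
    (k : ℤ) (hk : Odd k) :
    (CompactSpace M → ∀ α : BVGeom.Form (BVGeom.Sm (n := n) M), ∃! X, BVGeom.phi v X = α) ∧
    ∀ (m : ℤ) (X : BVGeom.MV (BVGeom.Sm (n := n) M)), X ∈ BVGeom.degreePart k m →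
      BVGeom.IsGradedVectorField k (m - k) (BVGeom.hamiltonian X) ∧
      (∃ Z, BVGeom.IsBVLaplacian v X Z) ∧
      ∀ Z, BVGeom.IsBVLaplacian v X Z ↔
        BVGeom.IsDivergence o v (BVGeom.hamiltonian X)
          ((2 * (-1 : ℝ) ^ ((n : ℤ) * (m + 1))) • Z) := by
  refine ⟨fun _ => (Function.bijective_iff_existsUnique _).1
    ⟨BVGeom.phi_injective hv, BVGeom.phi_surjective hv⟩,
    fun m X hX => ⟨BVGeom.isGradedVectorField_hamiltonian hk hX, ?_⟩⟩
  -- the zero multivector field has every degree; it is regarded as an `|m|`-vector field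
  have hi : ∃ i : ℕ, X ∈ ⋀[BVGeom.Sm (n := n) M]^i (BVGeom.VF (BVGeom.Sm (n := n) M)) ∧
      (-1 : ℝ) ^ ((n : ℤ) * (m + 1)) = (-1) ^ (n * (i + 1)) := by
    rcases BVGeom.eq_zero_or_exists_of_mem_degreePart hk hX with rfl | ⟨i, rfl, hi⟩
    · refine ⟨m.natAbs, zero_mem _, ?_⟩
      rcases Int.natAbs_eq m with h | h
      · have := BVGeom.neg_one_zpow_mul_succ (k := 1) odd_one n m.natAbs
        rwa [one_mul, ← h] at this
      · have := BVGeom.neg_one_zpow_mul_succ (k := -1) odd_one.neg n m.natAbs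
        rwa [neg_one_mul, ← h] at this
    · exact ⟨i, hi, BVGeom.neg_one_zpow_mul_succ hk n i⟩
  obtain ⟨i, hi, hs⟩ := hi
  rw [hs]
  exact BVGeom.isBVLaplacian_iff_isDivergence ho ho' hv hi
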